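/- Let $n\ge 1$. An \emph{$n$-polytope} in $\mathbb{R}^n$ is the convex hull of a finite set of points that has dimension $n$; $V_n$ is Lebesgue measure. For a convex body $K\subset\mathbb{R}^n$ (compact, convex, with nonempty interior) and a unit vector $u$, let $F(K,u)=\{x\in K:\langle u,x\rangle=\max_{y\in K}\langle u,y\rangle\}$. We say that $K$ and $-K$ are \emph{in general relative position} if, for every unit vector $u$, $\dim(F(K,u)+F(K,-u))=n-1$ implies $\dim F(K,u)+\dim F(K,-u)=n-1$. An \emph{affine diameter} of $K$ is a closed segment joining two points of $K$ that lie in distinct parallel supporting hyperplanes of $K$. Let $N_a(K,z)\in\{0,1,2,\dots\}\cup\{\infty\}$ be the number of affine diameters of $K$ passing through the point $z$, and let $$N_a(K)=\frac{1}{V_n(K)}\int_K N_a(K,z)\,dz .$$ Theorem. Let $P\subset\mathbb{R}^n$ be an $n$-polytope such that $P$ and $-P$ are in general relative position. Then $N_a(P,\cdot)$ is Lebesgue measurable on $P$, $N_a(P)$ is finite, and $$N_a(P)=\frac{n+1}{V_n(P)}\int_0^1 V_n((1-t)P-tP)\,dt-1,$$ where $(1-t)P-tP=\{(1-t)x-ty: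 x,y\in P\}$. Moreover $$n\le N_a(P)\le 2^n-1,$$ with equality on the right-hand side if and only if $P$ is an $n$-simplex. If $n\ge 2$, then $n<N_a(P)$. The lower bound $n$ is sharp: for every real $c>n$ there is an $n$-polytope $P\subset\mathbb{R}^n$ such that $P$ and $-P$ are in general relative position and $N_a(P)<c$. -/

import Mathlib

open MeasureTheory
open scoped Pointwise ENNReal

noncomputable section

namespace AffineDiam

variable {n : ℕ}

/-- The dimension of a (nonempty) subset of `ℝⁿ`: the dimension of its affine hull. -/
def setDim (A : Set (EuclideanSpace ℝ (Fin n))) : ℕ :=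
  Module.finrank ℝ (vectorSpan ℝ A)

/-- An `n`-polytope in `ℝⁿ`: the convex hull of a nonempty finite set of points, of full
dimension `n`. -/
def IsFullPolytope (P : Set (EuclideanSpace ℝ (Fin n))) : Prop :=
  (∃ V : Set (EuclideanSpace ℝ (Fin n)), V.Finite ∧ V.Nonempty ∧ P = convexHull ℝ V) ∧
    setDim P = n

/-- An `n`-simplex in `ℝⁿ`: the convex hull of `n + 1` affinely independent points. -/
def IsFullSimplex (P : Set (EuclideanSpace ℝ (Fin n))) : Prop :=
  ∃ p : Fin (n + 1) → EuclideanSpace ℝ (Fin n),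
    AffineIndependent ℝ p ∧ P = convexHull ℝ (Set.range p)

/-- The support set `F(K, u)`: the points of `K` at which `⟪u, ·⟫` attains its maximum on `K`,
that is, the intersection of `K` with its supporting hyperplane with outer normal `u`. -/
def suppSet (K : Set (EuclideanSpace ℝ (Fin n))) (u : EuclideanSpace ℝ (Fin n)) :
    Set (EuclideanSpace ℝ (Fin n)) :=
  {x | x ∈ K ∧ ∀ y ∈ K, inner ℝ u y ≤ inner ℝ u x}

/-- `K` and `-K` are in general relative position: for every unit vector `u`,
`dim (F(K, u) + F(K, -u)) = n - 1` implies `dim F(K, u) + dim F(K, -u) = n - 1`. -/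
def GeneralRelPos (K : Set (EuclideanSpace ℝ (Fin n))) : Prop :=
  ∀ u : EuclideanSpace ℝ (Fin n), ‖u‖ = 1 →
    setDim (suppSet K u + suppSet K (-u)) + 1 = n →
      setDim (suppSet K u) + setDim (suppSet K (-u)) + 1 = n

/-- `S` is an affine diameter of `K`: a closed segment joining two points of `K` that lie in
distinct parallel supporting hyperplanes of `K`. -/
def IsAffineDiameter (K S : Set (EuclideanSpace ℝ (Fin n))) : Prop :=
  ∃ u : EuclideanSpace ℝ (Fin n), ‖u‖ = 1 ∧
    ∃ x ∈ suppSet K u, ∃ y ∈ suppSet K (-u),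
      inner ℝ u x ≠ inner ℝ u y ∧ S = segment ℝ x y

/-- `N_a(K, z)`: the number (possibly `∞`) of affine diameters of `K` passing through `z`. -/
def numDiam (K : Set (EuclideanSpace ℝ (Fin n))) (z : EuclideanSpace ℝ (Fin n)) : ℝ≥0∞ :=
  ((Set.encard {S : Set (EuclideanSpace ℝ (Fin n)) | IsAffineDiameter K S ∧ z ∈ S} : ℕ∞) : ℝ≥0∞)

/-- `N_a(K)`: the mean number (possibly `∞`) of affine diameters through a point of `K`,
`(1 / V_n(K)) ∫_K N_a(K, z) dz`. -/
def meanDiam (K : Set (EuclideanSpace ℝ (Fin n))) : ℝ≥0∞ :=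
  (∫⁻ z in K, numDiam K z) / volume K

end AffineDiam

end

open MeasureTheory
open scoped Pointwise ENNReal

noncomputable section

namespace AffineDiam

variable {n : ℕ}

local notation "𝔼" n => EuclideanSpace ℝ (Fin n)

/-! ### The Prékopa-Leindler and Brunn-Minkowski inequalities. -/

section

/-! Counting. Call a unit vector u a facet normal if F(P,u) + F(P,-u) has dimension n - 1; there are
finitely many. For any other direction the segments joining F(P,u) to F(P,-u) fill a null set, and
only finitely many pairs of faces occur. For a facet normal, general relative position makes the
direction spaces of the two faces complementary in the hyperplane orthogonal to u, so a point of the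
join J(u) of the faces, off the faces themselves, lies on exactly one joining segment. Hence the
integral of N_a is the sum of V(J(u)) over antipodal pairs of facet normals (`numDiam_ae_eq`,
`setLIntegral_numDiam`).

The formula. If 0 is interior to P, then sP - tP is dissected, up to null sets, into -tP and the
layers swept out by θF(P,u) - tF(P,-u), 0 ≤ θ ≤ s (`volume_smul_sub_smul`). In coordinates adapted
to the two faces, the volumes of J(u) and of the layers of u and -u are explicit one-dimensional
integrals with one common constant (`exists_const_volume_sweep`, `facet_volumes`). For s = 1 - t,
integration over t gives Beta integrals: -tP contributes V(P)/(n+1) and each antipodal pair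
V(J(u))/(n+1).

Lower bound. Brunn-Minkowski gives V((1-t)P - tP) ≥ V(P). For n ≥ 2 some facet of P lies opposite a
vertex. A cap of relative height δ at the vertex has volume O(δ^n), but half the difference of the
facet and that cap has volume at least of order δ; Brunn-Minkowski on the remaining parts then makes
the inequality strict at t = 1/2 (`volumeReal_lt`).

Upper bound. This is a Rogers-Shephard argument: the volumes of (1-t)K ∩ (w + tK) are integrated
over all (w,t). The total is a Beta integral times V(K)², while each intersection contains a
homothet of K (`rogers_shephard`). Equality forces the sets K ∩ (K + v) to be homothets of K
(`mem_homothet_of_ae_eq`), which makes the extreme points of K affinely independent. Conversely,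
each proper splitting of the vertices of a simplex gives an affine diameter through each interior
point, 2^n - 1 in all.

Sharpness. A generic perturbation of the cross-polytope is in general relative position to its
reflection, and lies between two nearly equal centrally symmetric bodies (`exists_meanDiam_lt`). -/

/-- With a the maximum of A and b the minimum of B, the translates A + b and a + B both lie in C and
meet only in a + b. -/
lemma volume_add_volume_le_of_isCompact {A B C : Set ℝ} (hA : IsCompact A) (hB : IsCompact B)
    (hA0 : A.Nonempty) (hB0 : B.Nonempty) (h : ∀ a ∈ A, ∀ b ∈ B, a + b ∈ C) :
    volume A + volume B ≤ volume C := by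
  obtain ⟨a, ha, hamax⟩ := hA.exists_isGreatest hA0
  obtain ⟨b, hb, hbmin⟩ := hB.exists_isLeast hB0
  have h1 : volume ((fun x => x + b) '' A) = volume A := by
    rw [Set.image_add_right, measure_preimage_add_right]
  have h2 : volume ((fun x => a + x) '' B) = volume B := by
    rw [Set.image_add_left, measure_preimage_add]
  have hmA : MeasurableSet ((fun x => x + b) '' A) :=
    (hA.image (by fun_prop)).isClosed.measurableSet
  have hdisj : AEDisjoint volume ((fun x => x + b) '' A) ((fun x => a + x) '' B) := by
    refine measure_mono_null (t := {a + b}) ?_ (by simp)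
    rintro _ ⟨⟨x, hx, rfl⟩, ⟨y, hy, hxy⟩⟩
    have := hamax hx
    have := hbmin hy
    simp only [Set.mem_singleton_iff] at *
    linarith
  rw [← h1, ← h2, ← measure_union₀' hmA.nullMeasurableSet hdisj]
  refine measure_mono ?_
  rintro _ (⟨x, hx, rfl⟩ | ⟨x, hx, rfl⟩)
  · exact h _ hx _ hb
  · exact h _ ha _ hx

/-- Inner regularity reduces this to compact sets; a fixed point is inserted in each compact subset
to keep it nonempty. -/
lemma volume_add_volume_le {A B C : Set ℝ} (hA : MeasurableSet A) (hB : MeasurableSet B)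
    (hA0 : A.Nonempty) (hB0 : B.Nonempty) (h : ∀ a ∈ A, ∀ b ∈ B, a + b ∈ C) :
    volume A + volume B ≤ volume C := by
  obtain ⟨a, ha⟩ := hA0
  obtain ⟨b, hb⟩ := hB0
  rw [hA.measure_eq_iSup_isCompact, hB.measure_eq_iSup_isCompact]
  simp only [iSup_and']
  refine ENNReal.biSup_add_biSup_le' (p := fun K => K ⊆ A ∧ IsCompact K)
    (q := fun K => K ⊆ B ∧ IsCompact K) ⟨∅, by simp⟩ ⟨∅, by simp⟩ ?_
  rintro K ⟨hKA, hK⟩ K' ⟨hKB, hK'⟩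
  refine le_trans (add_le_add (measure_mono (Set.subset_insert a K))
    (measure_mono (Set.subset_insert b K'))) ?_
  refine volume_add_volume_le_of_isCompact (hK.insert a) (hK'.insert b) (by simp) (by simp) ?_
  intro x hx y hy
  exact h x (Set.insert_subset ha hKA hx) y (Set.insert_subset hb hKB hy)

/-- Layer-cake formula: the one-dimensional sumset inequality is applied to the superlevel sets at
each height l. It needs both sets nonempty, which is why both functions have supremum 1: for l < 1
both sets are nonempty, and for l ≥ 1 both are empty. -/
lemma lintegral_le_of_superlevel {t : ℝ} (ht0 : 0 < t) (ht1 : t < 1) {f g h : ℝ → ℝ}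
    (hf : Measurable f) (hg : Measurable g) (hh : Measurable h)
    (hf0 : ∀ x, 0 ≤ f x) (hg0 : ∀ x, 0 ≤ g x) (hh0 : ∀ x, 0 ≤ h x)
    (hf1 : ∀ x, f x ≤ 1) (hg1 : ∀ x, g x ≤ 1)
    (hfs : ∀ l < 1, ∃ x, l < f x) (hgs : ∀ l < 1, ∃ x, l < g x)
    (hfg : ∀ l, 0 < l → ∀ x y, l < f x → l < g y → l < h ((1 - t) * x + t * y)) :
    ENNReal.ofReal (1 - t) * (∫⁻ x, ENNReal.ofReal (f x)) +
      ENNReal.ofReal t * (∫⁻ x, ENNReal.ofReal (g x)) ≤ ∫⁻ x, ENNReal.ofReal (h x) := by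
  rw [lintegral_eq_lintegral_meas_lt _ (ae_of_all _ hf0) hf.aemeasurable,
    lintegral_eq_lintegral_meas_lt _ (ae_of_all _ hg0) hg.aemeasurable,
    lintegral_eq_lintegral_meas_lt _ (ae_of_all _ hh0) hh.aemeasurable]
  have anti : ∀ k : ℝ → ℝ, Measurable fun l => volume {a | l < k a} := fun k =>
    Antitone.measurable fun a b hab => measure_mono fun x hx => lt_of_le_of_lt hab hx
  rw [← lintegral_const_mul _ (anti f), ← lintegral_const_mul _ (anti g),
    ← lintegral_add_left ((anti f).const_mul _)]
  refine setLIntegral_mono (anti h) fun l hl => ?_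
  rcases lt_or_ge l 1 with hl1 | hl1
  · have hs : ∀ (c : ℝ), 0 < c → ∀ S : Set ℝ,
        ENNReal.ofReal c * volume S = volume (c • S) := by
      intro c hc S
      rw [Measure.addHaar_smul_of_nonneg _ hc.le]; simp
    rw [hs _ (by linarith), hs _ ht0]
    refine volume_add_volume_le (MeasurableSet.const_smul₀ (measurableSet_lt measurable_const hf) _)
      (MeasurableSet.const_smul₀ (measurableSet_lt measurable_const hg) _) ?_ ?_ ?_
    · obtain ⟨x, hx⟩ := hfs l hl1
      exact Set.Nonempty.smul_set ⟨x, hx⟩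
    · obtain ⟨x, hx⟩ := hgs l hl1
      exact Set.Nonempty.smul_set ⟨x, hx⟩
    · rintro _ ⟨x, hx, rfl⟩ _ ⟨y, hy, rfl⟩
      exact hfg l hl x y hx hy
  · have e1 : {a | l < f a} = ∅ := by
      ext a; simpa using (hf1 a).trans hl1
    have e2 : {a | l < g a} = ∅ := by
      ext a; simpa using (hg1 a).trans hl1
    simp [e1, e2]

lemma ENNReal_geom_mean_le_arith_mean {t : ℝ} (ht0 : 0 < t) (ht1 : t < 1) (a b : ℝ≥0∞) :
    a ^ (1 - t) * b ^ t ≤ ENNReal.ofReal (1 - t) * a + ENNReal.ofReal t * b := by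
  have h1t : 0 < 1 - t := by linarith
  have w1 : ENNReal.ofReal (1 - t) ≠ 0 := by simpa using h1t
  have w2 : ENNReal.ofReal t ≠ 0 := by simpa using ht0
  rcases eq_or_ne a ∞ with rfl | ha
  · rw [ENNReal.mul_top w1]; simp
  rcases eq_or_ne b ∞ with rfl | hb
  · rw [ENNReal.mul_top w2]; simp
  lift a to NNReal using ha
  lift b to NNReal using hb
  rw [← ENNReal.coe_rpow_of_nonneg _ h1t.le, ← ENNReal.coe_rpow_of_nonneg _ ht0.le,
    ENNReal.ofReal, ENNReal.ofReal]
  norm_cast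
  have := NNReal.geom_mean_le_arith_mean2_weighted (1 - t).toNNReal t.toNNReal a b (by
    rw [← Real.toNNReal_add h1t.le ht0.le]; simp)
  rwa [Real.coe_toNNReal _ h1t.le, Real.coe_toNNReal _ ht0.le] at this

/-- The one-dimensional Prékopa-Leindler inequality, for bounded functions. -/
lemma prekopa_leindler_real {t : ℝ} (ht0 : 0 < t) (ht1 : t < 1) {f g h : ℝ → ℝ}
    (hf : Measurable f) (hg : Measurable g) (hh : Measurable h)
    (hf0 : ∀ x, 0 ≤ f x) (hg0 : ∀ x, 0 ≤ g x) (hh0 : ∀ x, 0 ≤ h x) {M : ℝ}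
    (hf1 : ∀ x, f x ≤ M) (hg1 : ∀ x, g x ≤ M)
    (hfg : ∀ x y, f x ^ (1 - t) * g y ^ t ≤ h ((1 - t) * x + t * y)) :
    (∫⁻ x, ENNReal.ofReal (f x)) ^ (1 - t) * (∫⁻ x, ENNReal.ofReal (g x)) ^ t ≤
      ∫⁻ x, ENNReal.ofReal (h x) := by
  have h1t : 0 < 1 - t := by linarith
  have bf : BddAbove (Set.range f) := ⟨M, by rintro _ ⟨x, rfl⟩; exact hf1 x⟩
  have bg : BddAbove (Set.range g) := ⟨M, by rintro _ ⟨x, rfl⟩; exact hg1 x⟩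
  have lef : ∀ x, f x ≤ ⨆ x, f x := fun x => le_ciSup bf x
  have leg : ∀ x, g x ≤ ⨆ x, g x := fun x => le_ciSup bg x
  have key : ∀ k : ℝ → ℝ, ∀ c, (∀ x, k x ≤ c) → c ≤ 0 → ∫⁻ x, ENNReal.ofReal (k x) = 0 := by
    intro k c hk hc
    simp [ENNReal.ofReal_of_nonpos ((hk _).trans hc)]
  rcases le_or_gt (⨆ x, f x) 0 with ha | ha
  · rw [key f _ lef ha, ENNReal.zero_rpow_of_pos h1t]; simp
  rcases le_or_gt (⨆ x, g x) 0 with hb | hb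
  · rw [key g _ leg hb, ENNReal.zero_rpow_of_pos ht0]; simp
  set a := ⨆ x, f x
  set b := ⨆ x, g x
  set c := a ^ (1 - t) * b ^ t with hc
  have hcpos : 0 < c := by positivity
  have exf : ∀ l < 1, ∃ x, l < f x / a := by
    intro l hl
    obtain ⟨x, hx⟩ := exists_lt_of_lt_ciSup (show l * a < ⨆ x, f x by
      change l * a < a; nlinarith)
    exact ⟨x, (lt_div_iff₀ ha).2 hx⟩
  have exg : ∀ l < 1, ∃ x, l < g x / b := by
    intro l hl
    obtain ⟨x, hx⟩ := exists_lt_of_lt_ciSup (show l * b < ⨆ x, g x by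
      change l * b < b; nlinarith)
    exact ⟨x, (lt_div_iff₀ hb).2 hx⟩
  -- Dividing by the suprema a and b, and `h` by their weighted geometric mean c, preserves the
  -- hypothesis and equalizes the suprema. The resulting additive inequality is stronger than the
  -- multiplicative one, by the weighted arithmetic-geometric mean inequality.
  have main := lintegral_le_of_superlevel ht0 ht1 (f := fun x => f x / a) (g := fun x => g x / b)
    (h := fun x => h x / c) (hf.div_const _) (hg.div_const _) (hh.div_const _)
    (fun x => div_nonneg (hf0 x) ha.le) (fun x => div_nonneg (hg0 x) hb.le)
    (fun x => div_nonneg (hh0 x) hcpos.le)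
    (fun x => (div_le_one ha).2 (lef x)) (fun x => (div_le_one hb).2 (leg x)) exf exg (by
      intro l hl x y hx hy
      refine lt_of_lt_of_le ?_ (div_le_div_of_nonneg_right (hfg x y) hcpos.le)
      have e : f x ^ (1 - t) * g y ^ t / c = (f x / a) ^ (1 - t) * (g y / b) ^ t := by
        rw [Real.div_rpow (hf0 x) ha.le, Real.div_rpow (hg0 y) hb.le, hc]
        field_simp
      rw [e]
      calc l = l ^ (1 - t) * l ^ t := by
            rw [← Real.rpow_add hl]; simp
        _ < _ := mul_lt_mul'' (Real.rpow_lt_rpow hl.le hx h1t) (Real.rpow_lt_rpow hl.le hy ht0)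
            (by positivity) (by positivity))
  have scale : ∀ k : ℝ → ℝ, Measurable k → ∀ d : ℝ, 0 < d →
      ∫⁻ x, ENNReal.ofReal (k x) = ENNReal.ofReal d * ∫⁻ x, ENNReal.ofReal (k x / d) := by
    intro k hk d hd
    rw [← lintegral_const_mul _ (by fun_prop)]
    refine lintegral_congr fun x => ?_
    rw [← ENNReal.ofReal_mul hd.le, mul_div_cancel₀ _ hd.ne']
  rw [scale f hf a ha, scale g hg b hb, scale h hh c hcpos,
    ENNReal.mul_rpow_of_nonneg _ _ h1t.le, ENNReal.mul_rpow_of_nonneg _ _ ht0.le,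
    mul_mul_mul_comm, ENNReal.ofReal_rpow_of_pos ha, ENNReal.ofReal_rpow_of_pos hb,
    ← ENNReal.ofReal_mul (by positivity)]
  gcongr
  exact (ENNReal_geom_mean_le_arith_mean ht0 ht1 _ _).trans main

/-- The multiplicative Brunn-Minkowski inequality for compact subsets of `ℝⁿ`. -/
lemma brunn_minkowski_pi {t : ℝ} (ht0 : 0 < t) (ht1 : t < 1) (n : ℕ) :
    ∀ A B C : Set (Fin n → ℝ), IsCompact A → IsCompact B → IsCompact C →
      (∀ x ∈ A, ∀ y ∈ B, (1 - t) • x + t • y ∈ C) →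
      volume A ^ (1 - t) * volume B ^ t ≤ volume C := by
  have h1t : 0 < 1 - t := by linarith
  induction n with
  | zero =>
    intro A B C hA hB hC h
    rcases A.eq_empty_or_nonempty with rfl | ⟨a, ha⟩
    · simp [h1t]
    rcases B.eq_empty_or_nonempty with rfl | ⟨b, hb⟩
    · simp [ht0]
    have : ∀ S : Set (Fin 0 → ℝ), S.Nonempty → volume S = 1 := by
      intro S hS
      rw [Subsingleton.eq_univ_of_nonempty hS]
      simp [Measure.volume_pi_eq_dirac (0 : Fin 0 → ℝ)]
    rw [this A ⟨a, ha⟩, this B ⟨b, hb⟩, this C ⟨_, h a ha b hb⟩]; simp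
  | succ n ih =>
    intro A B C hA hB hC h
    let e := MeasurableEquiv.piFinSuccAbove (fun _ : Fin (n + 1) => ℝ) 0
    have he : MeasurePreserving e := volume_preserving_piFinSuccAbove (fun _ => ℝ) 0
    let sl : Set (Fin (n + 1) → ℝ) → ℝ → Set (Fin n → ℝ) :=
      fun S r => {x | (Fin.cons r x : Fin (n + 1) → ℝ) ∈ S}
    have contcons : Continuous fun p : ℝ × (Fin n → ℝ) => (Fin.cons p.1 p.2 : Fin (n + 1) → ℝ) := by
      refine continuous_pi fun i => ?_
      refine Fin.cases ?_ (fun j => ?_) i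
      · simpa using continuous_fst
      · simp only [Fin.cons_succ]; fun_prop
    have hesymm : ∀ p : ℝ × (Fin n → ℝ), e.symm p = Fin.cons p.1 p.2 := fun p => by
      ext i; refine Fin.cases ?_ (fun j => ?_) i <;> simp [e]
    have pre : ∀ S, e.symm ⁻¹' S = {p : ℝ × (Fin n → ℝ) | p.2 ∈ sl S p.1} := by
      intro S; ext p; simp only [Set.mem_preimage, hesymm]; rfl
    have hvol : ∀ S, IsCompact S → volume S = ∫⁻ r, volume (sl S r) := by
      intro S hS
      rw [← he.symm.measure_preimage hS.measurableSet.nullMeasurableSet, pre,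
        Measure.volume_eq_prod, Measure.prod_apply]
      · rfl
      · rw [← pre]; exact e.symm.measurable hS.measurableSet
    have hmeas : ∀ S, IsCompact S → Measurable fun r => volume (sl S r) := by
      intro S hS
      exact measurable_measure_prodMk_left (ν := (volume : Measure (Fin n → ℝ)))
        (s := {p : ℝ × (Fin n → ℝ) | p.2 ∈ sl S p.1})
        (by rw [← pre]; exact e.symm.measurable hS.measurableSet)
    let tail : (Fin (n + 1) → ℝ) → (Fin n → ℝ) := fun x i => x i.succ
    have ctail : Continuous tail := by fun_prop
    have slsub : ∀ S r, sl S r ⊆ tail '' S := by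
      intro S r x hx
      exact ⟨_, hx, by ext i; simp [tail]⟩
    have slcomp : ∀ S r, IsCompact S → IsCompact (sl S r) := by
      intro S r hS
      refine (hS.image ctail).of_isClosed_subset ?_ (slsub S r)
      exact hS.isClosed.preimage (contcons.comp (by fun_prop : Continuous fun x => (r, x)))
    have fin : ∀ S r, IsCompact S → volume (sl S r) ≠ ∞ := fun S r hS =>
      (slcomp S r hS).measure_lt_top.ne
    have eqr : ∀ S, IsCompact S → volume S = ∫⁻ r, ENNReal.ofReal (volume.real (sl S r)) := by
      intro S hS
      rw [hvol S hS]
      exact lintegral_congr fun r => (ENNReal.ofReal_toReal (fin S r hS)).symm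
    have bd : ∀ S, IsCompact S → ∀ r, volume.real (sl S r) ≤ volume.real (tail '' S) :=
      fun S hS r => measureReal_mono (slsub S r) (hS.image ctail).measure_lt_top.ne
    rw [eqr A hA, eqr B hB, eqr C hC]
    -- Prékopa-Leindler is applied to the slice volumes as functions of the first coordinate; its
    -- pointwise hypothesis is the induction hypothesis for slices. All slices lie in the projection
    -- `tail`, which gives the bound M.
    refine prekopa_leindler_real ht0 ht1 (hmeas A hA).ennreal_toReal (hmeas B hB).ennreal_toReal
      (hmeas C hC).ennreal_toReal (fun _ => measureReal_nonneg) (fun _ => measureReal_nonneg)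
      (fun _ => measureReal_nonneg)
      (M := max (volume.real (tail '' A)) (volume.real (tail '' B)))
      (fun r => (bd A hA r).trans (le_max_left _ _)) (fun r => (bd B hB r).trans (le_max_right _ _))
      ?_
    intro r s
    have := ih (sl A r) (sl B s) (sl C ((1 - t) * r + t * s)) (slcomp A r hA) (slcomp B s hB)
      (slcomp C _ hC) (by
        intro x hx y hy
        have := h _ hx _ hy
        change Fin.cons _ _ ∈ C
        convert this using 1
        ext i; refine Fin.cases ?_ (fun j => ?_) i <;> simp)
    have h2 := ENNReal.toReal_mono (fin C _ hC) this
    rw [ENNReal.toReal_mul, ← ENNReal.toReal_rpow, ← ENNReal.toReal_rpow] at h2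
    exact h2

lemma brunn_minkowski {n : ℕ} {t : ℝ} (ht0 : 0 < t) (ht1 : t < 1)
    {A B C : Set (EuclideanSpace ℝ (Fin n))} (hA : IsCompact A) (hB : IsCompact B)
    (hC : IsCompact C) (h : ∀ x ∈ A, ∀ y ∈ B, (1 - t) • x + t • y ∈ C) :
    volume A ^ (1 - t) * volume B ^ t ≤ volume C := by
  have mp := PiLp.volume_preserving_toLp (Fin n)
  have cont : Continuous (@WithLp.ofLp 2 (Fin n → ℝ)) := PiLp.continuous_ofLp 2 _
  have key : ∀ S : Set (EuclideanSpace ℝ (Fin n)), IsCompact S →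
      volume (WithLp.ofLp '' S) = volume S := by
    intro S hS
    rw [← mp.measure_preimage hS.measurableSet.nullMeasurableSet]
    congr 1
    ext x
    simp only [Set.mem_image, Set.mem_preimage]
    constructor
    · rintro ⟨y, hy, rfl⟩; exact hy
    · intro hx; exact ⟨_, hx, rfl⟩
  rw [← key A hA, ← key B hB, ← key C hC]
  refine brunn_minkowski_pi ht0 ht1 n _ _ _ (hA.image cont) (hB.image cont) (hC.image cont) ?_
  rintro _ ⟨x, hx, rfl⟩ _ ⟨y, hy, rfl⟩
  exact ⟨_, h x hx y hy, rfl⟩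

lemma le_volume_of_volume_eq {n : ℕ} {t : ℝ} (ht0 : 0 < t) (ht1 : t < 1)
    {A B C : Set (EuclideanSpace ℝ (Fin n))} (hA : IsCompact A) (hB : IsCompact B)
    (hC : IsCompact C) (hAB : volume A = volume B)
    (h : ∀ x ∈ A, ∀ y ∈ B, (1 - t) • x + t • y ∈ C) :
    volume A ≤ volume C := by
  refine le_trans (le_of_eq ?_) (brunn_minkowski ht0 ht1 hA hB hC h)
  rw [← hAB, ← ENNReal.rpow_add_of_nonneg _ _ (by linarith) ht0.le]
  simp

end

/-! ### Volumes of affine sweeps of two faces. -/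

section

/-- The set swept out by the combinations `a θ • x + b θ • y` with `x ∈ F`, `y ∈ G` and
`c ≤ θ ≤ d`. -/
def sweep (F G : Set (EuclideanSpace ℝ (Fin n))) (a b : ℝ → ℝ) (c d : ℝ) :
    Set (EuclideanSpace ℝ (Fin n)) :=
  {z | ∃ θ ∈ Set.Icc c d, ∃ x ∈ F, ∃ y ∈ G, z = a θ • x + b θ • y}

lemma isCompact_sweep {F G : Set (EuclideanSpace ℝ (Fin n))} (hF : IsCompact F)
    (hG : IsCompact G) {a b : ℝ → ℝ} (ha : Continuous a) (hb : Continuous b) (c d : ℝ) :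
    IsCompact (sweep F G a b c d) := by
  have : sweep F G a b c d = (fun p : ℝ × EuclideanSpace ℝ (Fin n) × EuclideanSpace ℝ (Fin n) =>
      a p.1 • p.2.1 + b p.1 • p.2.2) '' (Set.Icc c d ×ˢ F ×ˢ G) := by
    ext z
    simp only [sweep, Set.mem_ofPred_eq, Set.mem_image, Set.mem_prod, Prod.exists]
    constructor
    · rintro ⟨θ, h, x, hx, y, hy, rfl⟩; exact ⟨θ, x, y, ⟨h, hx, hy⟩, rfl⟩
    · rintro ⟨θ, x, y, ⟨h, hx, hy⟩, rfl⟩; exact ⟨θ, h, x, hx, y, hy, rfl⟩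
  rw [this]
  exact (isCompact_Icc.prod (hF.prod hG)).image (by fun_prop)

/-- If a linear functional `ℓ` with kernel `M ⊕ N` is constant on `F ⊆ x₀ + M` and on
`G ⊆ y₀ + N`, then the volume of any affine sweep of `F` and `G` is an explicit one-dimensional
integral, up to a constant depending only on `F` and `G`. -/
lemma exists_const_volume_sweep (ℓ : EuclideanSpace ℝ (Fin n) →ₗ[ℝ] ℝ)
    {e₀ : EuclideanSpace ℝ (Fin n)} (he₀ : ℓ e₀ = 1)
    {M N : Submodule ℝ (EuclideanSpace ℝ (Fin n))} (hinf : M ⊓ N = ⊥)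
    (hsup : M ⊔ N = LinearMap.ker ℓ)
    {F G : Set (EuclideanSpace ℝ (Fin n))} (hF : IsCompact F) (hG : IsCompact G)
    {x₀ y₀ : EuclideanSpace ℝ (Fin n)} (hFM : ∀ x ∈ F, x - x₀ ∈ M) (hGN : ∀ y ∈ G, y - y₀ ∈ N) :
    ∃ C : ℝ, 0 ≤ C ∧ ∀ a₀ a₁ b₀ b₁ c d : ℝ, a₁ * ℓ x₀ + b₁ * ℓ y₀ ≠ 0 → c ≤ d →
      volume.real (sweep F G (fun θ => a₀ + a₁ * θ) (fun θ => b₀ + b₁ * θ) c d) =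
        C * |a₁ * ℓ x₀ + b₁ * ℓ y₀| *
          ∫ θ in c..d, |a₀ + a₁ * θ| ^ Module.finrank ℝ M * |b₀ + b₁ * θ| ^ Module.finrank ℝ N := by
  classical
  -- Adapted coordinates: the whole space is M ⊕ N ⊕ ℝe₀, and the last coordinate is the value of ℓ.
  let e' : (M × N) × ℝ →ₗ[ℝ] EuclideanSpace ℝ (Fin n) :=
    (M.subtype.coprod N.subtype).coprod (LinearMap.toSpanSingleton ℝ _ e₀)
  have he' : ∀ q, e' q = (q.1.1 : EuclideanSpace ℝ (Fin n)) + q.1.2 + q.2 • e₀ := fun q => by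
    simp [e']
  have hℓM : ∀ m : M, ℓ m = 0 := fun m => by
    have : (m : EuclideanSpace ℝ (Fin n)) ∈ LinearMap.ker ℓ := hsup ▸ Submodule.mem_sup_left m.2
    simpa using this
  have hℓN : ∀ m : N, ℓ m = 0 := fun m => by
    have : (m : EuclideanSpace ℝ (Fin n)) ∈ LinearMap.ker ℓ := hsup ▸ Submodule.mem_sup_right m.2
    simpa using this
  have hℓe : ∀ q, ℓ (e' q) = q.2 := fun q => by simp [he', hℓM, hℓN, he₀]
  have hbij : Function.Bijective e' := by
    constructor
    · rw [← LinearMap.ker_eq_bot, LinearMap.ker_eq_bot']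
      intro q hq
      have h2 : q.2 = 0 := by rw [← hℓe q, hq, map_zero]
      rw [he', h2, zero_smul, add_zero] at hq
      have h1 : (q.1.1 : EuclideanSpace ℝ (Fin n)) ∈ M ⊓ N := by
        refine ⟨q.1.1.2, ?_⟩
        rw [eq_neg_of_add_eq_zero_left hq]
        exact N.neg_mem q.1.2.2
      rw [hinf, Submodule.mem_bot] at h1
      rw [h1, zero_add] at hq
      ext1
      · ext1
        · exact Subtype.ext h1
        · exact Subtype.ext hq
      · exact h2
    · intro z
      have : z - ℓ z • e₀ ∈ M ⊔ N := by
        rw [hsup]; simp [he₀]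
      obtain ⟨m, hm, k, hk, hmk⟩ := Submodule.mem_sup.1 this
      exact ⟨((⟨m, hm⟩, ⟨k, hk⟩), ℓ z), by rw [he']; simp [hmk]⟩
  let e : ((M × N) × ℝ) ≃L[ℝ] EuclideanSpace ℝ (Fin n) :=
    (LinearEquiv.ofBijective e' hbij).toContinuousLinearEquiv
  have hee : ∀ q, e q = (q.1.1 : EuclideanSpace ℝ (Fin n)) + q.1.2 + q.2 • e₀ := he'
  have hℓe : ∀ q, ℓ (e q) = q.2 := hℓe
  let νM : Measure M := Measure.addHaar
  let νN : Measure N := Measure.addHaar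
  let μ : Measure ((M × N) × ℝ) := Measure.map e.symm volume
  have : μ.IsAddHaarMeasure := ContinuousLinearEquiv.isAddHaarMeasure_map e.symm volume
  let ν : Measure ((M × N) × ℝ) := (νM.prod νN).prod volume
  have h1 : (νM.prod νN).IsAddHaarMeasure := Measure.prod.instIsAddHaarMeasure νM νN
  have : ν.IsAddHaarMeasure := Measure.prod.instIsAddHaarMeasure (νM.prod νN) volume
  -- Uniqueness of Haar measure: Lebesgue measure is a constant multiple of the product measure in
  -- these coordinates. The constant sought is this factor times the measures of `F1` in M and of
  -- `G1` in N, so it does not depend on the coefficients.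
  have hμν := Measure.isAddLeftInvariant_eq_smul μ ν
  set c₀ := μ.addHaarScalarFactor ν
  have hvol : ∀ S, IsCompact S → volume S = c₀ * ∫⁻ r, (νM.prod νN) {p | e (p, r) ∈ S} := by
    intro S hS
    have m1 : MeasurableSet (e ⁻¹' S) := e.continuous.measurable hS.measurableSet
    have : volume S = μ (e ⁻¹' S) := by
      rw [Measure.map_apply e.symm.continuous.measurable m1, ← Set.preimage_comp]
      simp
    rw [this, hμν, Measure.smul_apply, Measure.prod_apply_symm m1]
    rfl
  obtain ⟨⟨⟨m0, n0⟩, α⟩, hx0⟩ := e.surjective x₀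
  obtain ⟨⟨⟨m1, n1⟩, β⟩, hy0⟩ := e.surjective y₀
  have hα : ℓ x₀ = α := by rw [← hx0, hℓe]
  have hβ : ℓ y₀ = β := by rw [← hy0, hℓe]
  let F1 : Set M := {m | e ((m, n0), α) ∈ F}
  let G1 : Set N := {k | e ((m1, k), β) ∈ G}
  have hF1 : ∀ x ∈ F, ∃ m ∈ F1, x = e ((m, n0), α) := by
    intro x hx
    have e1 : e ((m0 + ⟨x - x₀, hFM x hx⟩, n0), α) = x := by
      have := hx0
      rw [hee] at this ⊢
      simp only [Submodule.coe_add] at this ⊢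
      rw [← sub_eq_zero, ← sub_eq_zero.2 this]; abel
    exact ⟨_, by simpa only [F1, Set.mem_ofPred_eq, e1] using hx, e1.symm⟩
  have hG1 : ∀ y ∈ G, ∃ k ∈ G1, y = e ((m1, k), β) := by
    intro y hy
    have e1 : e ((m1, n1 + ⟨y - y₀, hGN y hy⟩), β) = y := by
      have := hy0
      rw [hee] at this ⊢
      simp only [Submodule.coe_add] at this ⊢
      rw [← sub_eq_zero, ← sub_eq_zero.2 this]; abel
    exact ⟨_, by simpa only [G1, Set.mem_ofPred_eq, e1] using hy, e1.symm⟩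
  have cF1 : νM F1 ≠ ∞ := by
    refine ne_of_lt (IsCompact.measure_lt_top ?_)
    have : IsCompact ((fun z => (e.symm z).1.1) '' F) := hF.image (by fun_prop)
    refine this.of_isClosed_subset (hF.isClosed.preimage (by fun_prop)) ?_
    intro m hm
    exact ⟨_, hm, by simp⟩
  have cG1 : νN G1 ≠ ∞ := by
    refine ne_of_lt (IsCompact.measure_lt_top ?_)
    have : IsCompact ((fun z => (e.symm z).1.2) '' G) := hG.image (by fun_prop)
    refine this.of_isClosed_subset (hG.isClosed.preimage (by fun_prop)) ?_
    intro m hm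
    exact ⟨_, hm, by simp⟩
  refine ⟨c₀ * ((νM F1).toReal * (νN G1).toReal), by positivity, ?_⟩
  intro a₀ a₁ b₀ b₁ c d hp hcd
  rw [hα, hβ] at hp ⊢
  set p := a₁ * α + b₁ * β with hpdef
  -- The value of ℓ on the points with parameter θ. Its slope p is nonzero, so the height determines
  -- θ; p also becomes the Jacobian below.
  set γ : ℝ → ℝ := fun θ => (a₀ * α + b₀ * β) + p * θ with hγ
  have hγinj : Function.Injective γ := by
    intro x y hxy
    simp only [hγ, add_right_inj] at hxy
    exact mul_left_cancel₀ hp hxy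
  set S := sweep F G (fun θ => a₀ + a₁ * θ) (fun θ => b₀ + b₁ * θ) c d with hS
  have cS : IsCompact S := isCompact_sweep hF hG (by fun_prop) (by fun_prop) c d
  have comb : ∀ (θ : ℝ) (m : M) (k : N),
      (a₀ + a₁ * θ) • e ((m, n0), α) + (b₀ + b₁ * θ) • e ((m1, k), β) =
      e (((a₀ + a₁ * θ) • m + (b₀ + b₁ * θ) • m1, (a₀ + a₁ * θ) • n0 + (b₀ + b₁ * θ) • k), γ θ) := by
    intro θ m k
    rw [← map_smul, ← map_smul, ← map_add]
    congr 1
    ext1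
    · rfl
    · simp [hγ, hpdef]; ring
  -- At a fixed height the section is a product of translated dilates of `F1` and `G1`, whence the
  -- powers of the two coefficients.
  have sec : ∀ θ ∈ Set.Icc c d, {q | e (q, γ θ) ∈ S} =
      ((fun m => m + (b₀ + b₁ * θ) • m1) '' ((a₀ + a₁ * θ) • F1)) ×ˢ
        ((fun k => (a₀ + a₁ * θ) • n0 + k) '' ((b₀ + b₁ * θ) • G1)) := by
    intro θ hθ
    ext ⟨m, k⟩
    constructor
    · rintro ⟨θ', hθ', x, hx, y, hy, hxy⟩
      obtain ⟨m', hm', rfl⟩ := hF1 x hx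
      obtain ⟨k', hk', rfl⟩ := hG1 y hy
      simp only [comb] at hxy
      have h2 := e.injective hxy
      simp only [Prod.mk.injEq] at h2
      obtain rfl := hγinj h2.2
      obtain ⟨⟨rfl, rfl⟩, -⟩ := h2
      exact ⟨⟨_, Set.smul_mem_smul_set hm', rfl⟩, ⟨_, Set.smul_mem_smul_set hk', rfl⟩⟩
    · rintro ⟨⟨_, ⟨m', hm', rfl⟩, hm⟩, ⟨_, ⟨k', hk', rfl⟩, hk⟩⟩
      refine ⟨θ, hθ, _, hm', _, hk', ?_⟩
      simp only at hm hk
      rw [comb, ← hm, ← hk]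
  have hsec : ∀ θ ∈ Set.Icc c d, (νM.prod νN) {q | e (q, γ θ) ∈ S} =
      ENNReal.ofReal (|a₀ + a₁ * θ| ^ Module.finrank ℝ M * |b₀ + b₁ * θ| ^ Module.finrank ℝ N) *
        (νM F1 * νN G1) := by
    intro θ hθ
    rw [sec θ hθ, Measure.prod_prod, Set.image_add_right, measure_preimage_add_right,
      Set.image_add_left, measure_preimage_add, Measure.addHaar_smul, Measure.addHaar_smul,
      abs_pow, abs_pow, mul_mul_mul_comm, ← ENNReal.ofReal_mul (by positivity)]
  have hout : ∀ r, r ∉ γ '' Set.Icc c d → (νM.prod νN) {q | e (q, r) ∈ S} = 0 := by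
    intro r hr
    have : {q | e (q, r) ∈ S} = ∅ := by
      rw [Set.eq_empty_iff_forall_notMem]
      rintro ⟨m, k⟩ ⟨θ', hθ', x, hx, y, hy, hxy⟩
      obtain ⟨m', hm', rfl⟩ := hF1 x hx
      obtain ⟨k', hk', rfl⟩ := hG1 y hy
      simp only [comb] at hxy
      have h2 := e.injective hxy
      simp only [Prod.mk.injEq] at h2
      exact hr ⟨θ', hθ', h2.2.symm⟩
    rw [this, measure_empty]
  have hint : ∫⁻ r, (νM.prod νN) {q | e (q, r) ∈ S} =
      ∫⁻ r in γ '' Set.Icc c d, (νM.prod νN) {q | e (q, r) ∈ S} := by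
    rw [← lintegral_indicator ((isCompact_Icc.image (by fun_prop)).measurableSet)]
    refine lintegral_congr fun r => ?_
    by_cases hr : r ∈ γ '' Set.Icc c d
    · rw [Set.indicator_of_mem hr]
    · rw [Set.indicator_of_notMem hr, hout r hr]
  have hder : ∀ x ∈ Set.Icc c d, HasDerivWithinAt γ ((fun _ => p) x) (Set.Icc c d) x := by
    intro x _
    have := ((hasDerivAt_id x).const_mul p).const_add (a₀ * α + b₀ * β)
    simpa [hγ] using this.hasDerivWithinAt
  have hfin : (νM F1 * νN G1) ≠ ∞ := ENNReal.mul_ne_top cF1 cG1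
  have contf : Continuous fun θ : ℝ =>
      |a₀ + a₁ * θ| ^ Module.finrank ℝ M * |b₀ + b₁ * θ| ^ Module.finrank ℝ N := by fun_prop
  have hvS : volume S = c₀ * (ENNReal.ofReal |p| * (ENNReal.ofReal (∫ θ in c..d,
      |a₀ + a₁ * θ| ^ Module.finrank ℝ M * |b₀ + b₁ * θ| ^ Module.finrank ℝ N) *
        (νM F1 * νN G1))) := by
    rw [hvol S cS, hint, lintegral_image_eq_lintegral_abs_deriv_mul measurableSet_Icc hder
      hγinj.injOn, lintegral_const_mul' _ _ ENNReal.ofReal_ne_top,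
      setLIntegral_congr_fun measurableSet_Icc hsec, lintegral_mul_const' _ _ hfin,
      intervalIntegral.integral_of_le hcd, ← integral_Icc_eq_integral_Ioc,
      ofReal_integral_eq_lintegral_ofReal]
    · exact contf.continuousOn.integrableOn_Icc
    · exact ae_of_all _ fun θ => by positivity
  have hpos : 0 ≤ ∫ θ in c..d,
      |a₀ + a₁ * θ| ^ Module.finrank ℝ M * |b₀ + b₁ * θ| ^ Module.finrank ℝ N :=
    intervalIntegral.integral_nonneg hcd fun θ _ => by positivity
  rw [Measure.real, hvS]
  simp only [ENNReal.toReal_mul, ENNReal.coe_toReal, ENNReal.toReal_ofReal (abs_nonneg p),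
    ENNReal.toReal_ofReal hpos]
  ring

end

/-! ### Faces of a polytope in opposite directions and facet normals of the difference body. -/

section

lemma vectorSpan_add_eq_sup {A B : Set (𝔼 n)} (hA : A.Nonempty) (hB : B.Nonempty) :
    vectorSpan ℝ (A + B) = vectorSpan ℝ A ⊔ vectorSpan ℝ B := by
  obtain ⟨a, ha⟩ := hA
  obtain ⟨b, hb⟩ := hB
  apply le_antisymm
  · rw [vectorSpan_def, Submodule.span_le]
    rintro _ ⟨_, ⟨x, hx, y, hy, rfl⟩, _, ⟨x', hx', y', hy', rfl⟩, rfl⟩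
    have : (x + y) -ᵥ (x' + y') = (x - x') + (y - y') := by simp only [vsub_eq_sub]; abel
    change (x + y) -ᵥ (x' + y') ∈ _
    rw [this]
    exact Submodule.add_mem_sup (vsub_mem_vectorSpan ℝ hx hx') (vsub_mem_vectorSpan ℝ hy hy')
  · refine sup_le ?_ ?_
    · rw [vectorSpan_def, Submodule.span_le]
      rintro _ ⟨x, hx, x', hx', rfl⟩
      have : x -ᵥ x' = (x + b) -ᵥ (x' + b) := by simp
      change x -ᵥ x' ∈ _
      rw [this]
      exact vsub_mem_vectorSpan ℝ ⟨x, hx, b, hb, rfl⟩ ⟨x', hx', b, hb, rfl⟩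
    · rw [vectorSpan_def, Submodule.span_le]
      rintro _ ⟨x, hx, x', hx', rfl⟩
      have : x -ᵥ x' = (a + x) -ᵥ (a + x') := by simp
      change x -ᵥ x' ∈ _
      rw [this]
      exact vsub_mem_vectorSpan ℝ ⟨a, ha, x, hx, rfl⟩ ⟨a, ha, x', hx', rfl⟩

/-- Parametrize by the segment from c to d. The end parameters 0 and 1 are convex combinations of
the parameters s, r of a and b, which lie in [0,1]; hence s and r are 0 and 1 in some order. -/
lemma segment_eq_segment {a b c d : 𝔼 n} (h : segment ℝ a b = segment ℝ c d) :
    (a = c ∧ b = d) ∨ (a = d ∧ b = c) := by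
  have ha : a ∈ segment ℝ c d := h ▸ left_mem_segment ℝ a b
  have hb : b ∈ segment ℝ c d := h ▸ right_mem_segment ℝ a b
  have hc : c ∈ segment ℝ a b := h ▸ left_mem_segment ℝ c d
  have hd : d ∈ segment ℝ a b := h ▸ right_mem_segment ℝ c d
  rw [segment_eq_image'] at ha hb hc hd
  obtain ⟨s, ⟨hs0, hs1⟩, rfl⟩ := ha
  obtain ⟨r, ⟨hr0, hr1⟩, rfl⟩ := hb
  obtain ⟨p, ⟨hp0, hp1⟩, hp⟩ := hc
  obtain ⟨q, ⟨hq0, hq1⟩, hq⟩ := hd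
  rcases eq_or_ne d c with rfl | hne
  · simp
  have hv : d - c ≠ 0 := sub_ne_zero.2 hne
  have e1 : (1 - p) * s + p * r = 0 := by
    have : ((1 - p) * s + p * r) • (d - c) = 0 := by
      have := sub_eq_zero.2 hp
      rw [← this]; module
    exact (smul_eq_zero.1 this).resolve_right hv
  have e2 : (1 - q) * s + q * r = 1 := by
    have : ((1 - q) * s + q * r - 1) • (d - c) = 0 := by
      have := sub_eq_zero.2 hq
      rw [← this]; module
    have := (smul_eq_zero.1 this).resolve_right hv
    linarith
  have e3 : (1 - p) * s = 0 := by nlinarith [mul_nonneg (sub_nonneg.2 hp1) hs0, mul_nonneg hp0 hr0]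
  have e4 : p * r = 0 := by linarith
  rcases mul_eq_zero.1 e3 with h1 | h1
  · have hp' : p = 1 := by linarith
    have hr : r = 0 := by rw [hp'] at e4; linarith
    have hs : s = 1 := by subst hr; nlinarith
    right; subst hr hs; simp
  · subst h1
    have hr : r = 1 := by nlinarith
    left; subst hr; simp

lemma volume_hyperplane {w : 𝔼 n} (hw : w ≠ 0) (c : ℝ) :
    volume {z : 𝔼 n | inner ℝ w z = c} = 0 := by
  have hww : inner ℝ w w ≠ 0 := by simpa using hw
  let s : AffineSubspace ℝ (𝔼 n) := AffineSubspace.mk' ((c / inner ℝ w w) • w)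
    (LinearMap.ker (innerSL ℝ w).toLinearMap)
  have hs : ({z : 𝔼 n | inner ℝ w z = c} : Set (𝔼 n)) = s := by
    ext z
    change inner ℝ w z = c ↔ z -ᵥ ((c / inner ℝ w w) • w) ∈ LinearMap.ker (innerSL ℝ w).toLinearMap
    simp [inner_sub_right, inner_smul_right, sub_eq_zero, hw]
  rw [hs]
  refine Measure.addHaar_affineSubspace _ _ fun htop => ?_
  have h1 : (((c + 1) / inner ℝ w w) • w) ∈ s := htop ▸ AffineSubspace.mem_top ℝ _ _
  have h2 : (((c + 1) / inner ℝ w w) • w) ∈ ({z : 𝔼 n | inner ℝ w z = c} : Set (𝔼 n)) := hs ▸ h1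
  have h3 : inner ℝ w (((c + 1) / inner ℝ w w) • w) = c := h2
  rw [inner_smul_right, div_mul_cancel₀ _ hww] at h3
  linarith

lemma volume_eq_zero_of_sub_mem {S : Set (𝔼 n)} (W : Submodule ℝ (𝔼 n))
    (hW : Module.finrank ℝ W < n) (p : 𝔼 n) (h : ∀ z ∈ S, z - p ∈ W) : volume S = 0 := by
  have h1 : S ⊆ (AffineSubspace.mk' p W : Set (𝔼 n)) := fun z hz => h z hz
  refine measure_mono_null h1 (Measure.addHaar_affineSubspace _ _ fun htop => ?_)
  have : W = ⊤ := by
    rw [← AffineSubspace.direction_mk' p W, htop, AffineSubspace.direction_top]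
  rw [this, finrank_top] at hW
  simp at hW

/-- Since the coefficients are affine in θ, the sweep lies in a translate of the sum of the two
direction spaces and one further line, a space of dimension less than n. -/
lemma volume_sweep_eq_zero {F G : Set (𝔼 n)} (hF : F.Nonempty) (hG : G.Nonempty)
    (h : setDim (F + G) + 1 < n) (a₀ a₁ b₀ b₁ c d : ℝ) :
    volume (sweep F G (fun θ => a₀ + a₁ * θ) (fun θ => b₀ + b₁ * θ) c d) = 0 := by
  rw [setDim, vectorSpan_add_eq_sup hF hG] at h
  obtain ⟨x₀, hx₀⟩ := hF
  obtain ⟨y₀, hy₀⟩ := hG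
  set v := a₁ • x₀ + b₁ • y₀
  refine volume_eq_zero_of_sub_mem ((vectorSpan ℝ F ⊔ vectorSpan ℝ G) ⊔ Submodule.span ℝ {v}) ?_
    (a₀ • x₀ + b₀ • y₀) ?_
  · have h1 := Submodule.finrank_add_le_finrank_add_finrank (vectorSpan ℝ F ⊔ vectorSpan ℝ G)
      (Submodule.span ℝ {v})
    have h2 := finrank_span_le_card (R := ℝ) ({v} : Set (𝔼 n))
    simp only [Set.toFinset_singleton, Finset.card_singleton] at h2
    omega
  · rintro _ ⟨θ, -, x, hx, y, hy, rfl⟩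
    have e : (a₀ + a₁ * θ) • x + (b₀ + b₁ * θ) • y - (a₀ • x₀ + b₀ • y₀) =
        ((a₀ + a₁ * θ) • (x - x₀) + (b₀ + b₁ * θ) • (y - y₀)) + θ • v := by
      simp only [v]; module
    rw [e]
    refine Submodule.add_mem_sup (Submodule.add_mem_sup ?_ ?_) ?_
    · exact Submodule.smul_mem _ _ (vsub_mem_vectorSpan ℝ hx hx₀)
    · exact Submodule.smul_mem _ _ (vsub_mem_vectorSpan ℝ hy hy₀)
    · exact Submodule.smul_mem _ _ (Submodule.mem_span_singleton_self v)

section SuppSet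

variable {P : Set (𝔼 n)} {u : 𝔼 n}

lemma suppSet_nonempty (hP : IsCompact P) (hne : P.Nonempty) (u : 𝔼 n) :
    (suppSet P u).Nonempty := by
  obtain ⟨x, hx, hmax⟩ := hP.exists_isMaxOn hne (f := fun y => inner ℝ u y)
    (by fun_prop : Continuous fun y : 𝔼 n => inner ℝ u y).continuousOn
  exact ⟨x, hx, fun y hy => hmax hy⟩

lemma inner_eq_of_mem_suppSet {x y : 𝔼 n} (hx : x ∈ suppSet P u) (hy : y ∈ suppSet P u) :
    inner ℝ u x = inner ℝ u y := le_antisymm (hy.2 x hx.1) (hx.2 y hy.1)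

lemma isExposed_suppSet (P : Set (𝔼 n)) (u : 𝔼 n) : IsExposed ℝ P (suppSet P u) :=
  fun _ => ⟨innerSL ℝ u, rfl⟩

lemma isCompact_suppSet (hP : IsCompact P) (u : 𝔼 n) : IsCompact (suppSet P u) :=
  (isExposed_suppSet P u).isCompact hP

lemma convex_suppSet (hP : Convex ℝ P) (u : 𝔼 n) : Convex ℝ (suppSet P u) :=
  (isExposed_suppSet P u).convex hP

/-- An extreme point of an exposed face is an extreme point of the hull, hence belongs to V;
Krein-Milman recovers the face. This is what makes the number of faces finite. -/
lemma suppSet_convexHull {V : Set (𝔼 n)} (hV : V.Finite) (u : 𝔼 n) :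
    suppSet (convexHull ℝ V) u = convexHull ℝ (V ∩ suppSet (convexHull ℝ V) u) := by
  have hc := hV.isCompact_convexHull (𝕜 := ℝ)
  apply subset_antisymm
  · have h1 := closure_convexHull_extremePoints (isCompact_suppSet hc u)
      (convex_suppSet (convex_convexHull ℝ V) u)
    have h2 : (suppSet (convexHull ℝ V) u).extremePoints ℝ ⊆ V ∩ suppSet (convexHull ℝ V) u :=
      fun x hx => ⟨extremePoints_convexHull_subset
        ((isExposed_suppSet (convexHull ℝ V) u).isExtreme.extremePoints_subset_extremePoints hx),
        hx.1⟩
    calc suppSet (convexHull ℝ V) u = _ := h1.symm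
      _ ⊆ closure (convexHull ℝ (V ∩ suppSet (convexHull ℝ V) u)) :=
        closure_mono (convexHull_mono h2)
      _ = _ := ((hV.inter_of_left _).isCompact_convexHull (𝕜 := ℝ)).isClosed.closure_eq
  · exact convexHull_min Set.inter_subset_right (convex_suppSet (convex_convexHull ℝ V) u)

end SuppSet

section Polytope

variable {P : Set (𝔼 n)}

lemma IsFullPolytope.isCompact (hP : IsFullPolytope P) : IsCompact P := by
  obtain ⟨⟨V, hV, -, rfl⟩, -⟩ := hP
  exact hV.isCompact_convexHull (𝕜 := ℝ)

lemma IsFullPolytope.convex (hP : IsFullPolytope P) : Convex ℝ P := by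
  obtain ⟨⟨V, hV, -, rfl⟩, -⟩ := hP
  exact convex_convexHull ℝ V

lemma IsFullPolytope.nonempty (hP : IsFullPolytope P) : P.Nonempty := by
  obtain ⟨⟨V, hV, hne, rfl⟩, -⟩ := hP
  exact hne.convexHull

lemma IsFullPolytope.vectorSpan_eq_top (hP : IsFullPolytope P) : vectorSpan ℝ P = ⊤ :=
  Submodule.eq_top_of_finrank_eq (by simpa [setDim] using hP.2)

lemma IsFullPolytope.interior_nonempty (hP : IsFullPolytope P) : (interior P).Nonempty := by
  rw [hP.convex.interior_nonempty_iff_affineSpan_eq_top,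
    AffineSubspace.affineSpan_eq_top_iff_vectorSpan_eq_top_of_nonempty _ _ _ hP.nonempty]
  exact hP.vectorSpan_eq_top

lemma IsFullPolytope.volume_pos (hP : IsFullPolytope P) : 0 < volume P :=
  lt_of_lt_of_le (isOpen_interior.measure_pos _ hP.interior_nonempty)
    (measure_mono interior_subset)

lemma IsFullPolytope.volume_ne_top (hP : IsFullPolytope P) : volume P ≠ ∞ :=
  hP.isCompact.measure_lt_top.ne

lemma IsFullPolytope.volumeReal_pos (hP : IsFullPolytope P) : 0 < volume.real P :=
  ENNReal.toReal_pos hP.volume_pos.ne' hP.volume_ne_top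

lemma IsFullPolytope.finite_suppSet (hP : IsFullPolytope P) :
    (Set.range fun u => suppSet P u).Finite := by
  obtain ⟨⟨V, hV, -, rfl⟩, -⟩ := hP
  refine (hV.powerset.image fun W => convexHull ℝ W).subset ?_
  rintro _ ⟨u, rfl⟩
  exact ⟨V ∩ suppSet (convexHull ℝ V) u, Set.inter_subset_left, (suppSet_convexHull hV u).symm⟩

lemma IsFullPolytope.finite_pairs (hP : IsFullPolytope P) :
    (Set.range fun u => (suppSet P u, suppSet P (-u))).Finite := by
  refine (hP.finite_suppSet.prod hP.finite_suppSet).subset ?_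
  rintro _ ⟨u, rfl⟩
  exact ⟨⟨u, rfl⟩, ⟨-u, rfl⟩⟩

lemma ne_zero_of_norm_eq_one {u : 𝔼 n} (hu : ‖u‖ = 1) : u ≠ 0 := by
  rintro rfl; simp at hu

/-- The width of a full-dimensional polytope is positive in every direction. -/
lemma IsFullPolytope.inner_lt (hP : IsFullPolytope P) {u x y : 𝔼 n} (hu : u ≠ 0)
    (hx : x ∈ suppSet P u) (hy : y ∈ suppSet P (-u)) : inner ℝ u y < inner ℝ u x := by
  refine lt_of_le_of_ne (hx.2 y hy.1) fun heq => hu ?_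
  have h1 : ∀ z ∈ P, inner ℝ u z = inner ℝ u x := by
    intro z hz
    have h2 := hy.2 z hz
    simp only [inner_neg_left, neg_le_neg_iff] at h2
    exact le_antisymm (hx.2 z hz) (heq ▸ h2)
  have h2 : vectorSpan ℝ P ≤ LinearMap.ker (innerSL ℝ u).toLinearMap := by
    rw [vectorSpan_def, Submodule.span_le]
    rintro _ ⟨a, ha, b, hb, rfl⟩
    change inner ℝ u (a - b) = 0
    rw [inner_sub_right, h1 a ha, h1 b hb, sub_self]
  rw [hP.vectorSpan_eq_top] at h2
  have h3 : inner ℝ u u = 0 := h2 (Submodule.mem_top (x := u))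
  simpa using h3

lemma vectorSpan_suppSet_le (P : Set (𝔼 n)) (u : 𝔼 n) :
    vectorSpan ℝ (suppSet P u) ≤ LinearMap.ker (innerSL ℝ u).toLinearMap := by
  rw [vectorSpan_def, Submodule.span_le]
  rintro _ ⟨a, ha, b, hb, rfl⟩
  change inner ℝ u (a - b) = 0
  rw [inner_sub_right, inner_eq_of_mem_suppSet ha hb, sub_self]

lemma vectorSpan_suppSet_neg_le (P : Set (𝔼 n)) (u : 𝔼 n) :
    vectorSpan ℝ (suppSet P (-u)) ≤ LinearMap.ker (innerSL ℝ u).toLinearMap := by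
  refine (vectorSpan_suppSet_le P (-u)).trans fun x hx => ?_
  have : inner ℝ (-u) x = 0 := hx
  change inner ℝ u x = 0
  simpa using this

lemma finrank_ker_inner {u : 𝔼 n} (hu : u ≠ 0) :
    Module.finrank ℝ (LinearMap.ker (innerSL ℝ u).toLinearMap) + 1 = n := by
  have h := LinearMap.finrank_range_add_finrank_ker (innerSL ℝ u).toLinearMap
  have h2 : LinearMap.range (innerSL ℝ u).toLinearMap = ⊤ := by
    refine LinearMap.range_eq_top.2 (LinearMap.surjective fun h0 => hu ?_)
    have : inner ℝ u u = 0 := LinearMap.congr_fun h0 u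
    simpa using this
  rw [h2, finrank_top, Module.finrank_self, finrank_euclideanSpace_fin] at h
  rw [add_comm]; exact h

lemma IsFullPolytope.suppSet_nonempty (hP : IsFullPolytope P) (u : 𝔼 n) :
    (suppSet P u).Nonempty := AffineDiam.suppSet_nonempty hP.isCompact hP.nonempty u

lemma IsFullPolytope.sup_le_ker (u : 𝔼 n) :
    vectorSpan ℝ (suppSet P u) ⊔ vectorSpan ℝ (suppSet P (-u)) ≤
      LinearMap.ker (innerSL ℝ u).toLinearMap :=
  sup_le (vectorSpan_suppSet_le P u) (vectorSpan_suppSet_neg_le P u)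

lemma IsFullPolytope.setDim_add_one_le (hP : IsFullPolytope P) {u : 𝔼 n} (hu : u ≠ 0) :
    setDim (suppSet P u + suppSet P (-u)) + 1 ≤ n := by
  have h := finrank_ker_inner hu
  have h2 := Submodule.finrank_mono (IsFullPolytope.sup_le_ker (P := P) u)
  rw [setDim, vectorSpan_add_eq_sup (hP.suppSet_nonempty u) (hP.suppSet_nonempty (-u))]
  omega

/-- The unit normals of the facets of `P - P`. -/
def facetNormals (P : Set (𝔼 n)) : Set (𝔼 n) :=
  {u | ‖u‖ = 1 ∧ setDim (suppSet P u + suppSet P (-u)) + 1 = n}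

lemma IsFullPolytope.sup_eq_ker (hP : IsFullPolytope P) {u : 𝔼 n} (hu : u ∈ facetNormals P) :
    vectorSpan ℝ (suppSet P u) ⊔ vectorSpan ℝ (suppSet P (-u)) =
      LinearMap.ker (innerSL ℝ u).toLinearMap := by
  refine Submodule.eq_of_le_of_finrank_eq (IsFullPolytope.sup_le_ker u) ?_
  have h := finrank_ker_inner (ne_zero_of_norm_eq_one hu.1)
  have h2 := hu.2
  rw [setDim, vectorSpan_add_eq_sup (hP.suppSet_nonempty u) (hP.suppSet_nonempty (-u))] at h2
  omega

lemma neg_mem_facetNormals {u : 𝔼 n} (hu : u ∈ facetNormals P) : -u ∈ facetNormals P := by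
  refine ⟨by rw [norm_neg]; exact hu.1, ?_⟩
  rw [neg_neg, add_comm (suppSet P (-u))]
  exact hu.2

/-- The sum of the direction spaces has dimension n - 1, and by general relative position so has
their formal direct sum; the dimension formula leaves nothing for the intersection. -/
lemma IsFullPolytope.inf_eq_bot (hP : IsFullPolytope P) (hG : GeneralRelPos P) {u : 𝔼 n}
    (hu : u ∈ facetNormals P) :
    vectorSpan ℝ (suppSet P u) ⊓ vectorSpan ℝ (suppSet P (-u)) = ⊥ := by
  have h1 := hG u hu.1 hu.2
  have h2 := hu.2
  rw [setDim, vectorSpan_add_eq_sup (hP.suppSet_nonempty u) (hP.suppSet_nonempty (-u))] at h2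
  have h3 := Submodule.finrank_sup_add_finrank_inf_eq (vectorSpan ℝ (suppSet P u))
    (vectorSpan ℝ (suppSet P (-u)))
  simp only [setDim] at h1
  rw [← Submodule.finrank_eq_zero (R := ℝ)]
  omega

lemma eq_or_eq_neg_of_ker_eq {u v : 𝔼 n} (hu : ‖u‖ = 1) (hv : ‖v‖ = 1)
    (h : LinearMap.ker (innerSL ℝ u).toLinearMap = LinearMap.ker (innerSL ℝ v).toLinearMap) :
    u = v ∨ u = -v := by
  have h1 : v - (inner ℝ u v) • u ∈ LinearMap.ker (innerSL ℝ u).toLinearMap := by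
    change inner ℝ u (v - (inner ℝ u v) • u) = 0
    simp [inner_sub_right, inner_smul_right, hu]
  have h1' : inner ℝ u (v - (inner ℝ u v) • u) = 0 := h1
  rw [h] at h1
  have h2 : inner ℝ v (v - (inner ℝ u v) • u) = 0 := h1
  have h3 : inner ℝ (v - (inner ℝ u v) • u) (v - (inner ℝ u v) • u) = 0 := by
    rw [inner_sub_left, inner_smul_left, h1', h2]; simp
  rw [inner_self_eq_zero, sub_eq_zero] at h3
  have h4 : |inner ℝ u v| = 1 := by
    have := congrArg norm h3
    rw [norm_smul, hu, hv] at this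
    simpa using this.symm
  rcases eq_or_eq_neg_of_abs_eq h4 with h5 | h5
  · left; rw [h3, h5, one_smul]
  · right; rw [h3, h5]; simp

/-- The pair of opposite faces determines the hyperplane orthogonal to u, hence u up to sign; the
sign is settled because the width is positive. Only finitely many pairs of faces exist. -/
lemma IsFullPolytope.finite_facetNormals (hP : IsFullPolytope P) : (facetNormals P).Finite := by
  refine Set.Finite.of_finite_image (f := fun u => (suppSet P u, suppSet P (-u)))
    (hP.finite_pairs.subset (Set.image_subset_range _ _)) ?_
  intro u hu v hv huv
  simp only [Prod.mk.injEq] at huv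
  have h := hP.sup_eq_ker hu
  rw [huv.1, huv.2, hP.sup_eq_ker hv] at h
  rcases eq_or_eq_neg_of_ker_eq hu.1 hv.1 h.symm with rfl | rfl
  · rfl
  · obtain ⟨x, hx⟩ := hP.suppSet_nonempty v
    obtain ⟨y, hy⟩ := hP.suppSet_nonempty (-v)
    have h1 := hP.inner_lt (ne_zero_of_norm_eq_one hv.1) hx hy
    rw [huv.1] at hy
    exact absurd (inner_eq_of_mem_suppSet hx hy) h1.ne'

end Polytope

end

/-! ### Almost everywhere, affine diameters correspond to joins of opposite faces. -/

section

variable {P : Set (𝔼 n)}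

/-- The union of all segments joining the support sets of `P` in the directions `u` and `-u`. -/
def diamJoin (P : Set (𝔼 n)) (u : 𝔼 n) : Set (𝔼 n) :=
  sweep (suppSet P u) (suppSet P (-u)) (fun θ => 1 + (-1) * θ) (fun θ => 0 + 1 * θ) 0 1

lemma mem_diamJoin {u z : 𝔼 n} :
    z ∈ diamJoin P u ↔ ∃ x ∈ suppSet P u, ∃ y ∈ suppSet P (-u), z ∈ segment ℝ x y := by
  simp only [segment_eq_image]
  constructor
  · rintro ⟨θ, hθ, x, hx, y, hy, rfl⟩
    exact ⟨x, hx, y, hy, θ, hθ, by simp; module⟩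
  · rintro ⟨x, hx, y, hy, θ, hθ, rfl⟩
    exact ⟨θ, hθ, x, hx, y, hy, by simp; module⟩

lemma isCompact_diamJoin (hP : IsCompact P) (u : 𝔼 n) : IsCompact (diamJoin P u) :=
  isCompact_sweep (isCompact_suppSet hP u) (isCompact_suppSet hP (-u)) (by fun_prop)
    (by fun_prop) 0 1

lemma diamJoin_subset (hP : Convex ℝ P) (u : 𝔼 n) : diamJoin P u ⊆ P := by
  intro z hz
  obtain ⟨x, hx, y, hy, hz⟩ := mem_diamJoin.1 hz
  exact hP.segment_subset hx.1 hy.1 hz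

lemma eq_of_smul_eq_smul {u v : 𝔼 n} (hu : ‖u‖ = 1) (hv : ‖v‖ = 1) {a b : ℝ} (ha : 0 < a)
    (hb : 0 < b) (h : a • u = b • v) : u = v := by
  have h1 := congrArg norm h
  rw [norm_smul, norm_smul, hu, hv, Real.norm_of_nonneg ha.le, Real.norm_of_nonneg hb.le,
    mul_one, mul_one] at h1
  rw [h1] at h
  exact smul_right_injective _ hb.ne' h

/-- Half of the facet normals of `P - P`: one from each antipodal pair. -/
lemma IsFullPolytope.exists_half (hP : IsFullPolytope P) :
    ∃ T : Finset (𝔼 n), (∀ u ∈ T, u ∈ facetNormals P ∧ -u ∉ T) ∧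
      ∀ u ∈ facetNormals P, u ∈ T ∨ -u ∈ T := by
  classical
  -- A generic vector e is orthogonal to no facet normal, so an open half-space selects one of each
  -- antipodal pair.
  have h : ∀ᵐ e : 𝔼 n, ∀ u ∈ facetNormals P, inner ℝ u e ≠ 0 := by
    rw [ae_ball_iff hP.finite_facetNormals.countable]
    intro u hu
    have := volume_hyperplane (ne_zero_of_norm_eq_one hu.1) 0
    rw [ae_iff]
    simpa using this
  obtain ⟨e, he⟩ := h.exists
  refine ⟨hP.finite_facetNormals.toFinset.filter fun u => 0 < inner ℝ u e, ?_, ?_⟩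
  · intro u hu
    simp only [Finset.mem_filter, Set.Finite.mem_toFinset] at hu ⊢
    refine ⟨hu.1, fun h => ?_⟩
    have := h.2
    rw [inner_neg_left] at this
    linarith [hu.2]
  · intro u hu
    simp only [Finset.mem_filter, Set.Finite.mem_toFinset, inner_neg_left]
    rcases lt_or_gt_of_ne (he u hu) with h | h
    · right; exact ⟨neg_mem_facetNormals hu, by linarith⟩
    · left; exact ⟨hu, h⟩

lemma IsFullPolytope.ae_notMem_sweep (hP : IsFullPolytope P) (a₀ a₁ b₀ b₁ c d : ℝ) :
    ∀ᵐ z : 𝔼 n, ∀ u : 𝔼 n, ‖u‖ = 1 → u ∉ facetNormals P →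
      z ∉ sweep (suppSet P u) (suppSet P (-u)) (fun θ => a₀ + a₁ * θ) (fun θ => b₀ + b₁ * θ) c d := by
  have h : ∀ᵐ z : 𝔼 n, ∀ p ∈ (Set.range fun u => (suppSet P u, suppSet P (-u))),
      setDim (p.1 + p.2) + 1 < n →
        z ∉ sweep p.1 p.2 (fun θ => a₀ + a₁ * θ) (fun θ => b₀ + b₁ * θ) c d := by
    rw [ae_ball_iff hP.finite_pairs.countable]
    rintro _ ⟨u, rfl⟩
    by_cases hlt : setDim (suppSet P u + suppSet P (-u)) + 1 < n
    · have := volume_sweep_eq_zero (hP.suppSet_nonempty u) (hP.suppSet_nonempty (-u)) hlt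
        a₀ a₁ b₀ b₁ c d
      filter_upwards [measure_eq_zero_iff_ae_notMem.1 this] with z hz _ using hz
    · exact ae_of_all _ fun z hz => absurd hz hlt
  filter_upwards [h] with z hz u hu hnot
  refine hz _ ⟨u, rfl⟩ (lt_of_le_of_ne (hP.setDim_add_one_le (ne_zero_of_norm_eq_one hu)) ?_)
  exact fun heq => hnot ⟨hu, heq⟩

lemma ae_notMem_suppSet (P : Set (𝔼 n)) {u : 𝔼 n} (hu : u ≠ 0) :
    ∀ᵐ z : 𝔼 n, z ∉ suppSet P u := by
  rcases (suppSet P u).eq_empty_or_nonempty with h | ⟨x, hx⟩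
  · simp [h]
  · refine measure_eq_zero_iff_ae_notMem.1 (measure_mono_null ?_ (volume_hyperplane hu (inner ℝ u x)))
    intro z hz
    exact inner_eq_of_mem_suppSet hz hx

/-- Two affine diameters that arise from different directions may coincide as segments. Such a
segment has its ends in the faces of both u and v, and a suitable nonzero combination of the two
functionals takes the same value at both ends; all such segments thus lie in one hyperplane. -/
lemma IsFullPolytope.ae_notMem_common (hP : IsFullPolytope P) {u v : 𝔼 n} (hu : ‖u‖ = 1)
    (hv : ‖v‖ = 1) (huv : u ≠ v) :
    ∀ᵐ z : 𝔼 n, ∀ x ∈ suppSet P u ∩ suppSet P v, ∀ y ∈ suppSet P (-u) ∩ suppSet P (-v),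
      z ∉ segment ℝ x y := by
  obtain ⟨xu, hxu⟩ := hP.suppSet_nonempty u
  obtain ⟨yu, hyu⟩ := hP.suppSet_nonempty (-u)
  obtain ⟨xv, hxv⟩ := hP.suppSet_nonempty v
  obtain ⟨yv, hyv⟩ := hP.suppSet_nonempty (-v)
  have hwu := hP.inner_lt (ne_zero_of_norm_eq_one hu) hxu hyu
  have hwv := hP.inner_lt (ne_zero_of_norm_eq_one hv) hxv hyv
  set α := inner ℝ u xu
  set α' := inner ℝ u yu
  set β := inner ℝ v xv
  set β' := inner ℝ v yv
  -- The coefficients are the widths in the directions v and u, so the functional falls by the same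
  -- amount on each term from x to y. It vanishes only if u = v, since both widths are positive.
  have hw : (β - β') • u - (α - α') • v ≠ 0 := fun h =>
    huv (eq_of_smul_eq_smul hu hv (by linarith) (by linarith) (sub_eq_zero.1 h))
  have hnull := volume_hyperplane hw ((β - β') * α - (α - α') * β)
  filter_upwards [measure_eq_zero_iff_ae_notMem.1 hnull] with z hz x hx y hy hzs
  apply hz
  rw [segment_eq_image] at hzs
  obtain ⟨θ, -, rfl⟩ := hzs
  have e1 : inner ℝ u x = α := inner_eq_of_mem_suppSet hx.1 hxu
  have e2 : inner ℝ v x = β := inner_eq_of_mem_suppSet hx.2 hxv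
  have e3 : inner ℝ u y = α' := by
    have := inner_eq_of_mem_suppSet hy.1 hyu
    simpa using this
  have e4 : inner ℝ v y = β' := by
    have := inner_eq_of_mem_suppSet hy.2 hyv
    simpa using this
  change inner ℝ ((β - β') • u - (α - α') • v) _ = _
  simp only [inner_sub_left, inner_smul_left, inner_add_right, inner_smul_right, e1, e2, e3, e4]
  simp
  ring

/-- In general relative position, a point strictly between two opposite facets lies on exactly one
segment joining them. -/
lemma IsFullPolytope.endpoints_unique (hP : IsFullPolytope P) (hG : GeneralRelPos P) {u : 𝔼 n}
    (hu : u ∈ facetNormals P) {x y x' y' z : 𝔼 n} (hx : x ∈ suppSet P u)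
    (hy : y ∈ suppSet P (-u)) (hx' : x' ∈ suppSet P u) (hy' : y' ∈ suppSet P (-u))
    (hz : z ∈ segment ℝ x y) (hz' : z ∈ segment ℝ x' y') (h1 : z ∉ suppSet P u)
    (h2 : z ∉ suppSet P (-u)) : x = x' ∧ y = y' := by
  rw [segment_eq_image] at hz hz'
  obtain ⟨s, ⟨hs0, hs1⟩, rfl⟩ := hz
  obtain ⟨r, ⟨hr0, hr1⟩, hr⟩ := hz'
  have e1 : inner ℝ u x = inner ℝ u x' := inner_eq_of_mem_suppSet hx hx'
  have e3 : inner ℝ u y = inner ℝ u y' := by simpa using inner_eq_of_mem_suppSet hy hy'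
  have hlt := hP.inner_lt (ne_zero_of_norm_eq_one hu.1) hx hy
  simp only at hr h1 h2
  have e4 : r = s := by
    have := congrArg (inner ℝ u) hr
    simp only [inner_add_right, inner_smul_right, ← e1, ← e3] at this
    have h3 : (r - s) * (inner ℝ u x - inner ℝ u y) = 0 := by linarith
    rcases mul_eq_zero.1 h3 with h | h <;> linarith
  subst e4
  have hr0' : r ≠ 0 := by rintro rfl; apply h1; simpa using hx
  have hr1' : 1 - r ≠ 0 := by
    intro h; apply h2
    obtain rfl : r = 1 := by linarith
    simpa using hy
  have e5 : (1 - r) • (x - x') = r • (y' - y) := by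
    have := sub_eq_zero.2 hr
    rw [← sub_eq_zero, ← neg_eq_zero, ← this]; module
  have m1 : (1 - r) • (x - x') ∈ vectorSpan ℝ (suppSet P u) ⊓ vectorSpan ℝ (suppSet P (-u)) := by
    refine ⟨Submodule.smul_mem _ _ (vsub_mem_vectorSpan ℝ hx hx'), ?_⟩
    rw [e5]
    exact Submodule.smul_mem _ _ (vsub_mem_vectorSpan ℝ hy' hy)
  rw [hP.inf_eq_bot hG hu, Submodule.mem_bot] at m1
  have m2 := m1
  rw [e5] at m2
  refine ⟨sub_eq_zero.1 ((smul_eq_zero.1 m1).resolve_left hr1'),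
    (sub_eq_zero.1 ((smul_eq_zero.1 m2).resolve_left hr0')).symm⟩

/-- Almost everywhere, the affine diameters through a point correspond to the pairs of opposite
facets of `P - P` whose join contains the point. -/
lemma IsFullPolytope.numDiam_ae_eq (hP : IsFullPolytope P) (hG : GeneralRelPos P)
    {T : Finset (𝔼 n)} (hT : ∀ u ∈ T, u ∈ facetNormals P ∧ -u ∉ T)
    (hT' : ∀ u ∈ facetNormals P, u ∈ T ∨ -u ∈ T) :
    ∀ᵐ z : 𝔼 n, numDiam P z = ∑ u ∈ T, (diamJoin P u).indicator 1 z := by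
  classical
  have hc := hP.finite_facetNormals.countable
  have ha := hP.ae_notMem_sweep 1 (-1) 0 1 0 1
  have hb : ∀ᵐ z : 𝔼 n, ∀ u ∈ facetNormals P, z ∉ suppSet P u :=
    (ae_ball_iff hc).2 fun u hu => ae_notMem_suppSet P (ne_zero_of_norm_eq_one hu.1)
  have hcm : ∀ᵐ z : 𝔼 n, ∀ u ∈ facetNormals P, ∀ v ∈ facetNormals P, u ≠ v →
      ∀ x ∈ suppSet P u ∩ suppSet P v, ∀ y ∈ suppSet P (-u) ∩ suppSet P (-v),
      z ∉ segment ℝ x y := by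
    refine (ae_ball_iff hc).2 fun u hu => (ae_ball_iff hc).2 fun v hv => ?_
    by_cases h : u = v
    · exact ae_of_all _ fun z hz => absurd h hz
    · filter_upwards [hP.ae_notMem_common hu.1 hv.1 h] with z hz _ using hz
  filter_upwards [ha, hb, hcm] with z ha hb hc
  set Tz := T.filter fun u => z ∈ diamJoin P u with hTz
  have ex : ∀ u ∈ Tz, ∃ p : (𝔼 n) × (𝔼 n), p.1 ∈ suppSet P u ∧ p.2 ∈ suppSet P (-u) ∧
      z ∈ segment ℝ p.1 p.2 := by
    intro u hu
    obtain ⟨x, hx, y, hy, h⟩ := mem_diamJoin.1 (Finset.mem_filter.1 hu).2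
    exact ⟨(x, y), hx, hy, h⟩
  choose! p hpF hpG hpz using ex
  have hU : ∀ u ∈ Tz, u ∈ facetNormals P := fun u hu => (hT u (Finset.mem_filter.1 hu).1).1
  have himg : {S | IsAffineDiameter P S ∧ z ∈ S} = (fun u => segment ℝ (p u).1 (p u).2) '' ↑Tz := by
    ext S
    constructor
    · rintro ⟨⟨u, hu, x, hx, y, hy, -, rfl⟩, hz⟩
      have hzj : z ∈ diamJoin P u := mem_diamJoin.2 ⟨x, hx, y, hy, hz⟩
      have huU : u ∈ facetNormals P := by
        by_contra h
        exact ha u hu h hzj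
      have hb2 := hb _ (neg_mem_facetNormals huU)
      rcases hT' u huU with h | h
      · have hm : u ∈ Tz := Finset.mem_filter.2 ⟨h, hzj⟩
        refine ⟨u, hm, ?_⟩
        obtain ⟨h1, h2⟩ := hP.endpoints_unique hG huU hx hy (hpF u hm) (hpG u hm) hz (hpz u hm)
          (hb u huU) hb2
        simp only [h1, h2]
      · have hm : -u ∈ Tz := by
          refine Finset.mem_filter.2 ⟨h, mem_diamJoin.2 ⟨y, hy, x, by rwa [neg_neg], ?_⟩⟩
          rwa [segment_symm]
        refine ⟨-u, hm, ?_⟩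
        have hx2 := hpG _ hm
        rw [neg_neg] at hx2
        have hz2 := hpz _ hm
        rw [segment_symm] at hz2
        obtain ⟨h1, h2⟩ := hP.endpoints_unique hG huU hx hy hx2 (hpF _ hm) hz hz2
          (hb u huU) hb2
        simp only
        rw [← h1, ← h2, segment_symm]
    · rintro ⟨u, hu, rfl⟩
      have h1 := hP.inner_lt (ne_zero_of_norm_eq_one (hU u hu).1) (hpF u hu) (hpG u hu)
      exact ⟨⟨u, (hU u hu).1, _, hpF u hu, _, hpG u hu, h1.ne', rfl⟩, hpz u hu⟩
  have hinj : Set.InjOn (fun u => segment ℝ (p u).1 (p u).2) (Tz : Set (𝔼 n)) := by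
    intro u hu v hv huv
    by_contra hne
    have hu' : u ∈ Tz := hu
    have hv' : v ∈ Tz := hv
    rcases segment_eq_segment huv with ⟨h1, h2⟩ | ⟨h1, h2⟩
    · exact hc u (hU u hu) v (hU v hv) hne (p u).1 ⟨hpF u hu, h1 ▸ hpF v hv⟩ (p u).2
        ⟨hpG u hu, h2 ▸ hpG v hv⟩ (hpz u hu)
    -- If the ends match in reverse order, the comparison is with -v. It differs from u because T
    -- contains only one vector of each antipodal pair.
    · refine hc u (hU u hu) (-v) (neg_mem_facetNormals (hU v hv)) ?_ (p u).1
        ⟨hpF u hu, h1 ▸ hpG v hv⟩ (p u).2 ⟨hpG u hu, ?_⟩ (hpz u hu)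
      · rintro rfl
        exact (hT v (Finset.mem_filter.1 hv').1).2 (Finset.mem_filter.1 hu').1
      · rw [neg_neg]; exact h2 ▸ hpF v hv
  rw [numDiam, himg, hinj.encard_image, Set.encard_coe_eq_coe_finsetCard, ENat.toENNReal_coe,
    hTz, Finset.card_filter, Nat.cast_sum]
  simp only [Set.indicator_apply, Pi.one_apply, Nat.cast_ite, Nat.cast_one, Nat.cast_zero]

lemma IsFullPolytope.aemeasurable_numDiam (hP : IsFullPolytope P) (hG : GeneralRelPos P) :
    AEMeasurable (numDiam P) volume := by
  obtain ⟨T, hT, hT'⟩ := hP.exists_half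
  refine ⟨fun z => ∑ u ∈ T, (diamJoin P u).indicator 1 z, ?_, hP.numDiam_ae_eq hG hT hT'⟩
  exact Finset.measurable_fun_sum _ fun u _ =>
    measurable_one.indicator (isCompact_diamJoin hP.isCompact u).measurableSet

lemma IsFullPolytope.setLIntegral_numDiam (hP : IsFullPolytope P) (hG : GeneralRelPos P)
    {T : Finset (𝔼 n)} (hT : ∀ u ∈ T, u ∈ facetNormals P ∧ -u ∉ T)
    (hT' : ∀ u ∈ facetNormals P, u ∈ T ∨ -u ∈ T) :
    ∫⁻ z in P, numDiam P z = ∑ u ∈ T, volume (diamJoin P u) := by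
  rw [lintegral_congr_ae (ae_restrict_of_ae (hP.numDiam_ae_eq hG hT hT')), lintegral_finsetSum]
  · refine Finset.sum_congr rfl fun u _ => ?_
    have hm := (isCompact_diamJoin hP.isCompact u).measurableSet
    rw [lintegral_indicator_one hm, Measure.restrict_apply hm,
      Set.inter_eq_left.2 (diamJoin_subset hP.convex u)]
  · exact fun u _ => measurable_one.indicator (isCompact_diamJoin hP.isCompact u).measurableSet

end

/-! ### Dissection of s P - t P and the integral formula. -/

section

variable {P : Set (𝔼 n)}

/-- The set of all `θ • x - t • y`, `0 ≤ θ ≤ s`, with `x`, `y` in the support sets of `P` in the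
directions `u` and `-u`. -/
def growth (P : Set (𝔼 n)) (u : 𝔼 n) (s t : ℝ) : Set (𝔼 n) :=
  sweep (suppSet P u) (suppSet P (-u)) (fun θ => 0 + 1 * θ) (fun θ => -t + 0 * θ) 0 s

lemma mem_growth {u z : 𝔼 n} {s t : ℝ} :
    z ∈ growth P u s t ↔ ∃ θ ∈ Set.Icc 0 s, ∃ x ∈ suppSet P u, ∃ y ∈ suppSet P (-u),
      z = θ • x - t • y := by
  simp [growth, sweep, sub_eq_add_neg]

lemma isCompact_growth (hP : IsCompact P) (u : 𝔼 n) (s t : ℝ) : IsCompact (growth P u s t) :=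
  isCompact_sweep (isCompact_suppSet hP u) (isCompact_suppSet hP (-u)) (by fun_prop)
    (by fun_prop) 0 s

lemma exists_unit_of_ne_zero {f : (𝔼 n) →L[ℝ] ℝ} (hf : f ≠ 0) :
    ∃ u : 𝔼 n, ‖u‖ = 1 ∧ ∃ c : ℝ, 0 < c ∧ ∀ x, inner ℝ u x = c * f x := by
  set v := (InnerProductSpace.toDual ℝ (𝔼 n)).symm f
  have hv : ∀ x, inner ℝ v x = f x := fun x => InnerProductSpace.toDual_symm_apply
  have hv0 : v ≠ 0 := by
    intro h
    apply hf
    ext x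
    rw [← hv, h]; simp
  have hn : 0 < ‖v‖ := norm_pos_iff.2 hv0
  refine ⟨‖v‖⁻¹ • v, by rw [norm_smul, norm_inv, norm_norm, inv_mul_cancel₀ hn.ne'],
    ‖v‖⁻¹, inv_pos.2 hn, fun x => ?_⟩
  rw [real_inner_smul_left, hv]

lemma exists_pos_of_eventually {p : ℝ → Prop} (h : ∀ᶠ ε in nhds (0 : ℝ), p ε) :
    ∃ ε, 0 < ε ∧ p ε := by
  have h1 : ∀ᶠ ε in nhdsWithin (0 : ℝ) (Set.Ioi 0), p ε := h.filter_mono nhdsWithin_le_nhds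
  have h2 : ∀ᶠ ε in nhdsWithin (0 : ℝ) (Set.Ioi 0), 0 < ε := self_mem_nhdsWithin
  exact (h2.and h1).exists

lemma inner_pos_of_mem_suppSet (h0 : (0 : 𝔼 n) ∈ interior P) {u x : 𝔼 n} (hu : u ≠ 0)
    (hx : x ∈ suppSet P u) : 0 < inner ℝ u x := by
  have hcont : Filter.Tendsto (fun ε : ℝ => ε • u) (nhds 0) (nhds 0) := by
    have : Continuous fun ε : ℝ => ε • u := by fun_prop
    simpa using this.tendsto 0
  have h1 : ∀ᶠ ε : ℝ in nhds 0, ε • u ∈ P :=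
    (hcont.eventually (isOpen_interior.mem_nhds h0)).mono fun _ h => interior_subset h
  obtain ⟨ε, hε, hεP⟩ := exists_pos_of_eventually h1
  have h2 := hx.2 _ hεP
  rw [inner_smul_right] at h2
  have h3 : 0 < inner ℝ u u := by
    rw [real_inner_self_eq_norm_sq]; exact pow_pos (norm_pos_iff.2 hu) 2
  exact lt_of_lt_of_le (mul_pos hε h3) h2

/-- A point of `s • P - t • P` outside `-t • P` lies on the boundary of some `θ • P - t • P`. -/
lemma exists_mem_growth (hc : IsCompact P) (hconv : Convex ℝ P) (h0 : (0 : 𝔼 n) ∈ interior P)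
    {s t : ℝ} (ht : 0 < t) {w : 𝔼 n} (hw : w ∈ s • P - t • P) (hs : 0 ≤ s)
    (hw' : w ∉ (-t) • P) : ∃ u, ‖u‖ = 1 ∧ w ∈ growth P u s t := by
  set C : Set (ℝ × (𝔼 n) × (𝔼 n)) :=
    (Set.Icc 0 s ×ˢ P ×ˢ P) ∩ {p | p.1 • p.2.1 - t • p.2.2 = w} with hC
  have cC : IsCompact C := (isCompact_Icc.prod (hc.prod hc)).inter_right
    (isClosed_eq (by fun_prop) continuous_const)
  have neC : (Prod.fst '' C).Nonempty := by
    obtain ⟨_, ⟨x, hx, rfl⟩, _, ⟨y, hy, rfl⟩, rfl⟩ := hw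
    exact ⟨_, ⟨(s, x, y), ⟨⟨⟨hs, le_rfl⟩, hx, hy⟩, rfl⟩, rfl⟩⟩
  -- The least σ for which w lies in σP - tP. It is positive because w is not in -tP, and minimality
  -- puts w on the boundary.
  obtain ⟨_, ⟨⟨σ, x, y⟩, ⟨⟨⟨hσ0, hσs⟩, hx, hy⟩, hxy⟩, rfl⟩, hmin⟩ :=
    (cC.image continuous_fst).exists_isLeast neC
  simp only at hσ0 hσs hx hy hxy hmin
  have hσpos : 0 < σ := by
    refine lt_of_le_of_ne hσ0 ?_
    rintro rfl
    change (0 : ℝ) • x - t • y = w at hxy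
    exact hw' ⟨y, hy, by rw [← hxy]; simp⟩
  have hxy : σ • x - t • y = w := hxy
  set K := σ • P - t • P with hK
  have convK : Convex ℝ K := (hconv.smul σ).sub (hconv.smul t)
  have intK : (interior K).Nonempty := by
    refine Set.Nonempty.mono (s := σ • interior P - {t • y}) ?_ ?_
    · refine interior_maximal ?_ ((isOpen_interior.smul₀ hσpos.ne').sub_right)
      exact Set.sub_subset_sub (Set.smul_set_mono interior_subset)
        (Set.singleton_subset_iff.2 (Set.smul_mem_smul_set hy))
    · exact ⟨_, Set.sub_mem_sub (Set.smul_mem_smul_set h0) rfl⟩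
  -- An interior w could be pushed slightly away from -ty without leaving K. Dividing by 1 + η and
  -- absorbing y into the second summand by convexity would represent w with the smaller ratio σ/(1
  -- + η).
  have hwint : w ∉ interior K := by
    intro hwi
    have hcont : Filter.Tendsto (fun η : ℝ => w + η • (w + t • y)) (nhds 0) (nhds w) := by
      have : Continuous fun η : ℝ => w + η • (w + t • y) := by fun_prop
      simpa using this.tendsto 0
    have h1 : ∀ᶠ η : ℝ in nhds 0, w + η • (w + t • y) ∈ K :=
      (hcont.eventually (isOpen_interior.mem_nhds hwi)).mono fun _ h => interior_subset h
    obtain ⟨η, hη, hηK⟩ := exists_pos_of_eventually h1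
    obtain ⟨_, ⟨x', hx', rfl⟩, _, ⟨y', hy', rfl⟩, he⟩ := hηK
    have h1η : (1 + η) ≠ 0 := by positivity
    have hmem : σ / (1 + η) ∈ Prod.fst '' C := by
      refine ⟨(σ / (1 + η), x', (1 / (1 + η)) • y' + (η / (1 + η)) • y),
        ⟨⟨⟨by positivity, ?_⟩, hx', ?_⟩, ?_⟩, rfl⟩
      · exact (div_le_self hσ0 (by linarith)).trans hσs
      · exact hconv hy' hy (by positivity) (by positivity) (by field_simp)
      · have he' : w = (1 / (1 + η)) • ((1 + η) • w) := by
          rw [smul_smul, one_div_mul_cancel h1η, one_smul]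
        have he2 : (1 + η) • w = σ • x' - t • y' - (η * t) • y := by
          have : σ • x' - t • y' = w + η • (w + t • y) := he
          rw [this]; module
        change (σ / (1 + η)) • x' - t • ((1 / (1 + η)) • y' + (η / (1 + η)) • y) = w
        rw [he', he2]
        match_scalars <;> field_simp
    have h2 := hmin hmem
    have h3 : σ / (1 + η) < σ := div_lt_self hσpos (by linarith)
    linarith
  -- A hyperplane supporting σP - tP at w = σx - ty supports P at x and -P at -y.
  obtain ⟨f, hf⟩ := geometric_hahn_banach_open_point convK.interior isOpen_interior hwint
  have hfK : ∀ k ∈ K, f k ≤ f w := by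
    intro k hk
    have h1 : k ∈ closure (interior K) := by
      rw [convK.closure_interior_eq_closure_of_nonempty_interior intK]
      exact subset_closure hk
    exact closure_minimal (fun a ha => (hf a ha).le)
      (isClosed_le f.continuous continuous_const) h1
  have hf0 : f ≠ 0 := by
    rintro rfl
    obtain ⟨a, ha⟩ := intK
    simpa using hf a ha
  obtain ⟨u, hu, c, hcpos, hcu⟩ := exists_unit_of_ne_zero hf0
  refine ⟨u, hu, mem_growth.2 ⟨σ, ⟨hσ0, hσs⟩, x, ⟨hx, fun x' hx' => ?_⟩, y, ⟨hy, fun y' hy' => ?_⟩,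
    hxy.symm⟩⟩
  · have := hfK _ (Set.sub_mem_sub (Set.smul_mem_smul_set hx') (Set.smul_mem_smul_set hy))
    rw [← hxy] at this
    simp only [map_sub, map_smul, smul_eq_mul, sub_le_sub_iff_right] at this
    rw [hcu, hcu]
    exact mul_le_mul_of_nonneg_left (le_of_mul_le_mul_left this hσpos) hcpos.le
  · have := hfK _ (Set.sub_mem_sub (Set.smul_mem_smul_set hx) (Set.smul_mem_smul_set hy'))
    rw [← hxy] at this
    simp only [map_sub, map_smul, smul_eq_mul, sub_le_sub_iff_left] at this
    rw [inner_neg_left, inner_neg_left, hcu, hcu, neg_le_neg_iff]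
    exact mul_le_mul_of_nonneg_left (le_of_mul_le_mul_left this ht) hcpos.le

/-- The part of `s • P - t • P` outside `-t • P` is dissected by the sets `growth P u s t`. -/
lemma IsFullPolytope.volume_smul_sub_smul (hP : IsFullPolytope P) (h0 : (0 : 𝔼 n) ∈ interior P)
    {s t : ℝ} (hs : 0 ≤ s) (ht : 0 < t) :
    volume (s • P - t • P) = volume ((-t) • P) +
      ∑ u ∈ hP.finite_facetNormals.toFinset, volume (growth P u s t) := by
  classical
  have hc := hP.isCompact
  have hU : ∀ u ∈ hP.finite_facetNormals.toFinset, u ∈ facetNormals P := fun u hu => by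
    simpa using hu
  have hgm : ∀ u, MeasurableSet (growth P u s t) := fun u => (isCompact_growth hc u s t).measurableSet
  have hval : ∀ u, ‖u‖ = 1 → ∃ α β : ℝ, 0 < α ∧ (∀ x ∈ suppSet P u, inner ℝ u x = α) ∧
      (∀ y ∈ suppSet P (-u), inner ℝ u y = β) := by
    intro u hu
    obtain ⟨x, hx⟩ := hP.suppSet_nonempty u
    obtain ⟨y, hy⟩ := hP.suppSet_nonempty (-u)
    refine ⟨inner ℝ u x, inner ℝ u y, inner_pos_of_mem_suppSet h0 (ne_zero_of_norm_eq_one hu) hx,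
      fun x' hx' => inner_eq_of_mem_suppSet hx' hx, fun y' hy' => ?_⟩
    simpa using inner_eq_of_mem_suppSet hy' hy
  have hdisj : Set.Pairwise (hP.finite_facetNormals.toFinset : Set (𝔼 n))
      (Function.onFun (AEDisjoint volume) fun u => growth P u s t) := by
    intro u hu v hv huv
    have hu1 := (hU u hu).1
    have hv1 := (hU v hv).1
    obtain ⟨α, β, hα, hFα, hGβ⟩ := hval u hu1
    obtain ⟨α', β', hα', hFα', hGβ'⟩ := hval v hv1
    have hne : α' • u - α • v ≠ 0 := fun h =>
      huv (eq_of_smul_eq_smul hu1 hv1 hα' hα (sub_eq_zero.1 h))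
    refine measure_mono_null ?_ (volume_hyperplane hne (α * (t * β') - α' * (t * β)))
    rintro w ⟨hwu, hwv⟩
    obtain ⟨θ, hθ, x, hx, y, hy, rfl⟩ := mem_growth.1 hwu
    obtain ⟨θ', hθ', x', hx', y', hy', he⟩ := mem_growth.1 hwv
    have i1 : inner ℝ u (θ • x - t • y) = θ * α - t * β := by
      rw [inner_sub_right, inner_smul_right, inner_smul_right, hFα x hx, hGβ y hy]
    have i2 : inner ℝ v (θ • x - t • y) = θ' * α' - t * β' := by
      rw [he, inner_sub_right, inner_smul_right, inner_smul_right, hFα' x' hx', hGβ' y' hy']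
    have i3 : θ * α - t * β ≤ θ' * α - t * β := by
      rw [← i1, he, inner_sub_right, inner_smul_right, inner_smul_right]
      have h1 := hx.2 x' hx'.1
      have h2 := hy.2 y' hy'.1
      rw [hFα x hx] at h1
      simp only [inner_neg_left, neg_le_neg_iff, hGβ y hy] at h2
      nlinarith [mul_le_mul_of_nonneg_left h1 hθ'.1, mul_le_mul_of_nonneg_left h2 ht.le]
    have i4 : θ' * α' - t * β' ≤ θ * α' - t * β' := by
      rw [← i2, inner_sub_right, inner_smul_right, inner_smul_right]
      have h1 := hx'.2 x hx.1
      have h2 := hy'.2 y hy.1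
      rw [hFα' x' hx'] at h1
      simp only [inner_neg_left, neg_le_neg_iff, hGβ' y' hy'] at h2
      nlinarith [mul_le_mul_of_nonneg_left h1 hθ.1, mul_le_mul_of_nonneg_left h2 ht.le]
    -- A common point w maximizes u on θP - tP and v on θ'P - tP. Evaluating each functional on the
    -- other representation gives both inequalities, because α and α' are positive. With equal
    -- ratios, eliminating θ leaves one linear equation for w.
    have i5 : θ = θ' := le_antisymm (by nlinarith) (by nlinarith)
    change inner ℝ (α' • u - α • v) (θ • x - t • y) = _
    rw [inner_sub_left, real_inner_smul_left, real_inner_smul_left, i1, i2, i5]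
    ring
  -- On -tP the functional u is at most -tβ, on the layer at least -tβ; the overlap lies in the
  -- hyperplane of equality.
  have hdisj2 : AEDisjoint volume ((-t) • P)
      (⋃ u ∈ hP.finite_facetNormals.toFinset, growth P u s t) := by
    rw [AEDisjoint, Set.inter_iUnion₂]
    refine (measure_biUnion_null_iff (Finset.countable_toSet _)).2 fun u hu => ?_
    have hu1 := (hU u hu).1
    obtain ⟨α, β, hα, hFα, hGβ⟩ := hval u hu1
    refine measure_mono_null ?_ (volume_hyperplane (ne_zero_of_norm_eq_one hu1) (-(t * β)))
    rintro _ ⟨⟨z, hz, rfl⟩, hwu⟩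
    obtain ⟨θ, hθ, x, hx, y, hy, he⟩ := mem_growth.1 hwu
    simp only at he
    change inner ℝ u ((-t) • z) = _
    have h2 := hy.2 z hz
    simp only [inner_neg_left, neg_le_neg_iff, hGβ y hy] at h2
    have h3 : inner ℝ u ((-t) • z) = θ * α - t * β := by
      rw [he, inner_sub_right, inner_smul_right, inner_smul_right, hFα x hx, hGβ y hy]
    have h4 : inner ℝ u ((-t) • z) = -(t * inner ℝ u z) := by
      rw [inner_smul_right]; ring
    have h5 := mul_nonneg hθ.1 hα.le
    have h6 := mul_le_mul_of_nonneg_left h2 ht.le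
    linarith
  rw [← measure_biUnion_finset₀ hdisj (fun u _ => (hgm u).nullMeasurableSet),
    ← measure_union₀ (Finset.nullMeasurableSet_biUnion _
      fun u _ => (hgm u).nullMeasurableSet) hdisj2]
  refine measure_congr ?_
  have hnull := hP.ae_notMem_sweep 0 1 (-t) 0 0 s
  filter_upwards [hnull] with w hw
  refine propext ⟨fun h => ?_, fun h => ?_⟩
  · by_cases hwt : w ∈ (-t) • P
    · exact Or.inl hwt
    · right
      obtain ⟨u, hu, hug⟩ := exists_mem_growth hc hP.convex h0 ht h hs hwt
      have huU : u ∈ facetNormals P := by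
        by_contra hn
        exact hw u hu hn hug
      exact Set.mem_iUnion₂.2 ⟨u, by simpa using huU, hug⟩
  -- Because 0 is in P, the dilates θP increase with θ; both kinds of pieces therefore stay inside
  -- sP - tP.
  · have hs0 : ∀ θ ∈ Set.Icc 0 s, ∀ x ∈ P, θ • x ∈ s • P := by
      intro θ hθ x hx
      rcases eq_or_lt_of_le hs with rfl | hs'
      · obtain rfl : θ = 0 := le_antisymm hθ.2 hθ.1
        exact Set.smul_mem_smul_set hx
      refine ⟨(θ / s) • x, ?_, ?_⟩
      · have := hP.convex hx (interior_subset h0) (a := θ / s) (b := 1 - θ / s)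
          (div_nonneg hθ.1 hs) (by rw [sub_nonneg, div_le_one hs']; exact hθ.2) (by ring)
        simpa using this
      · simp only [smul_smul]; rw [mul_div_cancel₀ _ hs'.ne']
    rcases h with ⟨z, hz, rfl⟩ | h
    · refine ⟨0, ?_, t • z, Set.smul_mem_smul_set hz, by simp⟩
      simpa using hs0 0 ⟨le_rfl, hs⟩ z hz
    · obtain ⟨u, hu, hug⟩ := Set.mem_iUnion₂.1 h
      obtain ⟨θ, hθ, x, hx, y, hy, rfl⟩ := mem_growth.1 hug
      exact Set.sub_mem_sub (hs0 θ hθ x hx.1) (Set.smul_mem_smul_set hy.1)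

lemma sweep_comm (F G : Set (𝔼 n)) (a b : ℝ → ℝ) (c d : ℝ) :
    sweep F G a b c d = sweep G F b a c d := by
  ext z
  constructor
  · rintro ⟨θ, h, x, hx, y, hy, rfl⟩; exact ⟨θ, h, y, hy, x, hx, add_comm _ _⟩
  · rintro ⟨θ, h, x, hx, y, hy, rfl⟩; exact ⟨θ, h, y, hy, x, hx, add_comm _ _⟩

lemma IsFullPolytope.exists_facet_const (hP : IsFullPolytope P) (hG : GeneralRelPos P)
    {u : 𝔼 n} (hu : u ∈ facetNormals P) :
    ∃ C : ℝ, 0 ≤ C ∧ ∀ a₀ a₁ b₀ b₁ c d : ℝ, ∀ x ∈ suppSet P u, ∀ y ∈ suppSet P (-u),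
      a₁ * inner ℝ u x + b₁ * inner ℝ u y ≠ 0 → c ≤ d →
      volume.real (sweep (suppSet P u) (suppSet P (-u)) (fun θ => a₀ + a₁ * θ)
        (fun θ => b₀ + b₁ * θ) c d) =
        C * |a₁ * inner ℝ u x + b₁ * inner ℝ u y| *
          ∫ θ in c..d, |a₀ + a₁ * θ| ^ setDim (suppSet P u) *
            |b₀ + b₁ * θ| ^ setDim (suppSet P (-u)) := by
  obtain ⟨x₀, hx₀⟩ := hP.suppSet_nonempty u
  obtain ⟨y₀, hy₀⟩ := hP.suppSet_nonempty (-u)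
  obtain ⟨C, hC, h⟩ := exists_const_volume_sweep (innerSL ℝ u).toLinearMap (e₀ := u)
    (by change inner ℝ u u = 1; rw [real_inner_self_eq_norm_sq, hu.1]; norm_num)
    (hP.inf_eq_bot hG hu) (hP.sup_eq_ker hu) (isCompact_suppSet hP.isCompact u)
    (isCompact_suppSet hP.isCompact (-u)) (x₀ := x₀) (y₀ := y₀)
    (fun x hx => vsub_mem_vectorSpan ℝ hx hx₀) (fun y hy => vsub_mem_vectorSpan ℝ hy hy₀)
  refine ⟨C, hC, fun a₀ a₁ b₀ b₁ c d x hx y hy hne hcd => ?_⟩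
  have e1 := inner_eq_of_mem_suppSet hx hx₀
  have e2 : inner ℝ u y = inner ℝ u y₀ := by simpa using inner_eq_of_mem_suppSet hy hy₀
  rw [e1, e2] at hne ⊢
  exact h a₀ a₁ b₀ b₁ c d hne hcd

lemma volume_growth {u : 𝔼 n} {C : ℝ}
    (h : ∀ a₀ a₁ b₀ b₁ c d : ℝ, ∀ x ∈ suppSet P u, ∀ y ∈ suppSet P (-u),
      a₁ * inner ℝ u x + b₁ * inner ℝ u y ≠ 0 → c ≤ d →
      volume.real (sweep (suppSet P u) (suppSet P (-u)) (fun θ => a₀ + a₁ * θ)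
        (fun θ => b₀ + b₁ * θ) c d) =
        C * |a₁ * inner ℝ u x + b₁ * inner ℝ u y| *
          ∫ θ in c..d, |a₀ + a₁ * θ| ^ setDim (suppSet P u) *
            |b₀ + b₁ * θ| ^ setDim (suppSet P (-u)))
    {x y : 𝔼 n} (hx : x ∈ suppSet P u) (hy : y ∈ suppSet P (-u)) (hα : 0 < inner ℝ u x)
    {s t : ℝ} (hs : 0 ≤ s) (ht : 0 ≤ t) :
    volume.real (growth P u s t) = C * inner ℝ u x *
      (s ^ (setDim (suppSet P u) + 1) / (setDim (suppSet P u) + 1) *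
        t ^ setDim (suppSet P (-u))) := by
  rw [growth, h 0 1 (-t) 0 0 s x hx y hy (by linarith) hs]
  congr 1
  · rw [abs_of_pos (by linarith)]; ring
  · have : Set.EqOn (fun θ : ℝ => |0 + 1 * θ| ^ setDim (suppSet P u) *
        |-t + 0 * θ| ^ setDim (suppSet P (-u)))
        (fun θ => θ ^ setDim (suppSet P u) * t ^ setDim (suppSet P (-u))) (Set.uIcc 0 s) := by
      intro θ hθ
      rw [Set.uIcc_of_le hs] at hθ
      simp only
      rw [abs_of_nonneg (by linarith [hθ.1]), show -t + 0 * θ = -t by ring, abs_neg,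
        abs_of_nonneg ht]
      ring
    rw [intervalIntegral.integral_congr this, intervalIntegral.integral_mul_const, integral_pow]
    simp

/-- The volumes of the pieces belonging to a pair of opposite facets of `P - P`. -/
lemma IsFullPolytope.facet_volumes (hP : IsFullPolytope P) (hG : GeneralRelPos P)
    (h0 : (0 : 𝔼 n) ∈ interior P) {u : 𝔼 n} (hu : u ∈ facetNormals P) :
    ∃ (C α β : ℝ) (k m : ℕ), k + m + 1 = n ∧
      volume.real (diamJoin P u) = C * (α + β) * ∫ θ in (0 : ℝ)..1, (1 - θ) ^ k * θ ^ m ∧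
      (∀ s t : ℝ, 0 ≤ s → 0 ≤ t →
        volume.real (growth P u s t) = C * α * (s ^ (k + 1) / (k + 1) * t ^ m)) ∧
      (∀ s t : ℝ, 0 ≤ s → 0 ≤ t →
        volume.real (growth P (-u) s t) = C * β * (s ^ (m + 1) / (m + 1) * t ^ k)) := by
  obtain ⟨C, hC, h⟩ := hP.exists_facet_const hG hu
  obtain ⟨x, hx⟩ := hP.suppSet_nonempty u
  obtain ⟨y, hy⟩ := hP.suppSet_nonempty (-u)
  have hα := inner_pos_of_mem_suppSet h0 (ne_zero_of_norm_eq_one hu.1) hx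
  have hβ := inner_pos_of_mem_suppSet h0 (neg_ne_zero.2 (ne_zero_of_norm_eq_one hu.1)) hy
  rw [inner_neg_left] at hβ
  refine ⟨C, inner ℝ u x, -inner ℝ u y, setDim (suppSet P u), setDim (suppSet P (-u)),
    hG u hu.1 hu.2, ?_, fun s t hs ht => volume_growth h hx hy hα hs ht, ?_⟩
  · rw [diamJoin, h 1 (-1) 0 1 0 1 x hx y hy (by linarith) zero_le_one]
    congr 1
    · rw [abs_of_neg (by linarith)]; ring
    · refine intervalIntegral.integral_congr fun θ hθ => ?_
      rw [Set.uIcc_of_le zero_le_one] at hθ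
      rw [abs_of_nonneg (by linarith [hθ.2]), abs_of_nonneg (by linarith [hθ.1])]
      ring
  · intro s t hs ht
    -- The layer of -u sweeps the same two faces with exchanged roles, so the constant C is shared
    -- by u and -u.
    rw [growth, neg_neg, sweep_comm, h (-t) 0 0 1 0 s x hx y hy (by linarith) hs]
    congr 1
    · rw [abs_of_neg (by linarith)]; ring
    · have : Set.EqOn (fun θ : ℝ => |-t + 0 * θ| ^ setDim (suppSet P u) *
          |0 + 1 * θ| ^ setDim (suppSet P (-u)))
          (fun θ => θ ^ setDim (suppSet P (-u)) * t ^ setDim (suppSet P u)) (Set.uIcc 0 s) := by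
        intro θ hθ
        rw [Set.uIcc_of_le hs] at hθ
        simp only
        rw [abs_of_nonneg (a := 0 + 1 * θ) (by linarith [hθ.1]), show -t + 0 * θ = -t by ring,
          abs_neg, abs_of_nonneg ht]
        ring
      rw [intervalIntegral.integral_congr this, intervalIntegral.integral_mul_const, integral_pow]
      simp

/-- Integration by parts: (1-t)^(k+1) t^(m+1) vanishes at 0 and 1. -/
lemma integral_beta_symm (k m : ℕ) :
    ((k : ℝ) + 1) * ∫ t in (0 : ℝ)..1, (1 - t) ^ k * t ^ (m + 1) =
      (m + 1) * ∫ t in (0 : ℝ)..1, (1 - t) ^ (k + 1) * t ^ m := by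
  have hd : ∀ t ∈ Set.uIcc (0 : ℝ) 1, HasDerivAt (fun t : ℝ => (1 - t) ^ (k + 1) * t ^ (m + 1))
      (-((k + 1) * ((1 - t) ^ k * t ^ (m + 1))) + (m + 1) * ((1 - t) ^ (k + 1) * t ^ m)) t := by
    intro t _
    have h1 : HasDerivAt (fun t : ℝ => (1 - t) ^ (k + 1)) (-((k + 1) * (1 - t) ^ k)) t := by
      exact (((hasDerivAt_id t).const_sub 1).pow (k + 1)).congr_deriv (by simp)
    have h2 : HasDerivAt (fun t : ℝ => t ^ (m + 1)) ((m + 1) * t ^ m) t := by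
      exact (hasDerivAt_pow (m + 1) t).congr_deriv (by simp)
    exact (h1.mul h2).congr_deriv (by ring)
  have h := intervalIntegral.integral_eq_sub_of_hasDerivAt hd
    (Continuous.intervalIntegrable (by fun_prop) _ _)
  rw [intervalIntegral.integral_add (Continuous.intervalIntegrable (by fun_prop) _ _)
    (Continuous.intervalIntegrable (by fun_prop) _ _), intervalIntegral.integral_neg,
    intervalIntegral.integral_const_mul, intervalIntegral.integral_const_mul] at h
  simp at h
  linarith

lemma integral_beta_succ (k m : ℕ) :
    ((k : ℝ) + m + 2) * ∫ t in (0 : ℝ)..1, (1 - t) ^ (k + 1) * t ^ m =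
      (k + 1) * ∫ t in (0 : ℝ)..1, (1 - t) ^ k * t ^ m := by
  have h1 := integral_beta_symm k m
  have h2 : ∫ t in (0 : ℝ)..1, (1 - t) ^ k * t ^ (m + 1) =
      (∫ t in (0 : ℝ)..1, (1 - t) ^ k * t ^ m) - ∫ t in (0 : ℝ)..1, (1 - t) ^ (k + 1) * t ^ m := by
    rw [← intervalIntegral.integral_sub (Continuous.intervalIntegrable (by fun_prop) _ _)
      (Continuous.intervalIntegrable (by fun_prop) _ _)]
    refine intervalIntegral.integral_congr fun t _ => ?_
    ring
  rw [h2] at h1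
  linarith

lemma integral_beta_comm (k m : ℕ) :
    ∫ t in (0 : ℝ)..1, (1 - t) ^ k * t ^ m = ∫ t in (0 : ℝ)..1, (1 - t) ^ m * t ^ k := by
  have := intervalIntegral.integral_comp_sub_left (a := (0 : ℝ)) (b := 1)
    (fun t : ℝ => (1 - t) ^ k * t ^ m) 1
  simp only [sub_self, sub_zero] at this
  rw [← this]
  refine intervalIntegral.integral_congr fun t _ => ?_
  ring

/-- The dissection with s = 1 - t makes the volume a polynomial in t for 0 < t < 1. Its integral is
computed termwise: the layers of u and -u carry the factors Cα and Cβ, and their Beta integrals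
combine to the width factor C(α + β) in the volume of the join. The continuous extension q is kept
for the later comparisons of integrals. -/
lemma IsFullPolytope.integral_volume_zero_mem (hP : IsFullPolytope P) (hG : GeneralRelPos P)
    (h0 : (0 : 𝔼 n) ∈ interior P) {T : Finset (𝔼 n)}
    (hT : ∀ u ∈ T, u ∈ facetNormals P ∧ -u ∉ T)
    (hT' : ∀ u ∈ facetNormals P, u ∈ T ∨ -u ∈ T) :
    ((n : ℝ) + 1) * (∫ t in (0 : ℝ)..1, volume.real ((1 - t) • P - t • P)) =
      volume.real P + ∑ u ∈ T, volume.real (diamJoin P u) ∧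
    ∃ q : ℝ → ℝ, Continuous q ∧
      ∀ t ∈ Set.Ioo (0 : ℝ) 1, volume.real ((1 - t) • P - t • P) = q t := by
  classical
  have hex : ∀ u : T, ∃ (C α β : ℝ) (k m : ℕ), k + m + 1 = n ∧
      volume.real (diamJoin P u) = C * (α + β) * ∫ θ in (0 : ℝ)..1, (1 - θ) ^ k * θ ^ m ∧
      (∀ s t : ℝ, 0 ≤ s → 0 ≤ t →
        volume.real (growth P u s t) = C * α * (s ^ (k + 1) / (k + 1) * t ^ m)) ∧
      (∀ s t : ℝ, 0 ≤ s → 0 ≤ t →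
        volume.real (growth P (-u) s t) = C * β * (s ^ (m + 1) / (m + 1) * t ^ k)) :=
    fun u => hP.facet_volumes hG h0 (hT u u.2).1
  choose C α β k m hkm hJ hA hA' using hex
  have hfac : hP.finite_facetNormals.toFinset = T ∪ T.image Neg.neg := by
    ext u
    simp only [Set.Finite.mem_toFinset, Finset.mem_union, Finset.mem_image]
    constructor
    · intro hu
      rcases hT' u hu with h | h
      · exact Or.inl h
      · exact Or.inr ⟨-u, h, neg_neg u⟩
    · rintro (h | ⟨v, hv, rfl⟩)
      · exact (hT u h).1
      · exact neg_mem_facetNormals (hT v hv).1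
  have hdis : Disjoint T (T.image Neg.neg) := by
    rw [Finset.disjoint_left]
    rintro u hu hu'
    obtain ⟨v, hv, rfl⟩ := Finset.mem_image.1 hu'
    exact (hT v hv).2 hu
  set q : ℝ → ℝ := fun t => t ^ n * volume.real P + ∑ u : T,
    (C u * α u * ((1 - t) ^ (k u + 1) / (k u + 1) * t ^ m u) +
      C u * β u * ((1 - t) ^ (m u + 1) / (m u + 1) * t ^ k u)) with hq
  have hqc : Continuous q := by fun_prop
  have hfin : ∀ u s t, volume (growth P u s t) ≠ ∞ := fun u s t =>
    (isCompact_growth hP.isCompact u s t).measure_lt_top.ne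
  have hvol : ∀ t ∈ Set.Ioo (0 : ℝ) 1, volume.real ((1 - t) • P - t • P) = q t := by
    intro t ht
    have ht1 : 0 ≤ 1 - t := by linarith [ht.2]
    have hN : volume ((-t) • P) = ENNReal.ofReal (t ^ n) * volume P := by
      rw [Measure.addHaar_smul, finrank_euclideanSpace_fin, abs_pow, abs_neg, abs_of_pos ht.1]
    rw [Measure.real, hP.volume_smul_sub_smul h0 ht1 ht.1, ENNReal.toReal_add
      (by rw [hN]; exact ENNReal.mul_ne_top ENNReal.ofReal_ne_top hP.volume_ne_top)
      (ENNReal.sum_ne_top.2 fun u _ => hfin u _ _), hN, ENNReal.toReal_mul,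
      ENNReal.toReal_ofReal (pow_nonneg ht.1.le n), ENNReal.toReal_sum (fun u _ => hfin u _ _),
      hfac, Finset.sum_union hdis, Finset.sum_image (fun a _ b _ h => neg_injective h),
      ← Finset.sum_add_distrib, hq]
    simp only
    congr 1
    rw [← Finset.sum_coe_sort]
    refine Finset.sum_congr rfl fun u _ => ?_
    rw [← hA u _ _ ht1 ht.1.le, ← hA' u _ _ ht1 ht.1.le]
    rfl
  refine ⟨?_, q, hqc, hvol⟩
  have hint : ∫ t in (0 : ℝ)..1, volume.real ((1 - t) • P - t • P) = ∫ t in (0 : ℝ)..1, q t := by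
    rw [intervalIntegral.integral_of_le zero_le_one, intervalIntegral.integral_of_le zero_le_one,
      integral_Ioc_eq_integral_Ioo, integral_Ioc_eq_integral_Ioo]
    exact setIntegral_congr_fun measurableSet_Ioo hvol
  -- The Beta recursion with a + b + 2 = n + 1; this is the source of the factor n + 1 in the
  -- formula.
  have hb : ∀ a b : ℕ, a + b + 1 = n → ((n : ℝ) + 1) *
      ∫ t in (0 : ℝ)..1, (1 - t) ^ (a + 1) / (a + 1) * t ^ b =
        ∫ t in (0 : ℝ)..1, (1 - t) ^ a * t ^ b := by
    intro a b hab
    have h1 := integral_beta_succ a b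
    have h2 : ∫ t in (0 : ℝ)..1, (1 - t) ^ (a + 1) / ((a : ℝ) + 1) * t ^ b =
        (1 / ((a : ℝ) + 1)) * ∫ t in (0 : ℝ)..1, (1 - t) ^ (a + 1) * t ^ b := by
      rw [← intervalIntegral.integral_const_mul]
      refine intervalIntegral.integral_congr fun t _ => ?_
      ring
    have h3 : (n : ℝ) + 1 = a + b + 2 := by rw [← hab]; push_cast; ring
    rw [h2, h3]
    have h4 : (a : ℝ) + 1 ≠ 0 := by positivity
    calc ((a : ℝ) + b + 2) * (1 / ((a : ℝ) + 1) * ∫ t in (0 : ℝ)..1, (1 - t) ^ (a + 1) * t ^ b)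
        = (1 / ((a : ℝ) + 1)) * (((a : ℝ) + b + 2) *
            ∫ t in (0 : ℝ)..1, (1 - t) ^ (a + 1) * t ^ b) := by ring
      _ = _ := by rw [h1]; field_simp
  have hii : ∀ f : ℝ → ℝ, Continuous f → IntervalIntegrable f volume 0 1 :=
    fun f hf => hf.intervalIntegrable _ _
  have hpn : ((n : ℝ) + 1) * ∫ t in (0 : ℝ)..1, t ^ n = 1 := by
    rw [integral_pow]
    have : (n : ℝ) + 1 ≠ 0 := by positivity
    field_simp; simp
  rw [hint, hq, intervalIntegral.integral_add (hii _ (by fun_prop)) (hii _ (by fun_prop)),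
    intervalIntegral.integral_mul_const,
    intervalIntegral.integral_finsetSum (fun u _ => hii _ (by fun_prop)), mul_add, ← mul_assoc, hpn,
    one_mul, Finset.mul_sum, ← Finset.sum_coe_sort T]
  congr 1
  refine Finset.sum_congr rfl fun u _ => ?_
  rw [intervalIntegral.integral_add (hii _ (by fun_prop)) (hii _ (by fun_prop)),
    intervalIntegral.integral_const_mul, intervalIntegral.integral_const_mul, hJ]
  have e1 := hb (k u) (m u) (hkm u)
  have e2 := hb (m u) (k u) (by rw [← hkm u]; ring)
  rw [integral_beta_comm (m u) (k u)] at e2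
  calc _ = C u * α u * (((n : ℝ) + 1) *
          ∫ t in (0 : ℝ)..1, (1 - t) ^ (k u + 1) / ((k u : ℝ) + 1) * t ^ m u) +
        C u * β u * (((n : ℝ) + 1) *
          ∫ t in (0 : ℝ)..1, (1 - t) ^ (m u + 1) / ((m u : ℝ) + 1) * t ^ k u) := by ring
    _ = _ := by rw [e1, e2]; ring

end

/-! ### Translation invariance, the mean formula and the lower bound. -/

section

variable {P : Set (𝔼 n)}

lemma suppSet_vadd (v : 𝔼 n) (P : Set (𝔼 n)) (u : 𝔼 n) :
    suppSet (v +ᵥ P) u = v +ᵥ suppSet P u := by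
  ext x
  constructor
  · rintro ⟨⟨x, hx, rfl⟩, h⟩
    refine ⟨x, ⟨hx, fun y hy => ?_⟩, rfl⟩
    have := h _ (Set.vadd_mem_vadd_set hy)
    simpa [inner_add_right] using this
  · rintro ⟨x, ⟨hx, h⟩, rfl⟩
    refine ⟨Set.vadd_mem_vadd_set hx, ?_⟩
    rintro _ ⟨y, hy, rfl⟩
    have := h y hy
    simpa [inner_add_right] using this

lemma vadd_add_vadd (v w : 𝔼 n) (A B : Set (𝔼 n)) :
    (v +ᵥ A) + (w +ᵥ B) = (v + w) +ᵥ (A + B) := by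
  ext x
  constructor
  · rintro ⟨_, ⟨a, ha, rfl⟩, _, ⟨b, hb, rfl⟩, rfl⟩
    exact ⟨a + b, Set.add_mem_add ha hb, by simp only [vadd_eq_add]; abel⟩
  · rintro ⟨_, ⟨a, ha, b, hb, rfl⟩, rfl⟩
    exact ⟨v + a, ⟨a, ha, rfl⟩, w + b, ⟨b, hb, rfl⟩, by simp only [vadd_eq_add]; abel⟩

lemma setDim_vadd (v : 𝔼 n) (A : Set (𝔼 n)) : setDim (v +ᵥ A) = setDim A := by
  rw [setDim, vectorSpan_vadd, setDim]

lemma IsFullPolytope.vadd (hP : IsFullPolytope P) (v : 𝔼 n) : IsFullPolytope (v +ᵥ P) := by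
  refine ⟨?_, by rw [setDim_vadd]; exact hP.2⟩
  obtain ⟨⟨V, hV, hne, rfl⟩, -⟩ := hP
  exact ⟨v +ᵥ V, hV.vadd_set, hne.vadd_set, (convexHull_vadd v V).symm⟩

lemma GeneralRelPos.vadd (hG : GeneralRelPos P) (v : 𝔼 n) : GeneralRelPos (v +ᵥ P) := by
  intro u hu
  rw [suppSet_vadd, suppSet_vadd, vadd_add_vadd, setDim_vadd, setDim_vadd, setDim_vadd]
  exact hG u hu

lemma facetNormals_vadd (v : 𝔼 n) (P : Set (𝔼 n)) :
    facetNormals (v +ᵥ P) = facetNormals P := by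
  simp only [facetNormals, suppSet_vadd, vadd_add_vadd, setDim_vadd]

lemma diamJoin_vadd (v : 𝔼 n) (P : Set (𝔼 n)) (u : 𝔼 n) :
    diamJoin (v +ᵥ P) u = v +ᵥ diamJoin P u := by
  ext z
  simp only [diamJoin, suppSet_vadd]
  constructor
  · rintro ⟨θ, hθ, _, ⟨x, hx, rfl⟩, _, ⟨y, hy, rfl⟩, rfl⟩
    refine ⟨_, ⟨θ, hθ, x, hx, y, hy, rfl⟩, ?_⟩
    simp only [vadd_eq_add]; module
  · rintro ⟨_, ⟨θ, hθ, x, hx, y, hy, rfl⟩, rfl⟩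
    refine ⟨θ, hθ, _, Set.vadd_mem_vadd_set hx, _, Set.vadd_mem_vadd_set hy, ?_⟩
    simp only [vadd_eq_add]; module

lemma smul_sub_smul_vadd (v : 𝔼 n) (P : Set (𝔼 n)) (s t : ℝ) :
    s • (v +ᵥ P) - t • (v +ᵥ P) = (s • v - t • v) +ᵥ (s • P - t • P) := by
  ext z
  constructor
  · rintro ⟨_, ⟨_, ⟨x, hx, rfl⟩, rfl⟩, _, ⟨_, ⟨y, hy, rfl⟩, rfl⟩, rfl⟩
    refine ⟨_, Set.sub_mem_sub (Set.smul_mem_smul_set hx) (Set.smul_mem_smul_set hy), ?_⟩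
    simp only [vadd_eq_add]; module
  · rintro ⟨_, ⟨_, ⟨x, hx, rfl⟩, _, ⟨y, hy, rfl⟩, rfl⟩, rfl⟩
    refine ⟨_, ⟨v + x, ⟨x, hx, rfl⟩, rfl⟩, _, ⟨v + y, ⟨y, hy, rfl⟩, rfl⟩, ?_⟩
    simp only [vadd_eq_add]; module

lemma volumeReal_vadd (v : 𝔼 n) (A : Set (𝔼 n)) : volume.real (v +ᵥ A) = volume.real A := by
  rw [Measure.real, measure_vadd, Measure.real]

/-- The dissection needs an interior origin; every quantity involved is invariant under translation
of P, so any interior point may be moved there. -/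
lemma IsFullPolytope.integral_volume (hP : IsFullPolytope P) (hG : GeneralRelPos P)
    {T : Finset (𝔼 n)} (hT : ∀ u ∈ T, u ∈ facetNormals P ∧ -u ∉ T)
    (hT' : ∀ u ∈ facetNormals P, u ∈ T ∨ -u ∈ T) :
    ((n : ℝ) + 1) * (∫ t in (0 : ℝ)..1, volume.real ((1 - t) • P - t • P)) =
      volume.real P + ∑ u ∈ T, volume.real (diamJoin P u) ∧
    ∃ q : ℝ → ℝ, Continuous q ∧
      ∀ t ∈ Set.Ioo (0 : ℝ) 1, volume.real ((1 - t) • P - t • P) = q t := by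
  obtain ⟨p, hp⟩ := hP.interior_nonempty
  have h0 : (0 : 𝔼 n) ∈ interior (-p +ᵥ P) := by
    rw [interior_vadd]
    exact ⟨p, hp, by simp⟩
  have h := (hP.vadd (-p)).integral_volume_zero_mem (hG.vadd (-p)) h0 (T := T)
    (by rwa [facetNormals_vadd]) (by rwa [facetNormals_vadd])
  simpa only [smul_sub_smul_vadd, volumeReal_vadd, diamJoin_vadd] using h

lemma IsFullPolytope.meanDiam_formula (hP : IsFullPolytope P) (hG : GeneralRelPos P) :
    meanDiam P ≠ ∞ ∧ (meanDiam P).toReal = ((n : ℝ) + 1) / volume.real P *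
      (∫ t in (0 : ℝ)..1, volume.real ((1 - t) • P - t • P)) - 1 := by
  obtain ⟨T, hT, hT'⟩ := hP.exists_half
  have h1 := hP.setLIntegral_numDiam hG hT hT'
  have h2 := (hP.integral_volume hG hT hT').1
  have hfin : ∀ u ∈ T, volume (diamJoin P u) ≠ ∞ := fun u _ =>
    (isCompact_diamJoin hP.isCompact u).measure_lt_top.ne
  have hv := hP.volumeReal_pos
  refine ⟨?_, ?_⟩
  · rw [meanDiam, h1]
    exact ENNReal.div_ne_top (ENNReal.sum_ne_top.2 hfin) hP.volume_pos.ne'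
  · rw [meanDiam, h1, ENNReal.toReal_div, ENNReal.toReal_sum hfin, div_mul_eq_mul_div, h2]
    change (∑ u ∈ T, volume.real (diamJoin P u)) / volume.real P = _
    field_simp
    ring

lemma IsFullPolytope.exists_continuous_volume (hP : IsFullPolytope P) (hG : GeneralRelPos P) :
    ∃ q : ℝ → ℝ, Continuous q ∧
      ∀ t ∈ Set.Ioo (0 : ℝ) 1, volume.real ((1 - t) • P - t • P) = q t := by
  obtain ⟨T, hT, hT'⟩ := hP.exists_half
  exact (hP.integral_volume hG hT hT').2

lemma integral_eq_of_eqOn_Ioo {f q : ℝ → ℝ} (h : ∀ t ∈ Set.Ioo (0 : ℝ) 1, f t = q t) :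
    ∫ t in (0 : ℝ)..1, f t = ∫ t in (0 : ℝ)..1, q t := by
  rw [intervalIntegral.integral_of_le zero_le_one, intervalIntegral.integral_of_le zero_le_one,
    integral_Ioc_eq_integral_Ioo, integral_Ioc_eq_integral_Ioo]
  exact setIntegral_congr_fun measurableSet_Ioo h

lemma isCompact_smul_sub_smul (hP : IsCompact P) (s t : ℝ) : IsCompact (s • P - t • P) := by
  rw [sub_eq_add_neg]
  exact (hP.smul s).add (hP.smul t).neg

/-- Brunn-Minkowski for P and -P, which have equal volume. -/
lemma volumeReal_le_volumeReal_smul_sub_smul (hP : IsCompact P) {t : ℝ}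
    (ht : t ∈ Set.Ioo (0 : ℝ) 1) : volume.real P ≤ volume.real ((1 - t) • P - t • P) := by
  refine ENNReal.toReal_mono (isCompact_smul_sub_smul hP _ _).measure_lt_top.ne ?_
  refine le_volume_of_volume_eq ht.1 ht.2 hP hP.neg (isCompact_smul_sub_smul hP _ _)
    (by rw [Measure.measure_neg]) ?_
  intro x hx y hy
  refine ⟨(1 - t) • x, Set.smul_mem_smul_set hx, t • (-y), Set.smul_mem_smul_set hy, ?_⟩
  simp

/-- The lower bound, from the Brunn-Minkowski inequality. -/
lemma IsFullPolytope.le_meanDiam (hP : IsFullPolytope P) (hG : GeneralRelPos P) :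
    (n : ℝ) ≤ (meanDiam P).toReal := by
  obtain ⟨q, hq, hqv⟩ := hP.exists_continuous_volume hG
  rw [(hP.meanDiam_formula hG).2, integral_eq_of_eqOn_Ioo hqv]
  have hv := hP.volumeReal_pos
  have hle : volume.real P ≤ ∫ t in (0 : ℝ)..1, q t := by
    have h := intervalIntegral.integral_mono_on_of_le_Ioo (μ := volume) zero_le_one
      (intervalIntegrable_const (c := volume.real P)) (hq.intervalIntegrable 0 1)
      (fun t ht => (volumeReal_le_volumeReal_smul_sub_smul hP.isCompact ht).trans_eq (hqv t ht))
    simpa using h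
  rw [div_mul_eq_mul_div, le_sub_iff_add_le, le_div_iff₀ hv]
  have : 0 ≤ (n : ℝ) + 1 := by positivity
  exact mul_le_mul_of_nonneg_left hle this

/-- A strict inequality at the midpoint improves the lower bound. -/
lemma IsFullPolytope.lt_meanDiam_of_lt (hP : IsFullPolytope P) (hG : GeneralRelPos P)
    (h : volume.real P < volume.real ((1 - (1 / 2 : ℝ)) • P - (1 / 2 : ℝ) • P)) :
    (n : ℝ) < (meanDiam P).toReal := by
  obtain ⟨q, hq, hqv⟩ := hP.exists_continuous_volume hG
  rw [(hP.meanDiam_formula hG).2, integral_eq_of_eqOn_Ioo hqv]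
  have hv := hP.volumeReal_pos
  have hle : volume.real P < ∫ t in (0 : ℝ)..1, q t := by
    have hge : ∀ t ∈ Set.Icc (0 : ℝ) 1, volume.real P ≤ q t := by
      have hcl : IsClosed {t | volume.real P ≤ q t} := isClosed_le continuous_const hq
      have : Set.Ioo (0 : ℝ) 1 ⊆ {t | volume.real P ≤ q t} := fun t ht =>
        (volumeReal_le_volumeReal_smul_sub_smul hP.isCompact ht).trans_eq (hqv t ht)
      have h2 := closure_minimal this hcl
      rwa [closure_Ioo zero_ne_one] at h2
    have h := intervalIntegral.integral_lt_integral_of_continuousOn_of_le_of_exists_lt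
      (f := fun _ => volume.real P) (g := q) zero_lt_one continuousOn_const hq.continuousOn
      (fun t ht => hge t (Set.Ioc_subset_Icc_self ht))
      ⟨1 / 2, by norm_num, by rw [← hqv _ (by norm_num)]; exact h⟩
    simpa using h
  rw [div_mul_eq_mul_div, lt_sub_iff_add_lt, lt_div_iff₀ hv]
  have : 0 < (n : ℝ) + 1 := by positivity
  exact mul_lt_mul_of_pos_left hle this

end

/-! ### Strictness of the lower bound in dimension at least two. -/

section

variable {P : Set (𝔼 n)}

/-- Let t tend to 0 in the dissection of P - tP. Its volume is at least V(P), while -tP and every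
layer whose opposite face has positive dimension tend to volume 0; so some layer with a vertex as
opposite face has a nonzero constant. -/
lemma IsFullPolytope.exists_facet_zero_mem (hP : IsFullPolytope P) (hG : GeneralRelPos P)
    (hn : n ≠ 0) (h0 : (0 : 𝔼 n) ∈ interior P) : ∃ u ∈ facetNormals P,
      setDim (suppSet P (-u)) = 0 ∧ 0 < volume.real (diamJoin P u) := by
  classical
  by_contra! hcon
  set U := hP.finite_facetNormals.toFinset
  have hU : ∀ u : U, (u : 𝔼 n) ∈ facetNormals P := fun u =>
    hP.finite_facetNormals.mem_toFinset.1 u.2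
  have hex : ∀ u : U, ∃ c : ℝ, ∃ m : ℕ, m ≠ 0 ∧ ∀ t : ℝ, 0 ≤ t →
      volume.real (growth P u 1 t) ≤ c * t ^ m := by
    intro u
    obtain ⟨C, hC, h⟩ := hP.exists_facet_const hG (hU u)
    obtain ⟨x, hx⟩ := hP.suppSet_nonempty u
    obtain ⟨y, hy⟩ := hP.suppSet_nonempty (-(u : 𝔼 n))
    have hu0 := ne_zero_of_norm_eq_one (hU u).1
    have hα := inner_pos_of_mem_suppSet h0 hu0 hx
    have hlt := hP.inner_lt hu0 hx hy
    have hg : ∀ t : ℝ, 0 ≤ t → _ := fun t ht => volume_growth h hx hy hα zero_le_one ht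
    by_cases hm : setDim (suppSet P (-(u : 𝔼 n))) = 0
    -- Here the constant C turns out to vanish, so the bound 0 holds with any nonzero exponent; 1 is
    -- an arbitrary choice.
    · refine ⟨0, 1, one_ne_zero, fun t ht => ?_⟩
      have h1 := hcon u (hU u) hm
      rw [diamJoin, h 1 (-1) 0 1 0 1 x hx y hy (by linarith) zero_le_one, hm] at h1
      have h2 : 0 < ∫ θ in (0 : ℝ)..1, |1 + -1 * θ| ^ setDim (suppSet P (u : 𝔼 n)) *
          |0 + 1 * θ| ^ 0 := by
        refine intervalIntegral.intervalIntegral_pos_of_pos_on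
          (Continuous.intervalIntegrable (by fun_prop) _ _) (fun θ hθ => ?_) zero_lt_one
        have : 1 + -1 * θ ≠ 0 := by linarith [hθ.2]
        positivity
      have h3 : 0 < |-1 * inner ℝ (u : 𝔼 n) x + 1 * inner ℝ (u : 𝔼 n) y| :=
        abs_pos.2 (by linarith)
      have h4 : C ≤ 0 := by
        by_contra! hC'
        have := mul_pos (mul_pos hC' h3) h2
        linarith
      have h5 : C = 0 := le_antisymm h4 hC
      rw [hg t ht, h5]
      simp
    · exact ⟨_, _, hm, fun t ht => by rw [hg t ht, ← mul_assoc]⟩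
  choose c m hm hcm using hex
  set q : ℝ → ℝ := fun t => t ^ n * volume.real P + ∑ u : U, c u * t ^ m u with hq
  have hqc : Continuous q := by fun_prop
  have hq0 : q 0 = 0 := by simp [hq, hn, hm]
  have hfin : ∀ u s t, volume (growth P u s t) ≠ ∞ := fun u s t =>
    (isCompact_growth hP.isCompact u s t).measure_lt_top.ne
  have hge : ∀ t ∈ Set.Ioi (0 : ℝ), volume.real P ≤ q t := by
    intro t ht
    have ht : 0 < t := ht
    have hN : volume ((-t) • P) = ENNReal.ofReal (t ^ n) * volume P := by
      rw [Measure.addHaar_smul, finrank_euclideanSpace_fin, abs_pow, abs_neg, abs_of_pos ht]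
    have h1 : volume.real P ≤ volume.real ((1 : ℝ) • P - t • P) := by
      refine ENNReal.toReal_mono (isCompact_smul_sub_smul hP.isCompact _ _).measure_lt_top.ne
        (measure_mono ?_)
      intro x hx
      exact ⟨x, by simpa using hx, t • (0 : 𝔼 n), Set.smul_mem_smul_set (interior_subset h0),
        by simp⟩
    refine h1.trans ?_
    rw [Measure.real, hP.volume_smul_sub_smul h0 zero_le_one ht, ENNReal.toReal_add
      (by rw [hN]; exact ENNReal.mul_ne_top ENNReal.ofReal_ne_top hP.volume_ne_top)
      (ENNReal.sum_ne_top.2 fun u _ => hfin u _ _), hN, ENNReal.toReal_mul,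
      ENNReal.toReal_ofReal (pow_nonneg ht.le n), ENNReal.toReal_sum (fun u _ => hfin u _ _), hq]
    refine add_le_add le_rfl ?_
    rw [← Finset.sum_coe_sort]
    exact Finset.sum_le_sum fun u _ => hcm u t ht.le
  have hcl : IsClosed {t | volume.real P ≤ q t} := isClosed_le continuous_const hqc
  have h2 := closure_minimal (s := Set.Ioi (0 : ℝ)) hge hcl
  rw [closure_Ioi] at h2
  have h3 : volume.real P ≤ q 0 := h2 (Set.mem_Ici.2 le_rfl)
  rw [hq0] at h3
  linarith [hP.volumeReal_pos]

/-- `P` has a facet with an opposite vertex. -/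
lemma IsFullPolytope.exists_facet (hP : IsFullPolytope P) (hG : GeneralRelPos P) (hn : n ≠ 0) :
    ∃ u ∈ facetNormals P, setDim (suppSet P (-u)) = 0 ∧ 0 < volume.real (diamJoin P u) := by
  obtain ⟨p, hp⟩ := hP.interior_nonempty
  have h0 : (0 : 𝔼 n) ∈ interior (-p +ᵥ P) := by
    rw [interior_vadd]
    exact ⟨p, hp, by simp⟩
  obtain ⟨u, hu, h1, h2⟩ := (hP.vadd (-p)).exists_facet_zero_mem (hG.vadd (-p)) hn h0
  rw [facetNormals_vadd] at hu
  rw [suppSet_vadd, setDim_vadd] at h1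
  rw [diamJoin_vadd, volumeReal_vadd] at h2
  exact ⟨u, hu, h1, h2⟩

/-- Dominated convergence, as hyperplanes are null. It allows a cap of prescribed volume to be cut
off by the intermediate value theorem. -/
lemma continuous_volumeReal_cap (hP : IsCompact P) {u : 𝔼 n} (hu : u ≠ 0) :
    Continuous fun r : ℝ => volume.real (P ∩ {x | r ≤ inner ℝ u x}) := by
  have hm : ∀ r : ℝ, MeasurableSet {x : 𝔼 n | r ≤ inner ℝ u x} := fun r =>
    (isClosed_le continuous_const (by fun_prop)).measurableSet
  have heq : (fun r : ℝ => volume.real (P ∩ {x | r ≤ inner ℝ u x})) =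
      fun r => ∫ x in P, ({x | r ≤ inner ℝ u x} : Set (𝔼 n)).indicator (fun _ => (1 : ℝ)) x := by
    ext r
    rw [integral_indicator (hm r), setIntegral_const, smul_eq_mul, mul_one, Measure.real,
      Measure.real, Measure.restrict_apply (hm r), Set.inter_comm]
  rw [heq, continuous_iff_continuousAt]
  intro r₀
  refine continuousAt_of_dominated (bound := fun _ => 1) ?_ ?_ ?_ ?_
  · exact Filter.Eventually.of_forall fun r =>
      (measurable_const.indicator (hm r)).aestronglyMeasurable
  · refine Filter.Eventually.of_forall fun r => ae_of_all _ fun x => ?_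
    rw [Set.indicator_apply]
    split_ifs <;> simp
  · exact integrableOn_const hP.measure_lt_top.ne
  · have h := measure_eq_zero_iff_ae_notMem.1 (volume_hyperplane hu r₀)
    filter_upwards [ae_restrict_of_ae h] with x hx
    have hx : inner ℝ u x ≠ r₀ := hx
    rcases lt_or_gt_of_ne hx with h1 | h1
    · refine continuousAt_const.congr (f := fun _ => (0 : ℝ)) ?_
      filter_upwards [lt_mem_nhds h1] with r hr
      rw [Set.indicator_of_notMem]
      simpa using hr
    · refine continuousAt_const.congr (f := fun _ => (1 : ℝ)) ?_
      filter_upwards [gt_mem_nhds h1] with r hr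
      rw [Set.indicator_of_mem]
      exact hr.le

/-- A polytope is contained in a proper cone with apex at an exposed vertex. -/
lemma IsFullPolytope.exists_norm_sub_le (hP : IsFullPolytope P) {u y₀ : 𝔼 n}
    (h : suppSet P (-u) = {y₀}) :
    ∃ K : ℝ, 0 ≤ K ∧ ∀ x ∈ P, ‖x - y₀‖ ≤ K * inner ℝ u (x - y₀) := by
  obtain ⟨⟨V, hV, hne, rfl⟩, -⟩ := hP
  have hy₀ : y₀ ∈ suppSet (convexHull ℝ V) (-u) := h ▸ rfl
  have hge : ∀ x ∈ convexHull ℝ V, 0 ≤ inner ℝ u (x - y₀) := by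
    intro x hx
    have := hy₀.2 x hx
    simp only [inner_neg_left] at this
    rw [inner_sub_right]; linarith
  -- The largest ratio over the finitely many generators; the one at y₀ is 0/0 = 0 and harmless. The
  -- cone inequality is convex in x, so it passes to the hull.
  obtain ⟨K, hK⟩ := (hV.image fun v => ‖v - y₀‖ / inner ℝ u (v - y₀)).bddAbove
  have hVK : ∀ v ∈ V, ‖v - y₀‖ ≤ max K 0 * inner ℝ u (v - y₀) := by
    intro v hv
    have hvP := subset_convexHull ℝ V hv
    rcases eq_or_lt_of_le (hge v hvP) with h0 | h0
    · have : v ∈ suppSet (convexHull ℝ V) (-u) := by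
        refine ⟨hvP, fun x hx => (hy₀.2 x hx).trans (le_of_eq ?_)⟩
        rw [inner_sub_right] at h0
        simp only [inner_neg_left]; linarith
      rw [h] at this
      obtain rfl : v = y₀ := this
      simp
    · rw [← div_le_iff₀ h0]
      exact (hK ⟨v, hv, rfl⟩).trans (le_max_left _ _)
  refine ⟨max K 0, le_max_right _ _, fun x hx => ?_⟩
  have hconv : Convex ℝ {x : 𝔼 n | ‖x - y₀‖ ≤ max K 0 * inner ℝ u (x - y₀)} := by
    intro x hx y hy a b ha hb hab
    have e : a • x + b • y - y₀ = a • (x - y₀) + b • (y - y₀) := by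
      have : y₀ = (a + b) • y₀ := by rw [hab, one_smul]
      nth_rewrite 1 [this]
      module
    change ‖a • x + b • y - y₀‖ ≤ max K 0 * inner ℝ u (a • x + b • y - y₀)
    have hx : ‖x - y₀‖ ≤ max K 0 * inner ℝ u (x - y₀) := hx
    have hy : ‖y - y₀‖ ≤ max K 0 * inner ℝ u (y - y₀) := hy
    rw [e, inner_add_right, inner_smul_right, inner_smul_right]
    refine (norm_add_le _ _).trans ?_
    rw [norm_smul, norm_smul, Real.norm_of_nonneg ha, Real.norm_of_nonneg hb]
    nlinarith [mul_le_mul_of_nonneg_left hx ha, mul_le_mul_of_nonneg_left hy hb]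
  exact convexHull_min hVK hconv hx

lemma volumeReal_inter_add (hP : IsCompact P) {u : 𝔼 n} (hu : u ≠ 0) (r : ℝ) :
    volume.real (P ∩ {x | r ≤ inner ℝ u x}) + volume.real (P ∩ {x | inner ℝ u x ≤ r}) =
      volume.real P := by
  have hcl : IsClosed {x : 𝔼 n | r ≤ inner ℝ u x} := isClosed_le continuous_const (by fun_prop)
  have hcl2 : IsClosed {x : 𝔼 n | inner ℝ u x ≤ r} := isClosed_le (by fun_prop) continuous_const
  have hd : AEDisjoint volume (P ∩ {x | r ≤ inner ℝ u x}) (P ∩ {x | inner ℝ u x ≤ r}) :=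
    measure_mono_null (fun x hx => le_antisymm hx.2.2 hx.1.2) (volume_hyperplane hu r)
  rw [← measureReal_union₀ (hP.measurableSet.inter hcl2.measurableSet).nullMeasurableSet hd
    (hP.inter_right hcl).measure_lt_top.ne (hP.inter_right hcl2).measure_lt_top.ne,
    ← Set.inter_union_distrib_left]
  congr 1
  refine Set.inter_eq_left.2 fun x _ => ?_
  exact le_total r (inner ℝ u x)

/-- In dimension at least two, a polytope in general relative position to its reflection has a
difference body of strictly larger volume than a symmetric body of the same volume. -/
lemma IsFullPolytope.volumeReal_lt (hP : IsFullPolytope P) (hG : GeneralRelPos P) (hn : 2 ≤ n) :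
    volume.real P < volume.real ((1 - (1 / 2 : ℝ)) • P - (1 / 2 : ℝ) • P) := by
  obtain ⟨u, hu, hdim, hpos⟩ := hP.exists_facet hG (by omega)
  obtain ⟨C, hC, h⟩ := hP.exists_facet_const hG hu
  obtain ⟨x₀, hx₀⟩ := hP.suppSet_nonempty u
  obtain ⟨y₀, hy₀⟩ := hP.suppSet_nonempty (-u)
  have hu0 := ne_zero_of_norm_eq_one hu.1
  have hlt := hP.inner_lt hu0 hx₀ hy₀
  have hc := hP.isCompact
  set α := inner ℝ u x₀ with hα
  set β := inner ℝ u y₀ with hβ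
  set k := setDim (suppSet P u) with hk
  have hCpos : 0 < C := by
    refine lt_of_le_of_ne hC ?_
    rintro rfl
    rw [diamJoin, h 1 (-1) 0 1 0 1 x₀ hx₀ y₀ hy₀ (by rw [← hα, ← hβ]; linarith) zero_le_one] at hpos
    simp at hpos
  have hsing : suppSet P (-u) = {y₀} := by
    have h1 : vectorSpan ℝ (suppSet P (-u)) = ⊥ := Submodule.finrank_eq_zero.1 hdim
    exact ((vectorSpan_eq_bot_iff_subsingleton ℝ).1 h1).eq_singleton_of_mem hy₀
  obtain ⟨K, hK, hKP⟩ := hP.exists_norm_sub_le hsing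
  have hge : ∀ x ∈ P, β ≤ inner ℝ u x := by
    intro x hx
    have := hy₀.2 x hx
    simpa using this
  have hle : ∀ x ∈ P, inner ℝ u x ≤ α := fun x hx => hx₀.2 x hx
  set w := α - β with hw
  have hwpos : 0 < w := by linarith
  have hclge : ∀ r : ℝ, IsClosed {x : 𝔼 n | r ≤ inner ℝ u x} := fun r =>
    isClosed_le continuous_const (by fun_prop)
  have hclle : ∀ r : ℝ, IsClosed {x : 𝔼 n | inner ℝ u x ≤ r} := fun r =>
    isClosed_le (by fun_prop) continuous_const
  set κ := (K * w) ^ n * volume.real (Metric.ball (0 : 𝔼 n) 1) with hκ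
  set c := C * (w / 2) * (1 / 4) ^ k with hcdef
  have hcpos : 0 < c := by positivity
  -- The cap at the vertex y₀ lies in a ball of radius proportional to δ.
  have hlow : ∀ δ : ℝ, 0 < δ → volume.real (P ∩ {x | inner ℝ u x ≤ β + δ * w}) ≤ κ * δ ^ n := by
    intro δ hδ
    have hsub : P ∩ {x | inner ℝ u x ≤ β + δ * w} ⊆ Metric.closedBall y₀ (K * (δ * w)) := by
      rintro x ⟨hx, hx2⟩
      have hx2 : inner ℝ u x ≤ β + δ * w := hx2
      rw [mem_closedBall_iff_norm]
      refine (hKP x hx).trans (mul_le_mul_of_nonneg_left ?_ hK)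
      rw [inner_sub_right]; linarith
    refine (measureReal_mono hsub measure_closedBall_lt_top.ne).trans (le_of_eq ?_)
    rw [Measure.real, Measure.addHaar_closedBall _ _ (by positivity), finrank_euclideanSpace_fin,
      ENNReal.toReal_mul, ENNReal.toReal_ofReal (by positivity), hκ, Measure.real]
    ring_nf
  -- The point θx + (1-θ)y₀ with x in the facet lies in the lower cap if θ ≤ δ. Taking half its
  -- difference from the same x sweeps out dilates of the facet with factor (1-θ)/2 ≥ 1/4, a set of
  -- volume of order δ.
  have hup : ∀ δ : ℝ, 0 < δ → δ ≤ 1 / 2 → ∀ r ≤ α, ∀ A : Set (𝔼 n), IsCompact A →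
      (∀ x ∈ P ∩ {x | r ≤ inner ℝ u x}, ∀ y ∈ P ∩ {x | inner ℝ u x ≤ β + δ * w},
        (1 / 2 : ℝ) • x - (1 / 2 : ℝ) • y ∈ A) → c * δ ≤ volume.real A := by
    intro δ hδ hδ2 r hr A hA hsub
    have hvol := h (1 / 2) (-1 / 2) (-1 / 2) (1 / 2) 0 δ x₀ hx₀ y₀ hy₀
      (by rw [← hα, ← hβ]; linarith) hδ.le
    have hsw : sweep (suppSet P u) (suppSet P (-u)) (fun θ => 1 / 2 + -1 / 2 * θ)
        (fun θ => -1 / 2 + 1 / 2 * θ) 0 δ ⊆ A := by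
      rintro _ ⟨θ, hθ, x, hx, y, hy, rfl⟩
      have hxα : inner ℝ u x = α := inner_eq_of_mem_suppSet hx hx₀
      have hyβ : inner ℝ u y = β := by simpa using inner_eq_of_mem_suppSet hy hy₀
      have := hsub x ⟨hx.1, by change r ≤ inner ℝ u x; rw [hxα]; exact hr⟩ (θ • x + (1 - θ) • y)
        ⟨hP.convex hx.1 hy.1 hθ.1 (by linarith [hθ.2]) (by ring), ?_⟩
      · convert this using 1
        module
      · change inner ℝ u (θ • x + (1 - θ) • y) ≤ β + δ * w
        rw [inner_add_right, inner_smul_right, inner_smul_right, hxα, hyβ]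
        nlinarith [hθ.2]
    refine le_trans ?_ (measureReal_mono hsw hA.measure_lt_top.ne)
    rw [hvol, hdim, ← hα, ← hβ, show -1 / 2 * α + 1 / 2 * β = -(w / 2) by rw [hw]; ring, abs_neg,
      abs_of_pos (by positivity), hcdef, mul_assoc (C * (w / 2))]
    refine mul_le_mul_of_nonneg_left ?_ (by positivity)
    have h2 := intervalIntegral.integral_mono_on (μ := volume) hδ.le
      (f := fun _ => (1 / 4 : ℝ) ^ k) (g := fun θ => |1 / 2 + -1 / 2 * θ| ^ k *
        |-1 / 2 + 1 / 2 * θ| ^ 0) intervalIntegrable_const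
      (Continuous.intervalIntegrable (by fun_prop) _ _) (fun θ hθ => by
        rw [pow_zero, mul_one]
        refine pow_le_pow_left₀ (by norm_num) ?_ k
        rw [abs_of_nonneg (by linarith [hθ.2])]
        linarith [hθ.2])
    simpa [mul_comm] using h2
  -- The only use of n ≥ 2 in the comparison: δ^n is negligible against δ.
  obtain ⟨δ, hδ, hδ2, hδ3⟩ : ∃ δ : ℝ, 0 < δ ∧ δ ≤ 1 / 2 ∧ κ * δ ^ n < c * δ := by
    have hcont : Continuous fun δ : ℝ => κ * δ ^ (n - 1) := by fun_prop
    have h1 : ∀ᶠ δ in nhds (0 : ℝ), κ * δ ^ (n - 1) < c ∧ δ < 1 / 2 := by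
      refine (hcont.tendsto 0).eventually_lt_const ?_ |>.and (gt_mem_nhds (by norm_num))
      rw [zero_pow (by omega)]; simpa using hcpos
    obtain ⟨δ, hδ, h2, h3⟩ := exists_pos_of_eventually h1
    refine ⟨δ, hδ, h3.le, ?_⟩
    have : κ * δ ^ n = κ * δ ^ (n - 1) * δ := by
      rw [mul_assoc κ, ← pow_succ, Nat.sub_add_cancel (by omega)]
    rw [this]
    exact mul_lt_mul_of_pos_right h2 hδ
  set v := volume.real (P ∩ {x | inner ℝ u x ≤ β + δ * w}) with hv
  have hvle : v ≤ κ * δ ^ n := hlow δ hδ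
  -- The upper cap is cut at the height r where its volume equals that of the lower cap, so the two
  -- complementary parts also have equal volumes.
  obtain ⟨r, ⟨hr0, hr1⟩, hrv⟩ : ∃ r ∈ Set.Icc β α,
      volume.real (P ∩ {x | r ≤ inner ℝ u x}) = v := by
    have hivt := intermediate_value_Icc' hlt.le (continuous_volumeReal_cap hc hu0).continuousOn
    refine hivt ⟨?_, ?_⟩
    · have : volume.real (P ∩ {x | α ≤ inner ℝ u x}) = 0 := by
        have h1 : volume (P ∩ {x | α ≤ inner ℝ u x}) = 0 := measure_mono_null
          (fun x hx => le_antisymm (hle x hx.1) hx.2) (volume_hyperplane hu0 α)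
        rw [Measure.real, h1]; simp
      rw [this]
      exact measureReal_nonneg
    · have : P ∩ {x | β ≤ inner ℝ u x} = P := Set.inter_eq_left.2 fun x hx => hge x hx
      rw [this]
      exact measureReal_mono Set.inter_subset_left hc.measure_lt_top.ne
  have hP1 := volumeReal_inter_add hc hu0 r
  have hP2 := volumeReal_inter_add hc hu0 (β + δ * w)
  have c1 : IsCompact (P ∩ {x | r ≤ inner ℝ u x}) := hc.inter_right (hclge r)
  have c2 : IsCompact (P ∩ {x | inner ℝ u x ≤ r}) := hc.inter_right (hclle r)
  have c3 : IsCompact (P ∩ {x | inner ℝ u x ≤ β + δ * w}) := hc.inter_right (hclle _)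
  have c4 : IsCompact (P ∩ {x | β + δ * w ≤ inner ℝ u x}) := hc.inter_right (hclge _)
  set D := (1 - (1 / 2 : ℝ)) • P - (1 / 2 : ℝ) • P with hD
  have cD : IsCompact D := isCompact_smul_sub_smul hc _ _
  have memD : ∀ x ∈ P, ∀ y ∈ P, (1 / 2 : ℝ) • x - (1 / 2 : ℝ) • y ∈ D := by
    intro x hx y hy
    refine ⟨(1 - (1 / 2 : ℝ)) • x, Set.smul_mem_smul_set hx, _, Set.smul_mem_smul_set hy, ?_⟩
    norm_num
  set ρ := (1 / 2 : ℝ) * (r - (β + δ * w)) with hρ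
  have hA1 := hup δ hδ hδ2 r hr1 (D ∩ {x | ρ ≤ inner ℝ u x}) (cD.inter_right (hclge ρ)) (by
    rintro x ⟨hx, hx2⟩ y ⟨hy, hy2⟩
    refine ⟨memD x hx y hy, ?_⟩
    have hx2 : r ≤ inner ℝ u x := hx2
    have hy2 : inner ℝ u y ≤ β + δ * w := hy2
    change ρ ≤ inner ℝ u _
    rw [inner_sub_right, inner_smul_right, inner_smul_right]
    linarith)
  -- The hyperplane at height ρ splits D. Below it Brunn-Minkowski for the complementary parts gives
  -- at least V(P) - v; above it the caps give at least cδ, which exceeds v.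
  have hA2 : volume (P ∩ {x | inner ℝ u x ≤ r}) ≤ volume (D ∩ {x | inner ℝ u x ≤ ρ}) := by
    refine le_volume_of_volume_eq (t := 1 / 2) (by norm_num) (by norm_num) c2 c4.neg
      (cD.inter_right (hclle ρ)) ?_ ?_
    · rw [Measure.measure_neg, ← ENNReal.toReal_eq_toReal_iff' c2.measure_lt_top.ne
        c4.measure_lt_top.ne]
      change volume.real _ = volume.real _
      linarith
    · rintro x ⟨hx, hx2⟩ y ⟨hy, hy2⟩
      have hx2 : inner ℝ u x ≤ r := hx2
      have hy2 : β + δ * w ≤ inner ℝ u (-y) := hy2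
      have e : (1 - 1 / 2 : ℝ) • x + (1 / 2 : ℝ) • y = (1 / 2 : ℝ) • x - (1 / 2 : ℝ) • (-y) := by
        module
      rw [e]
      refine ⟨memD x hx _ hy, ?_⟩
      change inner ℝ u _ ≤ ρ
      rw [inner_sub_right, inner_smul_right, inner_smul_right]
      linarith
  have hA2' : volume.real (P ∩ {x | inner ℝ u x ≤ r}) ≤ volume.real (D ∩ {x | inner ℝ u x ≤ ρ}) :=
    ENNReal.toReal_mono (cD.inter_right (hclle ρ)).measure_lt_top.ne hA2
  have hDs := volumeReal_inter_add cD hu0 ρ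
  linarith

lemma IsFullPolytope.lt_meanDiam (hP : IsFullPolytope P) (hG : GeneralRelPos P) (hn : 2 ≤ n) :
    (n : ℝ) < (meanDiam P).toReal :=
  hP.lt_meanDiam_of_lt hG (hP.volumeReal_lt hG hn)

end

/-! ### The Rogers-Shephard inequality for the mixed body. -/

section

variable {K : Set (𝔼 n)}

/-- The body in `ℝⁿ × ℝ` whose section at height `t ∈ [0, 1]` is `(1 - t) K - t K`. -/
def mixBody (K : Set (𝔼 n)) : Set ((𝔼 n) × ℝ) :=
  {q | q.2 ∈ Set.Icc (0 : ℝ) 1 ∧ ∃ x ∈ K, ∃ y ∈ K, q.1 = (1 - q.2) • x - q.2 • y}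

/-- The set of all `((w, t), x)` with `x ∈ (1 - t) K ∩ (w + t K)`, `0 ≤ t ≤ 1`. -/
def sectionBody (K : Set (𝔼 n)) : Set (((𝔼 n) × ℝ) × (𝔼 n)) :=
  {p | p.1.2 ∈ Set.Icc (0 : ℝ) 1 ∧ p.2 ∈ (1 - p.1.2) • K ∧ p.2 - p.1.1 ∈ p.1.2 • K}

/-- The homothet of `mixBody K` with ratio `r` and centre `(0, 1/2)`. -/
def mixHomothet (K : Set (𝔼 n)) (r : ℝ) : Set ((𝔼 n) × ℝ) :=
  (fun l => (1 - r) • ((0 : 𝔼 n), (1 / 2 : ℝ)) + r • l) '' mixBody K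

lemma isCompact_mixBody (hK : IsCompact K) : IsCompact (mixBody K) := by
  have : mixBody K = (fun p : ℝ × (𝔼 n) × (𝔼 n) => ((1 - p.1) • p.2.1 - p.1 • p.2.2, p.1)) ''
      (Set.Icc (0 : ℝ) 1 ×ˢ K ×ˢ K) := by
    ext ⟨w, t⟩
    constructor
    · rintro ⟨ht, x, hx, y, hy, h⟩
      exact ⟨(t, x, y), ⟨ht, hx, hy⟩, by simp only at h; rw [h]⟩
    · rintro ⟨⟨t', x, y⟩, ⟨ht, hx, hy⟩, h⟩
      simp only [Prod.mk.injEq] at h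
      obtain ⟨rfl, rfl⟩ := h
      exact ⟨ht, x, hx, y, hy, rfl⟩
  rw [this]
  exact (isCompact_Icc.prod (hK.prod hK)).image (by fun_prop)

lemma isCompact_sectionBody (hK : IsCompact K) : IsCompact (sectionBody K) := by
  have : sectionBody K = (fun p : ℝ × (𝔼 n) × (𝔼 n) =>
      (((1 - p.1) • p.2.1 - p.1 • p.2.2, p.1), (1 - p.1) • p.2.1)) ''
      (Set.Icc (0 : ℝ) 1 ×ˢ K ×ˢ K) := by
    ext ⟨⟨w, t⟩, z⟩
    constructor
    · rintro ⟨ht, ⟨x, hx, h⟩, ⟨y, hy, h'⟩⟩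
      simp only at h h'
      refine ⟨(t, x, y), ⟨ht, hx, hy⟩, ?_⟩
      simp only [h, h', Prod.mk.injEq, and_true]
      abel
    · rintro ⟨⟨t', x, y⟩, ⟨ht, hx, hy⟩, h⟩
      simp only [Prod.mk.injEq] at h
      obtain ⟨⟨rfl, rfl⟩, rfl⟩ := h
      exact ⟨ht, ⟨x, hx, rfl⟩, ⟨y, hy, by simp⟩⟩
  rw [this]
  exact (isCompact_Icc.prod (hK.prod hK)).image (by fun_prop)

/-- The pairs of a ratio `r ∈ [a, b]` and a point of the homothet with ratio `r`. -/
def mixGraph (K : Set (𝔼 n)) (a b : ℝ) : Set (((𝔼 n) × ℝ) × ℝ) :=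
  {p | p.2 ∈ Set.Icc a b ∧ p.1 ∈ mixHomothet K p.2}

lemma mem_mixGraph {a b r : ℝ} {q : (𝔼 n) × ℝ} :
    (q, r) ∈ mixGraph K a b ↔ r ∈ Set.Icc a b ∧ q ∈ mixHomothet K r := Iff.rfl

lemma isCompact_mixGraph (hK : IsCompact K) (a b : ℝ) :
    IsCompact (mixGraph K a b) := by
  have : mixGraph K a b =
      (fun p : ((𝔼 n) × ℝ) × ℝ => ((1 - p.2) • ((0 : 𝔼 n), (1 / 2 : ℝ)) + p.2 • p.1, p.2)) ''
      (mixBody K ×ˢ Set.Icc a b) := by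
    ext ⟨q, r⟩
    constructor
    · rintro ⟨hr, l, hl, h⟩
      exact ⟨(l, r), ⟨hl, hr⟩, by simp only at h ⊢; rw [h]⟩
    · rintro ⟨⟨l, r'⟩, ⟨hl, hr⟩, h⟩
      simp only [Prod.mk.injEq] at h
      obtain ⟨rfl, rfl⟩ := h
      exact ⟨hr, l, hl, rfl⟩
  rw [this]
  exact ((isCompact_mixBody hK).prod isCompact_Icc).image (by fun_prop)

lemma volume_mixHomothet (K : Set (𝔼 n)) {r : ℝ} (hr : 0 ≤ r) :
    volume (mixHomothet K r) = ENNReal.ofReal (r ^ (n + 1)) * volume (mixBody K) := by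
  have : mixHomothet K r = (fun l => (1 - r) • ((0 : 𝔼 n), (1 / 2 : ℝ)) + l) ''
      (r • mixBody K) := by
    rw [mixHomothet, ← Set.image_smul, Set.image_image]
  have h1 : (volume : Measure ((𝔼 n) × ℝ)).IsAddHaarMeasure :=
    Measure.prod.instIsAddHaarMeasure volume volume
  rw [this, Set.image_add_left, measure_preimage_add, Measure.addHaar_smul,
    abs_of_nonneg (by positivity)]
  simp

lemma volume_mixBody (hK : IsCompact K) :
    volume (mixBody K) = ENNReal.ofReal
      (∫ t in (0 : ℝ)..1, volume.real ((1 - t) • K - t • K)) := by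
  have hsec : ∀ t ∈ Set.Icc (0 : ℝ) 1,
      volume {w | (w, t) ∈ mixBody K} = volume ((1 - t) • K - t • K) := by
    intro t ht
    congr 1
    ext w
    constructor
    · rintro ⟨-, x, hx, y, hy, h⟩
      exact ⟨_, Set.smul_mem_smul_set hx, _, Set.smul_mem_smul_set hy, h.symm⟩
    · rintro ⟨_, ⟨x, hx, rfl⟩, _, ⟨y, hy, rfl⟩, rfl⟩
      exact ⟨ht, x, hx, y, hy, rfl⟩
  have hm := (isCompact_mixBody hK).measurableSet
  have hmeas : Measurable fun t : ℝ => volume {w : 𝔼 n | (w, t) ∈ mixBody K} :=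
    measurable_measure_prodMk_right hm
  have hle : ∀ t ∈ Set.Icc (0 : ℝ) 1, volume ((1 - t) • K - t • K) ≤
      volume (Prod.fst '' mixBody K) := by
    intro t ht
    rw [← hsec t ht]
    exact measure_mono fun w hw => ⟨_, hw, rfl⟩
  have hfin : volume (Prod.fst '' mixBody K) ≠ ∞ :=
    ((isCompact_mixBody hK).image continuous_fst).measure_lt_top.ne
  rw [Measure.volume_eq_prod, Measure.prod_apply_symm hm,
    intervalIntegral.integral_of_le zero_le_one, ← integral_Icc_eq_integral_Ioc,
    ofReal_integral_eq_lintegral_ofReal, ← lintegral_indicator measurableSet_Icc]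
  · refine lintegral_congr fun t => ?_
    by_cases ht : t ∈ Set.Icc (0 : ℝ) 1
    · rw [Set.indicator_of_mem ht]
      refine (hsec t ht).trans ?_
      rw [Measure.real, ENNReal.ofReal_toReal]
      exact ne_top_of_le_ne_top hfin (hle t ht)
    · rw [Set.indicator_of_notMem ht]
      have : (fun x : 𝔼 n => (x, t)) ⁻¹' mixBody K = ∅ := by
        ext w; simp only [Set.mem_preimage, Set.mem_empty_iff_false, iff_false]
        exact fun h => ht h.1
      rw [this, measure_empty]
  · refine Integrable.of_bound ?_ (volume (Prod.fst '' mixBody K)).toReal ?_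
    · have h1 : AEStronglyMeasurable (fun t : ℝ => (volume {w : 𝔼 n | (w, t) ∈ mixBody K}).toReal)
          (volume.restrict (Set.Icc 0 1)) := hmeas.ennreal_toReal.aestronglyMeasurable
      refine h1.congr ?_
      filter_upwards [ae_restrict_mem measurableSet_Icc] with t ht
      rw [hsec t ht]; rfl
    · filter_upwards [ae_restrict_mem measurableSet_Icc] with t ht
      rw [Real.norm_of_nonneg measureReal_nonneg]
      exact ENNReal.toReal_mono hfin (hle t ht)
  · exact ae_of_all _ fun t => measureReal_nonneg

/-- Fubini: for fixed x in A, the admissible w form a reflected translate of B. -/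
lemma lintegral_volume_inter_translate {A B : Set (𝔼 n)} (hA : IsCompact A) (hB : IsCompact B) :
    ∫⁻ w, volume {x : 𝔼 n | x ∈ A ∧ x - w ∈ B} = volume A * volume B := by
  have hm : MeasurableSet {p : (𝔼 n) × (𝔼 n) | p.2 ∈ A ∧ p.2 - p.1 ∈ B} :=
    ((hA.isClosed.preimage continuous_snd).inter
      (hB.isClosed.preimage (by fun_prop : Continuous fun p : (𝔼 n) × (𝔼 n) => p.2 - p.1))).measurableSet
  have h1 := Measure.prod_apply (μ := (volume : Measure (𝔼 n))) (ν := (volume : Measure (𝔼 n))) hm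
  rw [Measure.prod_apply_symm hm] at h1
  refine h1.symm.trans ?_
  rw [← lintegral_indicator_one hA.measurableSet, ← lintegral_mul_const _
    (measurable_one.indicator hA.measurableSet)]
  refine lintegral_congr fun x => ?_
  by_cases hx : x ∈ A
  · rw [Set.indicator_of_mem hx, Pi.one_apply, one_mul]
    have : (fun w => (w, x)) ⁻¹' {p : (𝔼 n) × (𝔼 n) | p.2 ∈ A ∧ p.2 - p.1 ∈ B} =
        (fun w => x - w) ⁻¹' B := by
      ext w
      exact ⟨fun h => h.2, fun h => ⟨hx, h⟩⟩
    rw [this, (Measure.measurePreserving_sub_left volume x).measure_preimage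
      hB.measurableSet.nullMeasurableSet]
  · rw [Set.indicator_of_notMem hx, zero_mul]
    have : (fun w => (w, x)) ⁻¹' {p : (𝔼 n) × (𝔼 n) | p.2 ∈ A ∧ p.2 - p.1 ∈ B} = ∅ := by
      ext w
      exact ⟨fun h => absurd h.1 hx, fun h => h.elim⟩
    rw [this, measure_empty]

lemma lintegral_volume_section (hK : IsCompact K) :
    ∫⁻ q, volume {x | (q, x) ∈ sectionBody K} =
      ENNReal.ofReal (∫ t in (0 : ℝ)..1, (1 - t) ^ n * t ^ n) * (volume K * volume K) := by
  have hmeas : Measurable fun q : (𝔼 n) × ℝ => volume {x : 𝔼 n | (q, x) ∈ sectionBody K} :=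
    measurable_measure_prodMk_left (isCompact_sectionBody hK).measurableSet
  rw [Measure.volume_eq_prod, lintegral_prod_symm' _ hmeas,
    intervalIntegral.integral_of_le zero_le_one, ← integral_Icc_eq_integral_Ioc,
    ofReal_integral_eq_lintegral_ofReal, ← lintegral_mul_const', ← lintegral_indicator
    measurableSet_Icc]
  · refine lintegral_congr fun t => ?_
    by_cases ht : t ∈ Set.Icc (0 : ℝ) 1
    · rw [Set.indicator_of_mem ht]
      have h1 : ∀ w : 𝔼 n, {x : 𝔼 n | ((w, t), x) ∈ sectionBody K} =
          {x | x ∈ (1 - t) • K ∧ x - w ∈ t • K} := by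
        intro w; ext x
        exact ⟨fun h => h.2, fun h => ⟨ht, h⟩⟩
      simp only [h1]
      rw [lintegral_volume_inter_translate (hK.smul _) (hK.smul _), Measure.addHaar_smul,
        Measure.addHaar_smul, finrank_euclideanSpace_fin, mul_mul_mul_comm,
        abs_of_nonneg (pow_nonneg (by linarith [ht.2]) _), abs_of_nonneg (pow_nonneg ht.1 _),
        ENNReal.ofReal_mul (pow_nonneg (by linarith [ht.2]) _)]
    · rw [Set.indicator_of_notMem ht]
      have h1 : ∀ w : 𝔼 n, {x : 𝔼 n | ((w, t), x) ∈ sectionBody K} = ∅ := by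
        intro w; ext x
        exact ⟨fun h => ht h.1, fun h => h.elim⟩
      simp [h1]
  · exact ENNReal.mul_ne_top hK.measure_lt_top.ne hK.measure_lt_top.ne
  · exact (by fun_prop : Continuous fun t : ℝ => (1 - t) ^ n * t ^ n).continuousOn.integrableOn_Icc
  · filter_upwards [ae_restrict_mem measurableSet_Icc] with t ht
    exact mul_nonneg (pow_nonneg (by linarith [ht.2]) _) (pow_nonneg ht.1 _)

/-- The weight `(1 - ρ)ⁿ`, where `ρ` is the smallest ratio of a homothet containing `q`. -/
def weight (K : Set (𝔼 n)) (q : (𝔼 n) × ℝ) : ℝ≥0∞ :=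
  ∫⁻ r in Set.Icc (0 : ℝ) 1,
    {r | q ∈ mixHomothet K r}.indicator (fun r => ENNReal.ofReal (n * (1 - r) ^ (n - 1))) r

lemma lintegral_weight_density (hn : n ≠ 0) {a : ℝ} (ha : a ≤ 1) :
    ∫⁻ r in Set.Icc a 1, ENNReal.ofReal (n * (1 - r) ^ (n - 1)) =
      ENNReal.ofReal ((1 - a) ^ n) := by
  rw [← ofReal_integral_eq_lintegral_ofReal]
  · congr 1
    rw [integral_Icc_eq_integral_Ioc, ← intervalIntegral.integral_of_le ha]
    have hd : ∀ t ∈ Set.uIcc a 1, HasDerivAt (fun t : ℝ => -(1 - t) ^ n)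
        (n * (1 - t) ^ (n - 1)) t := by
      intro t _
      exact (((hasDerivAt_id t).const_sub 1).pow n).neg.congr_deriv (by simp)
    rw [intervalIntegral.integral_eq_sub_of_hasDerivAt hd
      (Continuous.intervalIntegrable (by fun_prop) _ _)]
    simp [hn]
  · exact (by fun_prop : Continuous fun r : ℝ => n * (1 - r) ^ (n - 1)).continuousOn.integrableOn_Icc
  · filter_upwards [ae_restrict_mem measurableSet_Icc] with t ht
    exact mul_nonneg (Nat.cast_nonneg n) (pow_nonneg (by linarith [ht.2]) _)

/-- The density integrates to (1-a)^n over [a,1], and only ratios at least a contribute. This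
one-sided bound suffices, so nestedness of the homothets is never needed. -/
lemma weight_le (hn : n ≠ 0) {q : (𝔼 n) × ℝ} {a : ℝ} (ha : a ≤ 1)
    (h : ∀ r ∈ Set.Icc (0 : ℝ) 1, q ∈ mixHomothet K r → a ≤ r) :
    weight K q ≤ ENNReal.ofReal ((1 - a) ^ n) := by
  rw [← lintegral_weight_density hn ha, weight, ← lintegral_indicator measurableSet_Icc,
    ← lintegral_indicator measurableSet_Icc]
  refine lintegral_mono fun r => ?_
  by_cases hr : r ∈ Set.Icc (0 : ℝ) 1
  · by_cases hq : q ∈ mixHomothet K r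
    · rw [Set.indicator_of_mem hr, Set.indicator_of_mem (s := {r | q ∈ mixHomothet K r}) hq,
        Set.indicator_of_mem (Set.mem_Icc.2 ⟨h r hr hq, hr.2⟩)]
    · rw [Set.indicator_of_mem hr, Set.indicator_of_notMem (s := {r | q ∈ mixHomothet K r}) hq]
      exact zero_le
  · rw [Set.indicator_of_notMem hr]; exact zero_le

lemma measurable_weight_integrand (hK : IsCompact K) :
    Measurable fun p : ((𝔼 n) × ℝ) × ℝ => (mixGraph K 0 1).indicator
        (fun p => ENNReal.ofReal (n * (1 - p.2) ^ (n - 1))) p :=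
  Measurable.indicator (by fun_prop) (isCompact_mixGraph hK 0 1).measurableSet

lemma weight_eq (K : Set (𝔼 n)) (q : (𝔼 n) × ℝ) :
    weight K q = ∫⁻ r, (mixGraph K 0 1).indicator
        (fun p => ENNReal.ofReal (n * (1 - p.2) ^ (n - 1))) (q, r) := by
  rw [weight, ← lintegral_indicator measurableSet_Icc]
  refine lintegral_congr fun r => ?_
  by_cases hr : r ∈ Set.Icc (0 : ℝ) 1
  · rw [Set.indicator_of_mem hr]
    by_cases hq : q ∈ mixHomothet K r
    · rw [Set.indicator_of_mem (s := {r | q ∈ mixHomothet K r}) hq,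
        Set.indicator_of_mem (mem_mixGraph.2 ⟨hr, hq⟩)]
    · rw [Set.indicator_of_notMem (s := {r | q ∈ mixHomothet K r}) hq,
        Set.indicator_of_notMem fun h => hq (mem_mixGraph.1 h).2]
  · rw [Set.indicator_of_notMem hr, Set.indicator_of_notMem fun h => hr (mem_mixGraph.1 h).1]

lemma measurable_weight (hK : IsCompact K) : Measurable (weight K) := by
  have : weight K = fun q => _ := funext (weight_eq K)
  rw [this]
  exact (measurable_weight_integrand hK).lintegral_prod_right'

/-- After exchanging integrals, the homothet of ratio r contributes r^(n+1) times the volume of the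
body in dimension n + 1; one Beta identity turns n(1-r)^(n-1) r^(n+1) into (n+1)(1-r)^n r^n. This
makes the Beta integral cancel against the one for the sections. -/
lemma lintegral_weight (hn : n ≠ 0) (hK : IsCompact K) :
    ∫⁻ q, weight K q = ENNReal.ofReal ((n + 1) * ∫ t in (0 : ℝ)..1, (1 - t) ^ n * t ^ n) *
      volume (mixBody K) := by
  obtain ⟨k, rfl⟩ : ∃ k, n = k + 1 := ⟨n - 1, by omega⟩
  simp only [weight_eq]
  rw [lintegral_lintegral_swap (measurable_weight_integrand hK).aemeasurable]
  have hbeta := integral_beta_symm k (k + 1)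
  have h1 : ((k + 1 : ℕ) + 1 : ℝ) * ∫ t in (0 : ℝ)..1, (1 - t) ^ (k + 1) * t ^ (k + 1) =
      ∫ t in (0 : ℝ)..1, ((k + 1 : ℕ) * (1 - t) ^ (k + 1 - 1)) * t ^ (k + 1 + 1) := by
    rw [← hbeta, ← intervalIntegral.integral_const_mul]
    refine intervalIntegral.integral_congr fun t _ => ?_
    push_cast
    ring
  rw [h1, intervalIntegral.integral_of_le zero_le_one, ← integral_Icc_eq_integral_Ioc,
    ofReal_integral_eq_lintegral_ofReal, ← lintegral_mul_const', ← lintegral_indicator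
    measurableSet_Icc]
  · refine lintegral_congr fun r => ?_
    by_cases hr : r ∈ Set.Icc (0 : ℝ) 1
    · rw [Set.indicator_of_mem hr, ENNReal.ofReal_mul
        (mul_nonneg (Nat.cast_nonneg _) (pow_nonneg (by linarith [hr.2]) _)), mul_assoc,
        ← volume_mixHomothet K hr.1]
      have hm : MeasurableSet (mixHomothet K r) :=
        ((isCompact_mixBody hK).image (by fun_prop)).measurableSet
      rw [← setLIntegral_const, ← lintegral_indicator hm]
      refine lintegral_congr fun q => ?_
      by_cases hq : q ∈ mixHomothet K r
      · rw [Set.indicator_of_mem hq, Set.indicator_of_mem (mem_mixGraph.2 ⟨hr, hq⟩)]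
      · rw [Set.indicator_of_notMem hq, Set.indicator_of_notMem fun h => hq (mem_mixGraph.1 h).2]
    · rw [Set.indicator_of_notMem hr]
      have : ∀ q : (𝔼 (k + 1)) × ℝ, (q, r) ∉ mixGraph K 0 1 := fun q h => hr h.1
      simp only [Set.indicator_of_notMem (this _), lintegral_zero]
  · exact (isCompact_mixBody hK).measure_lt_top.ne
  · exact (by fun_prop : Continuous fun r : ℝ => ((k + 1 : ℕ) * (1 - r) ^ (k + 1 - 1)) *
      r ^ (k + 1 + 1)).continuousOn.integrableOn_Icc
  · filter_upwards [ae_restrict_mem measurableSet_Icc] with t ht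
    exact mul_nonneg (mul_nonneg (Nat.cast_nonneg _) (pow_nonneg (by linarith [ht.2]) _))
      (pow_nonneg ht.1 _)

/-- The section at a point of the homothet with ratio `r` contains a translate of
`((1 - r) / 2) K`. -/
lemma le_volume_section (hconv : Convex ℝ K) {r : ℝ} (hr : r ∈ Set.Icc (0 : ℝ) 1)
    {q : (𝔼 n) × ℝ} (hq : q ∈ mixHomothet K r) :
    ENNReal.ofReal (((1 - r) / 2) ^ n) * volume K ≤ volume {x | (q, x) ∈ sectionBody K} := by
  obtain ⟨⟨w, t⟩, ⟨ht, x, hx, y, hy, hw⟩, rfl⟩ := hq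
  simp only at ht hw
  subst hw
  have hr1 : 0 ≤ 1 - r := by linarith [hr.2]
  have ht1 : 0 ≤ 1 - t := by linarith [ht.2]
  have hvol : ENNReal.ofReal (((1 - r) / 2) ^ n) * volume K =
      volume ((fun z => (r * (1 - t)) • x + z) '' (((1 - r) / 2) • K)) := by
    rw [Set.image_add_left, measure_preimage_add, Measure.addHaar_smul, finrank_euclideanSpace_fin,
      abs_of_nonneg (by positivity)]
  rw [hvol]
  refine measure_mono ?_
  rintro _ ⟨_, ⟨k, hk, rfl⟩, rfl⟩
  -- The height of q is rt + (1-r)/2 and its complement to 1 is r(1-t) + (1-r)/2, so each of the two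
  -- dilates of K has room for an extra summand ((1-r)/2)K.
  have hcomb : ∀ a b : ℝ, 0 ≤ a → 0 ≤ b → ∀ z ∈ K, ∀ z' ∈ K, a • z + b • z' ∈ (a + b) • K := by
    intro a b ha hb z hz z' hz'
    rw [hconv.add_smul ha hb]
    exact Set.add_mem_add (Set.smul_mem_smul_set hz) (Set.smul_mem_smul_set hz')
  refine ⟨?_, ?_, ?_⟩
  · have h1 := mul_nonneg hr.1 ht.1
    have h2 := mul_nonneg hr.1 ht1
    refine ⟨?_, ?_⟩
    · simp; nlinarith
    · simp; nlinarith
  · have := hcomb (r * (1 - t)) ((1 - r) / 2) (mul_nonneg hr.1 ht1) (by positivity) x hx k hk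
    convert this using 1
    · congr 1; simp; ring
  · have := hcomb (r * t) ((1 - r) / 2) (mul_nonneg hr.1 ht.1) (by positivity) y hy k hk
    convert this using 1
    · congr 1; simp; ring
    · simp; module

/-- By compactness there is a least ratio r of a homothet containing q. It bounds the weight from
above by (1-r)^n and the section from below by ((1-r)/2)^n V(K). If no homothet contains q, the
weight is 0. -/
lemma weight_mul_le (hn : n ≠ 0) (hK : IsCompact K) (hconv : Convex ℝ K) (q : (𝔼 n) × ℝ) :
    (ENNReal.ofReal ((1 / 2) ^ n) * volume K) * weight K q ≤
      volume {x | (q, x) ∈ sectionBody K} := by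
  set S := {r : ℝ | r ∈ Set.Icc (0 : ℝ) 1 ∧ q ∈ mixHomothet K r} with hS
  have cS : IsCompact S := by
    have h1 : S = Prod.snd '' (mixGraph K 0 1 ∩ {p | p.1 = q}) := by
      ext r
      constructor
      · rintro ⟨hr, hq⟩; exact ⟨(q, r), ⟨⟨hr, hq⟩, rfl⟩, rfl⟩
      · rintro ⟨⟨_, _⟩, ⟨⟨hr, hq⟩, rfl⟩, rfl⟩; exact ⟨hr, hq⟩
    rw [h1]
    exact ((isCompact_mixGraph hK 0 1).inter_right
      (isClosed_eq continuous_fst continuous_const)).image continuous_snd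
  rcases S.eq_empty_or_nonempty with hem | hne
  · have h0 : weight K q ≤ ENNReal.ofReal ((1 - 1) ^ n) := weight_le hn le_rfl fun r hr hq => by
      have : r ∈ S := ⟨hr, hq⟩
      rw [hem] at this
      exact this.elim
    have h1 : weight K q = 0 := by simpa [hn] using h0
    rw [h1, mul_zero]
    exact zero_le
  · obtain ⟨r, ⟨hr, hq⟩, hmin⟩ := cS.exists_isLeast hne
    have h0 : weight K q ≤ ENNReal.ofReal ((1 - r) ^ n) :=
      weight_le hn hr.2 fun r' hr' hq' => hmin ⟨hr', hq'⟩
    refine le_trans (mul_le_mul_right h0 _) (le_trans (le_of_eq ?_) (le_volume_section hconv hr hq))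
    have hr1 : 0 ≤ 1 - r := by linarith [hr.2]
    rw [mul_right_comm, ← ENNReal.ofReal_mul (by positivity), ← mul_pow]
    congr 3
    ring

lemma integral_beta_pos (n : ℕ) : 0 < ∫ t in (0 : ℝ)..1, (1 - t) ^ n * t ^ n := by
  refine intervalIntegral.intervalIntegral_pos_of_pos_on
    (Continuous.intervalIntegrable (by fun_prop) _ _) (fun t ht => ?_) zero_lt_one
  have : 0 < 1 - t := by linarith [ht.2]
  have := ht.1
  positivity

/-- The Rogers-Shephard inequality for `∫₀¹ V((1 - t) K - t K) dt`, together with what equality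
says about the volumes of the sections. -/
lemma rogers_shephard (hn : n ≠ 0) (hK : IsCompact K) (hconv : Convex ℝ K)
    (hpos : 0 < volume K) :
    ((n : ℝ) + 1) * (∫ t in (0 : ℝ)..1, volume.real ((1 - t) • K - t • K)) ≤
        2 ^ n * volume.real K ∧
      (((n : ℝ) + 1) * (∫ t in (0 : ℝ)..1, volume.real ((1 - t) • K - t • K)) =
        2 ^ n * volume.real K → ∀ᵐ q : (𝔼 n) × ℝ, volume {x | (q, x) ∈ sectionBody K} =
          (ENNReal.ofReal ((1 / 2) ^ n) * volume K) * weight K q) := by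
  set I := ∫ t in (0 : ℝ)..1, volume.real ((1 - t) • K - t • K) with hI
  set B := ∫ t in (0 : ℝ)..1, (1 - t) ^ n * t ^ n with hB
  have hBpos : 0 < B := integral_beta_pos n
  have hInn : 0 ≤ I := intervalIntegral.integral_nonneg zero_le_one fun t _ => measureReal_nonneg
  have hVfin : volume K ≠ ∞ := hK.measure_lt_top.ne
  have hVpos : 0 < volume.real K := ENNReal.toReal_pos hpos.ne' hVfin
  have hVof : volume K = ENNReal.ofReal (volume.real K) := (ENNReal.ofReal_toReal hVfin).symm
  have hL : ∫⁻ q, (ENNReal.ofReal ((1 / 2) ^ n) * volume K) * weight K q =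
      ENNReal.ofReal ((1 / 2) ^ n * volume.real K * ((n + 1) * B * I)) := by
    rw [lintegral_const_mul _ (measurable_weight hK), lintegral_weight hn hK, volume_mixBody hK,
      hVof, ← ENNReal.ofReal_mul (by positivity), ← ENNReal.ofReal_mul (by positivity),
      ← ENNReal.ofReal_mul (by positivity)]
  have hR : ∫⁻ q, volume {x | (q, x) ∈ sectionBody K} =
      ENNReal.ofReal (B * (volume.real K * volume.real K)) := by
    rw [lintegral_volume_section hK, hVof, ← ENNReal.ofReal_mul (by positivity),
      ← ENNReal.ofReal_mul (by positivity)]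
  have hle := lintegral_mono (μ := volume) (weight_mul_le hn hK hconv)
  have h2n : (1 / 2 : ℝ) ^ n * 2 ^ n = 1 := by rw [← mul_pow]; norm_num
  have h2pos : (0 : ℝ) < 2 ^ n := by positivity
  refine ⟨?_, fun heq => ?_⟩
  · rw [hL, hR, ENNReal.ofReal_le_ofReal_iff (by positivity)] at hle
    have h1 : (1 / 2 : ℝ) ^ n * ((n + 1) * I) ≤ volume.real K := by
      have h3 : 0 < B * volume.real K := by positivity
      refine le_of_mul_le_mul_left ?_ h3
      linarith
    calc ((n : ℝ) + 1) * I = 2 ^ n * ((1 / 2 : ℝ) ^ n * ((n + 1) * I)) := by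
          rw [← mul_assoc, mul_comm (2 ^ n : ℝ), h2n, one_mul]
      _ ≤ _ := mul_le_mul_of_nonneg_left h1 h2pos.le
  · have heq2 : ∫⁻ q, volume {x | (q, x) ∈ sectionBody K} =
        ∫⁻ q, (ENNReal.ofReal ((1 / 2) ^ n) * volume K) * weight K q := by
      rw [hL, hR]
      congr 1
      calc B * (volume.real K * volume.real K)
          = ((1 / 2 : ℝ) ^ n * 2 ^ n) * (B * (volume.real K * volume.real K)) := by
            rw [h2n, one_mul]
        _ = (1 / 2 : ℝ) ^ n * volume.real K * B * (2 ^ n * volume.real K) := by ring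
        _ = _ := by rw [← heq]; ring
    have := ae_eq_of_ae_le_of_lintegral_le (ae_of_all volume (weight_mul_le hn hK hconv))
      (by rw [hL]; exact ENNReal.ofReal_ne_top)
      (measurable_measure_prodMk_left (isCompact_sectionBody hK).measurableSet).aemeasurable heq2.le
    filter_upwards [this] with q hq using hq.symm

end

/-! ### The equality case: intersections of translates are homothets. -/

section

variable {K : Set (𝔼 n)}

/-- The centre of homothety has height 1/2, so for r > 0 a point at that height comes from t = 1/2,
and membership reads v = r(x - y). For r = 0 it would give v = 0. -/
lemma le_of_mem_mixHomothet_center {v : 𝔼 n} {r₀ : ℝ} (h0 : 0 < r₀)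
    (hmin : ∀ r ∈ Set.Ico (0 : ℝ) r₀, ∀ x ∈ K, ∀ y ∈ K, r • (x - y) ≠ v) {r : ℝ} (hr : 0 ≤ r)
    (hq : ((1 / 2 : ℝ) • v, (1 / 2 : ℝ)) ∈ mixHomothet K r) : r₀ ≤ r := by
  obtain ⟨⟨w, t⟩, ⟨ht, x, hx, y, hy, hw⟩, h⟩ := hq
  simp only [Prod.smul_mk, Prod.mk_add_mk, smul_zero, zero_add, smul_eq_mul, Prod.mk.injEq] at h hw
  obtain ⟨h1, h2⟩ := h
  by_contra hlt
  push Not at hlt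
  rcases hr.eq_or_lt with rfl | hpos
  · refine hmin 0 ⟨le_rfl, h0⟩ x hx y hy ?_
    rw [zero_smul] at h1 ⊢
    have := (smul_eq_zero.1 h1.symm).resolve_left (by norm_num)
    exact this.symm
  · have ht2 : t = 1 / 2 := by
      have : r * (t - 1 / 2) = 0 := by linarith
      have := (mul_eq_zero.1 this).resolve_left hpos.ne'
      linarith
    subst ht2
    refine hmin r ⟨hr, hlt⟩ x hx y hy ?_
    have h3 : v = (2 : ℝ) • ((1 / 2 : ℝ) • v) := by module
    rw [h3, ← h1, hw]
    module

/-- If the section volumes are as small as possible, then the intersections of `K` with its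
translates are homothets of `K`. -/
lemma mem_homothet_of_ae_eq (hn : n ≠ 0) (hK : IsCompact K) (hconv : Convex ℝ K)
    (hint : (interior K).Nonempty)
    (hae : ∀ᵐ q : (𝔼 n) × ℝ, volume {x | (q, x) ∈ sectionBody K} =
      (ENNReal.ofReal ((1 / 2) ^ n) * volume K) * weight K q)
    {x₀ y₀ : 𝔼 n} (hx₀ : x₀ ∈ K) (hy₀ : y₀ ∈ K) {r₀ : ℝ} (h0 : 0 < r₀) (h1 : r₀ < 1)
    (hmin : ∀ r ∈ Set.Ico (0 : ℝ) r₀, ∀ x ∈ K, ∀ y ∈ K, r • (x - y) ≠ r₀ • (x₀ - y₀))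
    {z : 𝔼 n} (hz : z ∈ K) (hz' : z - r₀ • (x₀ - y₀) ∈ K) :
    ∃ k ∈ K, z = (1 - r₀) • k + r₀ • x₀ := by
  by_contra hcon
  set v := r₀ • (x₀ - y₀) with hv
  set C : Set (𝔼 n) := K ∩ (fun x => x - v) ⁻¹' K with hC
  set H : Set (𝔼 n) := (fun k => r₀ • x₀ + k) '' ((1 - r₀) • K) with hH
  have hr1 : 0 < 1 - r₀ := by linarith
  have hVfin : volume K ≠ ∞ := hK.measure_lt_top.ne
  have hHC : H ⊆ C := by
    rintro _ ⟨_, ⟨k, hk, rfl⟩, rfl⟩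
    refine ⟨hconv hx₀ hk h0.le hr1.le (by ring), ?_⟩
    have := hconv hy₀ hk h0.le hr1.le (by ring)
    change r₀ • x₀ + (1 - r₀) • k - r₀ • (x₀ - y₀) ∈ K
    convert this using 1
    module
  have hzH : z ∉ H := by
    rintro ⟨_, ⟨k, hk, rfl⟩, h⟩
    exact hcon ⟨k, hk, by rw [← h]; simp only; abel⟩
  have hzC : z ∈ C := ⟨hz, hz'⟩
  have hHcpt : IsCompact H := (hK.smul _).image (by fun_prop)
  have hCcpt : IsCompact C := hK.inter_right (hK.isClosed.preimage (by fun_prop))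
  have hCconv : Convex ℝ C := by
    refine hconv.inter ?_
    have : (fun x => x - v) ⁻¹' K = (fun x => x + v) '' K := by
      ext x
      exact ⟨fun h => ⟨x - v, h, by simp⟩, by rintro ⟨y, hy, rfl⟩; simpa using hy⟩
    rw [this]
    have := hconv.translate v
    simpa [add_comm] using this
  have hHint : (interior H).Nonempty := by
    obtain ⟨k, hk⟩ := hint
    refine ⟨r₀ • x₀ + (1 - r₀) • k, ?_⟩
    have hopen : IsOpen ((fun k => r₀ • x₀ + k) '' ((1 - r₀) • interior K)) :=
      (Homeomorph.addLeft (r₀ • x₀)).isOpenMap _ (isOpen_interior.smul₀ hr1.ne')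
    refine interior_maximal ?_ hopen ⟨_, ⟨k, hk, rfl⟩, rfl⟩
    exact Set.image_mono (Set.smul_set_mono interior_subset)
  have hCint : (interior C).Nonempty := hHint.mono (interior_mono hHC)
  have hvolH : volume H = ENNReal.ofReal ((1 - r₀) ^ n) * volume K := by
    rw [hH, Set.image_add_left, measure_preimage_add, Measure.addHaar_smul,
      finrank_euclideanSpace_fin, abs_of_nonneg (by positivity)]
  -- A point of the convex body C off the closed homothet H yields an open piece of C \ H.
  have hlt : ENNReal.ofReal ((1 - r₀) ^ n) * volume K < volume C := by
    have hzcl : z ∈ closure (interior C) := by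
      rw [hCconv.closure_interior_eq_closure_of_nonempty_interior hCint]
      exact subset_closure hzC
    have hne : (Hᶜ ∩ interior C).Nonempty :=
      mem_closure_iff.1 hzcl _ hHcpt.isClosed.isOpen_compl hzH
    have hpos : 0 < volume (Hᶜ ∩ interior C) :=
      (hHcpt.isClosed.isOpen_compl.inter isOpen_interior).measure_pos volume hne
    rw [← hvolH]
    calc volume H < volume H + volume (Hᶜ ∩ interior C) :=
          ENNReal.lt_add_right hHcpt.measure_lt_top.ne hpos.ne'
      _ = volume (H ∪ (Hᶜ ∩ interior C)) := by
          rw [measure_union' (Set.disjoint_left.2 fun a ha hb => hb.1 ha) hHcpt.measurableSet]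
      _ ≤ volume C := measure_mono (Set.union_subset hHC fun a ha => interior_subset ha.2)
  -- Slack on both sides is needed because equality of volumes holds only almost everywhere: r₁ < r₀
  -- leaves room for the weight near q₀, and the compact set C₀ below leaves room for the section.
  obtain ⟨r₁, hr₁, hlt₁⟩ : ∃ r₁ ∈ Set.Ioo 0 r₀,
      ENNReal.ofReal ((1 - r₁) ^ n) * volume K < volume C := by
    have hc : Continuous fun r : ℝ => ENNReal.ofReal ((1 - r) ^ n) * volume K :=
      ENNReal.continuous_mul_const hVfin |>.comp (ENNReal.continuous_ofReal.comp (by fun_prop))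
    have h2 : ∀ᶠ r in nhdsWithin r₀ (Set.Iio r₀),
        ENNReal.ofReal ((1 - r) ^ n) * volume K < volume C :=
      (hc.continuousAt.eventually (gt_mem_nhds hlt)).filter_mono nhdsWithin_le_nhds
    have h3 : ∀ᶠ r in nhdsWithin r₀ (Set.Iio r₀), r ∈ Set.Ioo 0 r₀ := Ioo_mem_nhdsLT h0
    obtain ⟨r, hr⟩ := (h3.and h2).exists
    exact ⟨r, hr.1, hr.2⟩
  set U : Set (𝔼 n) := (1 / 2 : ℝ) • interior C with hU
  have hUopen : IsOpen U := isOpen_interior.smul₀ (by norm_num)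
  have hvolU : volume U = ENNReal.ofReal ((1 / 2) ^ n) * volume C := by
    rw [hU, Measure.addHaar_smul, finrank_euclideanSpace_fin, abs_of_nonneg (by positivity)]
    congr 1
    refine le_antisymm (measure_mono interior_subset) ?_
    have h2 : volume C ≤ volume (interior C) + volume (frontier C) := by
      refine le_trans (measure_mono ?_) (measure_union_le _ _)
      rw [← closure_eq_interior_union_frontier]
      exact subset_closure
    rwa [hCconv.addHaar_frontier volume, add_zero] at h2
  have hltU : ENNReal.ofReal ((1 / 2) ^ n) * (ENNReal.ofReal ((1 - r₁) ^ n) * volume K) <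
      volume U := by
    rw [hvolU]
    exact ENNReal.mul_lt_mul_right (by simp) (by simp) hlt₁
  obtain ⟨C₀, hC₀U, hC₀, hltC₀⟩ := hUopen.exists_lt_isCompact hltU
  set O : Set (((𝔼 n) × ℝ) × (𝔼 n)) :=
    {p | (0 < p.1.2 ∧ p.1.2 < 1) ∧ (∃ k ∈ interior K, p.2 = (1 - p.1.2) • k) ∧
      ∃ k ∈ interior K, p.2 - p.1.1 = p.1.2 • k} with hO
  have hOopen : IsOpen O := by
    set W : Set (((𝔼 n) × ℝ) × (𝔼 n)) := {p | 0 < p.1.2 ∧ p.1.2 < 1} with hW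
    have hct : Continuous fun p : ((𝔼 n) × ℝ) × (𝔼 n) => p.1.2 := by fun_prop
    have hWo : IsOpen W := (isOpen_lt continuous_const hct).inter (isOpen_lt hct continuous_const)
    have hc1 : ContinuousOn (fun p : ((𝔼 n) × ℝ) × (𝔼 n) => (1 - p.1.2)⁻¹ • p.2) W :=
      ((continuous_const.sub hct).continuousOn.inv₀ fun p hp =>
        (sub_pos.2 (And.right hp : p.1.2 < 1)).ne').smul continuous_snd.continuousOn
    have hc2 : ContinuousOn (fun p : ((𝔼 n) × ℝ) × (𝔼 n) => (p.1.2)⁻¹ • (p.2 - p.1.1)) W :=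
      (hct.continuousOn.inv₀ fun p hp => (And.left hp : 0 < p.1.2).ne').smul
        (by fun_prop : Continuous fun p : ((𝔼 n) × ℝ) × (𝔼 n) => p.2 - p.1.1).continuousOn
    have heq : O = (W ∩ (fun p : ((𝔼 n) × ℝ) × (𝔼 n) => (1 - p.1.2)⁻¹ • p.2) ⁻¹' interior K) ∩
        (W ∩ (fun p : ((𝔼 n) × ℝ) × (𝔼 n) => (p.1.2)⁻¹ • (p.2 - p.1.1)) ⁻¹' interior K) := by
      ext p
      constructor
      · rintro ⟨hp, ⟨k, hk, e⟩, k', hk', e'⟩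
        have hp2 := sub_pos.2 hp.2
        refine ⟨⟨hp, ?_⟩, hp, ?_⟩
        · change (1 - p.1.2)⁻¹ • p.2 ∈ interior K
          rwa [e, inv_smul_smul₀ hp2.ne']
        · change (p.1.2)⁻¹ • (p.2 - p.1.1) ∈ interior K
          rwa [e', inv_smul_smul₀ hp.1.ne']
      · rintro ⟨⟨hp, h⟩, -, h'⟩
        have hp2 := sub_pos.2 hp.2
        exact ⟨hp, ⟨_, h, (smul_inv_smul₀ hp2.ne' _).symm⟩, _, h', (smul_inv_smul₀ hp.1.ne' _).symm⟩
    rw [heq]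
    exact (hc1.isOpen_inter_preimage hWo isOpen_interior).inter
      (hc2.isOpen_inter_preimage hWo isOpen_interior)
  set q₀ : (𝔼 n) × ℝ := ((1 / 2 : ℝ) • v, (1 / 2 : ℝ)) with hq₀
  have hsub : ({q₀} : Set ((𝔼 n) × ℝ)) ×ˢ C₀ ⊆ O := by
    rintro ⟨q, x⟩ ⟨rfl, hx⟩
    obtain ⟨c, hc, rfl⟩ := hC₀U hx
    refine ⟨⟨by norm_num [hq₀], by norm_num [hq₀]⟩,
      ⟨c, interior_mono Set.inter_subset_left hc, ?_⟩, c - v, ?_, ?_⟩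
    · simp only [hq₀]; norm_num
    · have h2 : interior ((fun x => x - v) ⁻¹' K) ⊆ (fun x => x - v) ⁻¹' interior K := by
        have := (Homeomorph.subRight v).preimage_interior K
        exact this.symm.subset
      exact h2 (interior_mono Set.inter_subset_right hc)
    · simp only [hq₀]; module
  -- Semicontinuity of the sections: the interior of the section at q₀ contains C₀, and by the tube
  -- lemma so do all sections at nearby q.
  obtain ⟨N, N', hNo, -, hqN, hC₀N, hNO⟩ :=
    generalized_tube_lemma isCompact_singleton hC₀ hOopen hsub
  have hG : IsClosed (Prod.fst '' mixGraph K 0 r₁) :=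
    ((isCompact_mixGraph hK 0 r₁).image continuous_fst).isClosed
  have hqG : q₀ ∉ Prod.fst '' mixGraph K 0 r₁ := by
    rintro ⟨⟨q, r⟩, ⟨hr, hq⟩, h⟩
    simp only at h hr hq
    subst h
    have := le_of_mem_mixHomothet_center h0 hmin hr.1 hq
    linarith [hr.2, hr₁.2]
  have hopen : IsOpen (N ∩ (Prod.fst '' mixGraph K 0 r₁)ᶜ) := hNo.inter hG.isOpen_compl
  have hpos := hopen.measure_pos volume ⟨q₀, hqN rfl, hqG⟩
  -- This neighbourhood of q₀ also avoids the closed union of the homothets of ratio at most r₁.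
  -- Being open and nonempty, it contains a point where equality holds.
  have hne : ∃ q ∈ N ∩ (Prod.fst '' mixGraph K 0 r₁)ᶜ,
      volume {x | (q, x) ∈ sectionBody K} =
        (ENNReal.ofReal ((1 / 2) ^ n) * volume K) * weight K q := by
    by_contra hno
    push Not at hno
    exact hpos.ne' (measure_mono_null (fun q hq => hno q hq) hae)
  obtain ⟨q, ⟨hqN', hqG'⟩, heq⟩ := hne
  have hw : weight K q ≤ ENNReal.ofReal ((1 - r₁) ^ n) := by
    refine weight_le hn (by linarith [hr₁.2]) fun r hr hq => ?_
    by_contra hlt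
    exact hqG' ⟨(q, r), ⟨⟨hr.1, (not_le.1 hlt).le⟩, hq⟩, rfl⟩
  have hlow : volume C₀ ≤ volume {x | (q, x) ∈ sectionBody K} := by
    refine measure_mono fun x hx => ?_
    obtain ⟨hp, ⟨k, hk, e⟩, k', hk', e'⟩ := hNO (⟨hqN', hC₀N hx⟩ : (q, x) ∈ N ×ˢ N')
    exact ⟨⟨hp.1.le, hp.2.le⟩, ⟨k, interior_subset hk, e.symm⟩, k', interior_subset hk', e'.symm⟩
  refine absurd (hltC₀.trans_le (hlow.trans heq.le)) (not_lt.2 ?_)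
  rw [mul_assoc, mul_comm (ENNReal.ofReal ((1 - r₁) ^ n))]
  gcongr

end

/-! ### A body with homothetic sections and finitely many extreme points: the simplex. -/

section

variable {K : Set (𝔼 n)}

/-- The intersections of `K` with its translates are homothets of `K`. -/
def HomotheticSections (K : Set (𝔼 n)) : Prop :=
  ∀ x₀ ∈ K, ∀ y₀ ∈ K, ∀ r₀ : ℝ, 0 < r₀ → r₀ < 1 →
    (∀ r ∈ Set.Ico (0 : ℝ) r₀, ∀ x ∈ K, ∀ y ∈ K, r • (x - y) ≠ r₀ • (x₀ - y₀)) →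
    ∀ z ∈ K, z - r₀ • (x₀ - y₀) ∈ K → ∃ k ∈ K, z = (1 - r₀) • k + r₀ • x₀

lemma exists_minimal_ratio (hK : IsCompact K) {l : ℝ} (hl : 0 ≤ l) {p p' : 𝔼 n} (hp : p ∈ K)
    (hp' : p' ∈ K) :
    ∃ r₀ ∈ Set.Icc 0 l, ∃ x₀ ∈ K, ∃ y₀ ∈ K, r₀ • (x₀ - y₀) = l • (p - p') ∧
      ∀ r ∈ Set.Ico (0 : ℝ) r₀, ∀ x ∈ K, ∀ y ∈ K, r • (x - y) ≠ l • (p - p') := by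
  set S : Set ℝ := Prod.fst '' ((Set.Icc 0 l ×ˢ K ×ˢ K) ∩
    {t : ℝ × (𝔼 n) × (𝔼 n) | t.1 • (t.2.1 - t.2.2) = l • (p - p')}) with hS
  have hcomp : IsCompact S :=
    ((isCompact_Icc.prod (hK.prod hK)).inter_right
      (isClosed_eq (by fun_prop) (by fun_prop))).image continuous_fst
  obtain ⟨r₀, ⟨⟨r, x₀, y₀⟩, ⟨⟨hr, hx, hy⟩, he⟩, rfl⟩, hmin⟩ := hcomp.exists_isLeast
    ⟨l, (l, p, p'), ⟨⟨⟨hl, le_rfl⟩, hp, hp'⟩, rfl⟩, rfl⟩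
  refine ⟨r, hr, x₀, hx, y₀, hy, he, fun r' hr' x hx y hy he' => ?_⟩
  have := hmin ⟨(r', x, y), ⟨⟨⟨hr'.1, hr'.2.le.trans hr.2⟩, hx, hy⟩, he'⟩, rfl⟩
  exact absurd hr'.2 (not_lt.2 this)

lemma eq_of_mem_extremePoints {p : 𝔼 n} (hp : p ∈ K.extremePoints ℝ) {k x : 𝔼 n} (hk : k ∈ K)
    (hx : x ∈ K) {r : ℝ} (h0 : 0 < r) (h1 : r < 1) (h : p = (1 - r) • k + r • x) : x = p :=
  (mem_extremePoints.1 hp).2 k hk x hx ⟨1 - r, r, by linarith, h0, by ring, h.symm⟩ |>.2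

/-- Read in the cone over K, ordered by differences: an element of mass s above both bp and bp' is
above bp + bp'. With l = b/(s-b), the hypothesis says that k' and k differ by v = l(p - p'), so k'
lies in K ∩ (K + v), which is the homothet lp + (1-l)K. -/
lemma HomotheticSections.exists_eq_add (hH : HomotheticSections K) (hK : IsCompact K)
    (hconv : Convex ℝ K) {p p' : 𝔼 n} (hp : p ∈ K.extremePoints ℝ) (hp' : p' ∈ K.extremePoints ℝ)
    (hne : p ≠ p') {b s : ℝ} (hb : 0 < b) (hs : 2 * b < s) {k k' : 𝔼 n} (hk : k ∈ K)
    (hk' : k' ∈ K) (h : b • p + (s - b) • k = b • p' + (s - b) • k') :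
    ∃ m ∈ K, (s - b) • k' = b • p + (s - 2 * b) • m := by
  have hsb : 0 < s - b := by linarith
  set l := b / (s - b) with hl
  have hl0 : 0 < l := div_pos hb hsb
  have hl1 : l < 1 := (div_lt_one hsb).2 (by linarith)
  have hls : (s - b) * l = b := by rw [hl]; field_simp
  have hpK := hp.1
  have hpK' := hp'.1
  obtain ⟨r₀, hr₀, x₀, hx₀, y₀, hy₀, he, hmin⟩ := exists_minimal_ratio hK hl0.le hpK hpK'
  have hvne : l • (p - p') ≠ 0 := smul_ne_zero hl0.ne' (sub_ne_zero.2 hne)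
  have hr0 : 0 < r₀ := by
    refine lt_of_le_of_ne hr₀.1 fun h0 => hvne ?_
    rw [← he, ← h0, zero_smul]
  have hr1 : r₀ < 1 := hr₀.2.trans_lt hl1
  rw [← he] at hmin
  have key := hH x₀ hx₀ y₀ hy₀ r₀ hr0 hr1 hmin
  rw [he] at key
  -- The homothety data of the least ratio are identified by extremality: p lies in K ∩ (K + v),
  -- hence in the homothet, so p is a proper convex combination involving x₀. The same for p' gives
  -- y₀, and then r₀ = l.
  have hx : x₀ = p := by
    obtain ⟨m, hm, e⟩ := key p hpK (by
      have := hconv hpK hpK' (by linarith : 0 ≤ 1 - l) hl0.le (by ring)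
      convert this using 1
      module)
    exact eq_of_mem_extremePoints hp hm hx₀ hr0 hr1 e
  have hy : y₀ = p' := by
    have h1 : (1 - l) • p' + l • p - l • (p - p') = p' := by module
    obtain ⟨m, hm, e⟩ := key ((1 - l) • p' + l • p)
      (hconv hpK' hpK (by linarith : 0 ≤ 1 - l) hl0.le (by ring)) (by rw [h1]; exact hpK')
    refine eq_of_mem_extremePoints hp' hm hy₀ hr0 hr1 ?_
    rw [← h1, e, ← he]
    module
  subst hx hy
  have hrl : r₀ = l := by
    have : (r₀ - l) • (x₀ - y₀) = 0 := by rw [sub_smul, he, sub_self]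
    have := (smul_eq_zero.1 this).resolve_right (sub_ne_zero.2 hne)
    linarith
  subst hrl
  have hkk : k' - l • (x₀ - y₀) = k := by
    have h2 : (s - b) • (k' - l • (x₀ - y₀)) = (s - b) • k := by
      rw [smul_sub, smul_smul, hls]
      have : (s - b) • k = b • y₀ + (s - b) • k' - b • x₀ := by rw [← h]; abel
      rw [this]; module
    exact smul_right_injective _ hsb.ne' h2
  obtain ⟨m, hm, e⟩ := key k' hk' (by rw [hkk]; exact hk)
  refine ⟨m, hm, ?_⟩
  have h3 : s - 2 * b = (s - b) * (1 - l) := by rw [mul_sub, hls]; ring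
  rw [e, h3, smul_add, smul_smul, smul_smul, hls, add_comm]

/-- Removes a large multiple of p' from an element that dominates bp, in N steps of size b; each
step is one application of the two-point property. -/
lemma HomotheticSections.exists_eq_add_of_nsmul (hH : HomotheticSections K) (hK : IsCompact K)
    (hconv : Convex ℝ K) {p p' : 𝔼 n} (hp : p ∈ K.extremePoints ℝ) (hp' : p' ∈ K.extremePoints ℝ)
    (hne : p ≠ p') {b w : ℝ} (hb : 0 < b) (hw : b < w) {q : 𝔼 n} (hq : q ∈ K) (N : ℕ)
    (h : ∃ k ∈ K, (N * b) • p' + w • q = b • p + (w + N * b - b) • k) :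
    ∃ k ∈ K, w • q = b • p + (w - b) • k := by
  induction N with
  | zero => simpa using h
  | succ N ih =>
    apply ih
    obtain ⟨k, hk, e⟩ := h
    have hNb : 0 ≤ N * b := by positivity
    have hpos : 0 < w + N * b := by linarith
    set k' : 𝔼 n := (w + N * b)⁻¹ • ((N * b) • p' + w • q) with hkdef
    have hk' : k' ∈ K := by
      have := hconv hp'.1 hq (a := (w + N * b)⁻¹ * (N * b)) (b := (w + N * b)⁻¹ * w)
        (by positivity) (by have : 0 < w := hb.trans hw; positivity) (by field_simp; ring)
      convert this using 1
      rw [hkdef]; module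
    have hk'' : (w + N * b) • k' = (N * b) • p' + w • q := smul_inv_smul₀ hpos.ne' _
    have hsb : w + (N + 1) * b - b = w + N * b := by ring
    obtain ⟨m, hm, e'⟩ := hH.exists_eq_add hK hconv hp hp' hne hb (s := w + (N + 1) * b)
      (by nlinarith) hk hk' (by
        rw [hsb, hk'']
        push_cast at e
        rw [hsb] at e
        rw [← e]; module)
    refine ⟨m, hm, ?_⟩
    rw [hsb, hk''] at e'
    rw [e']
    congr 2
    ring

lemma exists_eq_add_of_le (hconv : Convex ℝ K) {p y : 𝔼 n} (hp : p ∈ K) {b b' h : ℝ}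
    (hb : b' ≤ b) (hb0 : b < h) (hy : ∃ k ∈ K, y = b • p + (h - b) • k) :
    ∃ k ∈ K, y = b' • p + (h - b') • k := by
  obtain ⟨k, hk, rfl⟩ := hy
  have hpos : 0 < h - b' := by linarith
  have h1 := hconv hp hk (a := (h - b')⁻¹ * (b - b')) (b := (h - b')⁻¹ * (h - b))
    (mul_nonneg (inv_nonneg.2 hpos.le) (by linarith))
    (mul_nonneg (inv_nonneg.2 hpos.le) (by linarith)) (by field_simp; ring)
  refine ⟨_, h1, ?_⟩
  rw [smul_add, smul_smul, smul_smul, ← mul_assoc, ← mul_assoc, mul_inv_cancel₀ hpos.ne']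
  module

/-- Induction on the number of terms: the term of e i is peeled off without losing domination of a
positive multiple of p, until a single term remains and contradicts extremality. -/
lemma HomotheticSections.not_dominated (hH : HomotheticSections K) (hK : IsCompact K)
    (hconv : Convex ℝ K) {ι : Type*} {e : ι → 𝔼 n} (he : ∀ i, e i ∈ K.extremePoints ℝ)
    {p : 𝔼 n} (hp : p ∈ K.extremePoints ℝ) {w : ι → ℝ} (s : Finset ι)
    (hw : ∀ i ∈ s, 0 ≤ w i) (hne : ∀ i ∈ s, e i ≠ p) {b : ℝ} (hb : 0 < b)
    (hbs : b < ∑ i ∈ s, w i) :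
    ¬ ∃ k ∈ K, ∑ i ∈ s, w i • e i = b • p + (∑ i ∈ s, w i - b) • k := by
  classical
  induction s using Finset.induction_on generalizing b with
  | empty => simp at hbs; linarith
  | insert i t hit ih =>
    rintro hex
    have hwt : ∀ j ∈ t, 0 ≤ w j := fun j hj => hw j (Finset.mem_insert_of_mem hj)
    have hwi : 0 ≤ w i := hw i (Finset.mem_insert_self _ _)
    have hnet : ∀ j ∈ t, e j ≠ p := fun j hj => hne j (Finset.mem_insert_of_mem hj)
    have hnei : e i ≠ p := hne i (Finset.mem_insert_self _ _)
    have ih' := fun b hb hbs => ih (b := b) hwt hnet hb hbs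
    rw [Finset.sum_insert hit] at hbs
    simp only [Finset.sum_insert hit] at hex
    set W := ∑ j ∈ t, w j with hW
    rcases hwi.eq_or_lt with h0 | hpos
    · rw [← h0] at hbs hex
      simp only [zero_smul, zero_add] at hbs hex
      exact ih' b hb hbs hex
    rcases (Finset.sum_nonneg hwt).eq_or_lt with hW0 | hWpos
    · have hz : ∀ j ∈ t, w j = 0 := (Finset.sum_eq_zero_iff_of_nonneg hwt).1 hW0.symm
      have hz' : ∑ j ∈ t, w j • e j = 0 := Finset.sum_eq_zero fun j hj => by rw [hz j hj, zero_smul]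
      rw [← hW] at hW0
      obtain ⟨k, hk, h⟩ := hex
      rw [hz', ← hW0, add_zero, add_zero] at h
      rw [← hW0, add_zero] at hbs
      refine hnei (eq_of_mem_extremePoints (he i) hk hp.1 (r := b / w i) (by positivity)
        ((div_lt_one hpos).2 hbs) ?_).symm
      have h2 : e i = (w i)⁻¹ • (w i • e i) := (inv_smul_smul₀ hpos.ne' _).symm
      rw [h2, h, smul_add, smul_smul, smul_smul, add_comm]
      congr 2 <;> field_simp
    -- N is so large that w i / N is below both b and the remaining mass W: the first lets the
    -- dominated multiple of p shrink to w i / N, the second leaves room to remove w i in N equal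
    -- steps.
    · obtain ⟨N, hN⟩ := exists_nat_gt (max (w i / b) (w i / W))
      have hN0 : (0 : ℝ) < N := lt_of_le_of_lt (le_max_of_le_left (by positivity)) hN
      have hb1 : w i / N < b := by
        rw [div_lt_comm₀ hN0 hb]; exact (le_max_left _ _).trans_lt hN
      have hb2 : w i / N < W := by
        rw [div_lt_comm₀ hN0 hWpos]; exact (le_max_right _ _).trans_lt hN
      have hb3 : 0 < w i / N := by positivity
      have hNb : N * (w i / N) = w i := by field_simp
      set q : 𝔼 n := W⁻¹ • ∑ j ∈ t, w j • e j with hq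
      have hqK : q ∈ K := by
        rw [hq, Finset.smul_sum]
        simp only [smul_smul]
        refine hconv.sum_mem (fun j hj => mul_nonneg (inv_nonneg.2 hWpos.le) (hwt j hj)) ?_
          fun j _ => (he j).1
        rw [← Finset.mul_sum]
        exact inv_mul_cancel₀ hWpos.ne'
      have hWq : W • q = ∑ j ∈ t, w j • e j := smul_inv_smul₀ hWpos.ne' _
      refine ih' (w i / N) hb3 hb2 ?_
      rw [← hWq]
      refine hH.exists_eq_add_of_nsmul hK hconv hp (he i) hnei.symm hb3 hb2 hqK N ?_
      rw [hNb, hWq, add_comm W]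
      exact exists_eq_add_of_le hconv hp.1 hb1.le hbs hex

/-- In an affine relation the terms with positive coefficients sum to those with negative ones. The
left side dominates a positive multiple of some e i, while e i does not occur on the right. -/
lemma HomotheticSections.affineIndependent (hH : HomotheticSections K) (hK : IsCompact K)
    (hconv : Convex ℝ K) {ι : Type*} {e : ι → 𝔼 n} (he : ∀ i, e i ∈ K.extremePoints ℝ)
    (hinj : Function.Injective e) : AffineIndependent ℝ e := by
  classical
  rw [affineIndependent_iff]
  intro s w hs0 hs1
  by_contra hcon
  push Not at hcon
  obtain ⟨i, hi, hwi⟩ : ∃ i ∈ s, 0 < w i := by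
    by_contra hno
    push Not at hno
    obtain ⟨i, hi, hwi⟩ := hcon
    exact hwi ((Finset.sum_eq_zero_iff_of_nonpos hno).1 hs0 i hi)
  set J := s.filter fun j => 0 < w j with hJ
  set J' := s.filter fun j => ¬ 0 < w j with hJ'
  have h0 : ∑ j ∈ J, w j = ∑ j ∈ J', -w j := by
    rw [Finset.sum_neg_distrib, ← add_eq_zero_iff_eq_neg, hJ, hJ',
      Finset.sum_filter_add_sum_filter_not, hs0]
  have h1 : ∑ j ∈ J, w j • e j = ∑ j ∈ J', (-w j) • e j := by
    simp only [neg_smul]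
    rw [Finset.sum_neg_distrib, ← add_eq_zero_iff_eq_neg, hJ, hJ',
      Finset.sum_filter_add_sum_filter_not, hs1]
  have hiJ : i ∈ J := Finset.mem_filter.2 ⟨hi, hwi⟩
  have hsum : w i ≤ ∑ j ∈ J, w j :=
    Finset.single_le_sum (f := w) (fun j hj => (Finset.mem_filter.1 hj).2.le) hiJ
  -- Half of w i is used to keep the remaining mass positive even when i is the only positive index.
  refine hH.not_dominated hK hconv he (he i) (w := fun j => -w j) J' (b := w i / 2)
    (fun j hj => by have := not_lt.1 (Finset.mem_filter.1 hj).2; linarith)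
    (fun j hj hji => by
      have := hinj hji
      subst this
      exact (Finset.mem_filter.1 hj).2 hwi) (by linarith) (by rw [← h0]; linarith) ?_
  rw [← h0, ← h1]
  set h := ∑ j ∈ J, w j with hh
  have hpos : 0 < h - w i / 2 := by linarith
  set w' : ι → ℝ := fun j => if j = i then w i / 2 else w j with hw'
  have hsplit : ∀ f : ι → ℝ, ∑ j ∈ J, f j = f i + ∑ j ∈ J.erase i, f j := fun f =>
    (Finset.add_sum_erase J f hiJ).symm
  have hw'sum : ∑ j ∈ J, w' j = h - w i / 2 := by
    rw [hsplit, hh, hsplit w, Finset.sum_congr rfl (g := w) fun j hj => by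
      simp [hw', Finset.ne_of_mem_erase hj]]
    simp only [hw', if_true]
    ring
  refine ⟨(h - w i / 2)⁻¹ • ∑ j ∈ J, w' j • e j, ?_, ?_⟩
  · rw [Finset.smul_sum]
    simp only [smul_smul]
    refine hconv.sum_mem (fun j hj => mul_nonneg (inv_nonneg.2 hpos.le) ?_) ?_ fun j _ => (he j).1
    · simp only [hw']
      split_ifs
      · linarith
      · exact (Finset.mem_filter.1 hj).2.le
    · rw [← Finset.mul_sum, hw'sum]
      exact inv_mul_cancel₀ hpos.ne'
  · rw [smul_inv_smul₀ hpos.ne', ← Finset.add_sum_erase J _ hiJ,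
      ← Finset.add_sum_erase J (fun j => w' j • e j) hiJ,
      Finset.sum_congr rfl (g := fun j => w j • e j) (s₁ := J.erase i) (f := fun j => w' j • e j)
      fun j hj => by simp [hw', Finset.ne_of_mem_erase hj]]
    simp only [hw', if_true]
    module

lemma IsFullPolytope.isFullSimplex {P : Set (𝔼 n)} (hP : IsFullPolytope P)
    (hH : HomotheticSections P) : IsFullSimplex P := by
  have hK := hP.isCompact
  have hconv := hP.convex
  have hfin : (P.extremePoints ℝ).Finite := by
    obtain ⟨⟨V, hV, -, rfl⟩, -⟩ := hP
    exact hV.subset extremePoints_convexHull_subset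
  have hPe : P = convexHull ℝ (P.extremePoints ℝ) := by
    have h1 := closure_convexHull_extremePoints hK hconv
    rw [(hfin.isCompact_convexHull ℝ).isClosed.closure_eq] at h1
    exact h1.symm
  have hai : AffineIndependent ℝ (Subtype.val : P.extremePoints ℝ → 𝔼 n) :=
    hH.affineIndependent hK hconv (fun i => i.2) Subtype.val_injective
  have := hfin.fintype
  have hne : (P.extremePoints ℝ).Nonempty := by
    rw [← convexHull_nonempty_iff (𝕜 := ℝ), ← hPe]; exact hP.nonempty
  have : Nonempty (P.extremePoints ℝ) := hne.to_subtype
  have hcard : Fintype.card (P.extremePoints ℝ) = n + 1 := by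
    rw [← hai.finrank_vectorSpan_add_one, Subtype.range_coe]
    have h2 : vectorSpan ℝ (P.extremePoints ℝ) = ⊤ := by
      rw [← hP.vectorSpan_eq_top]
      conv_rhs => rw [hPe]
      rw [← direction_affineSpan, ← direction_affineSpan, affineSpan_convexHull]
    rw [h2, finrank_top, finrank_euclideanSpace_fin]
  have eqv : Fin (n + 1) ≃ P.extremePoints ℝ := (Fintype.equivFinOfCardEq hcard).symm
  refine ⟨fun i => (eqv i : 𝔼 n), ?_, ?_⟩
  · exact hai.comp_embedding eqv.toEmbedding
  · have : Set.range (fun i => (eqv i : 𝔼 n)) = P.extremePoints ℝ := by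
      rw [show (fun i => (eqv i : 𝔼 n)) = Subtype.val ∘ eqv from rfl, eqv.surjective.range_comp,
        Subtype.range_coe]
    rw [this]
    exact hPe

lemma IsFullPolytope.meanDiam_le (hn : n ≠ 0) {P : Set (𝔼 n)} (hP : IsFullPolytope P)
    (hG : GeneralRelPos P) : (meanDiam P).toReal ≤ 2 ^ n - 1 := by
  have h := (rogers_shephard hn hP.isCompact hP.convex hP.volume_pos).1
  rw [(hP.meanDiam_formula hG).2, div_mul_eq_mul_div]
  gcongr
  rwa [div_le_iff₀ hP.volumeReal_pos]

lemma IsFullPolytope.isFullSimplex_of_meanDiam_eq (hn : n ≠ 0) {P : Set (𝔼 n)}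
    (hP : IsFullPolytope P) (hG : GeneralRelPos P) (h : (meanDiam P).toReal = 2 ^ n - 1) :
    IsFullSimplex P := by
  refine hP.isFullSimplex fun x₀ hx₀ y₀ hy₀ r₀ h0 h1 hmin z hz hz' => ?_
  refine mem_homothet_of_ae_eq hn hP.isCompact hP.convex hP.interior_nonempty
    ((rogers_shephard hn hP.isCompact hP.convex hP.volume_pos).2 ?_) hx₀ hy₀ h0 h1 hmin hz hz'
  rw [(hP.meanDiam_formula hG).2, div_mul_eq_mul_div, sub_left_inj,
    div_eq_iff hP.volumeReal_pos.ne'] at h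
  exact h

end

/-! ### Affine diameters through an interior point of a simplex. -/

section

variable {ι : Type*}

/-- The normalized part of the barycentric expansion of `z` supported on `S`. -/
def barycentricPart (b : AffineBasis ι ℝ (𝔼 n)) (z : 𝔼 n) (S : Finset ι) : 𝔼 n :=
  (∑ i ∈ S, b.coord i z)⁻¹ • ∑ i ∈ S, b.coord i z • b i

lemma barycentricPart_eq {b : AffineBasis ι ℝ (𝔼 n)} {z : 𝔼 n} {S : Finset ι}
    (hS : ∑ i ∈ S, b.coord i z ≠ 0) : barycentricPart b z S =
      S.affineCombination ℝ b fun i => (∑ i ∈ S, b.coord i z)⁻¹ * b.coord i z := by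
  rw [Finset.affineCombination_eq_linear_combination, barycentricPart, Finset.smul_sum]
  · simp only [smul_smul]
  · rw [← Finset.mul_sum, inv_mul_cancel₀ hS]

lemma coord_barycentricPart_of_mem {b : AffineBasis ι ℝ (𝔼 n)} {z : 𝔼 n} {S : Finset ι}
    (hS : ∑ i ∈ S, b.coord i z ≠ 0) {i : ι} (hi : i ∈ S) :
    b.coord i (barycentricPart b z S) = (∑ i ∈ S, b.coord i z)⁻¹ * b.coord i z := by
  rw [barycentricPart_eq hS, b.coord_apply_combination_of_mem hi]
  rw [← Finset.mul_sum, inv_mul_cancel₀ hS]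

lemma coord_barycentricPart_of_notMem {b : AffineBasis ι ℝ (𝔼 n)} {z : 𝔼 n} {S : Finset ι}
    (hS : ∑ i ∈ S, b.coord i z ≠ 0) {i : ι} (hi : i ∉ S) :
    b.coord i (barycentricPart b z S) = 0 := by
  rw [barycentricPart_eq hS, b.coord_apply_combination_of_notMem hi]
  rw [← Finset.mul_sum, inv_mul_cancel₀ hS]

lemma barycentricPart_mem {b : AffineBasis ι ℝ (𝔼 n)} {z : 𝔼 n} (hz : ∀ i, 0 < b.coord i z)
    {S : Finset ι} (hS : S.Nonempty) :
    barycentricPart b z S ∈ convexHull ℝ (Set.range b) := by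
  have hpos : 0 < ∑ i ∈ S, b.coord i z := Finset.sum_pos (fun i _ => hz i) hS
  rw [b.convexHull_eq_nonneg_coord]
  intro i
  by_cases hi : i ∈ S
  · rw [coord_barycentricPart_of_mem hpos.ne' hi]
    exact mul_nonneg (inv_nonneg.2 hpos.le) (hz i).le
  · rw [coord_barycentricPart_of_notMem hpos.ne' hi]

variable [Fintype ι] [DecidableEq ι]

/-- The sum of the barycentric coordinates over S is affine, lies in [0,1] on the simplex, and
equals 1 and 0 at the two end points; its extreme level sets are the parallel supporting
hyperplanes. The point z is the mean of the two parts weighted by their masses. -/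
lemma isAffineDiameter_barycentricPart {b : AffineBasis ι ℝ (𝔼 n)} {z : 𝔼 n}
    (hz : ∀ i, 0 < b.coord i z) {S : Finset ι} (hS : S.Nonempty) (hSc : Sᶜ.Nonempty) :
    IsAffineDiameter (convexHull ℝ (Set.range b))
      (segment ℝ (barycentricPart b z S) (barycentricPart b z Sᶜ)) ∧
      z ∈ segment ℝ (barycentricPart b z S) (barycentricPart b z Sᶜ) := by
  have hpos : 0 < ∑ i ∈ S, b.coord i z := Finset.sum_pos (fun i _ => hz i) hS
  have hpos' : 0 < ∑ i ∈ Sᶜ, b.coord i z := Finset.sum_pos (fun i _ => hz i) hSc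
  set g : (𝔼 n) → ℝ := fun x => ∑ i ∈ S, b.coord i x with hg
  set f : (𝔼 n) →ₗ[ℝ] ℝ := ∑ i ∈ S, (b.coord i).linear with hf
  have hfg : ∀ x y, f x - f y = g x - g y := by
    intro x y
    rw [← map_sub, hf, LinearMap.sum_apply, hg, ← Finset.sum_sub_distrib]
    exact Finset.sum_congr rfl fun i _ => (b.coord i).linearMap_vsub x y
  have hgx : g (barycentricPart b z S) = 1 := by
    simp only [hg]
    rw [Finset.sum_congr rfl fun i hi => coord_barycentricPart_of_mem hpos.ne' hi,
      ← Finset.mul_sum, inv_mul_cancel₀ hpos.ne']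
  have hgy : g (barycentricPart b z Sᶜ) = 0 :=
    Finset.sum_eq_zero fun i hi => coord_barycentricPart_of_notMem hpos'.ne'
      fun h => (Finset.mem_compl.1 h) hi
  have hmem : ∀ x ∈ convexHull ℝ (Set.range b), 0 ≤ g x ∧ g x ≤ 1 := by
    intro x hx
    rw [b.convexHull_eq_nonneg_coord] at hx
    refine ⟨Finset.sum_nonneg fun i _ => hx i, ?_⟩
    rw [← b.sum_coord_apply_eq_one x]
    exact Finset.sum_le_univ_sum_of_nonneg hx
  have hf0 : LinearMap.toContinuousLinearMap f ≠ 0 := by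
    intro h0
    have h1 := hfg (barycentricPart b z S) (barycentricPart b z Sᶜ)
    have h2 : ∀ x, f x = 0 := fun x => congrArg (fun φ : (𝔼 n) →L[ℝ] ℝ => φ x) h0
    rw [hgx, hgy, h2, h2] at h1
    norm_num at h1
  obtain ⟨u, hu, c, hc, huf⟩ := exists_unit_of_ne_zero hf0
  have hinner : ∀ x y, inner ℝ u x - inner ℝ u y = c * (g x - g y) := by
    intro x y
    rw [huf, huf, ← hfg, mul_sub]; rfl
  refine ⟨⟨u, hu, _, ⟨barycentricPart_mem hz hS, fun y hy => ?_⟩, _,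
    ⟨barycentricPart_mem hz hSc, fun y hy => ?_⟩, ?_, rfl⟩, ?_⟩
  · have h1 := hinner (barycentricPart b z S) y
    rw [hgx] at h1
    have := mul_nonneg hc.le (sub_nonneg.2 (hmem y hy).2)
    linarith
  · have h1 := hinner y (barycentricPart b z Sᶜ)
    rw [hgy] at h1
    have := mul_nonneg hc.le (hmem y hy).1
    rw [inner_neg_left, inner_neg_left]
    linarith
  · intro h
    have h1 := hinner (barycentricPart b z S) (barycentricPart b z Sᶜ)
    rw [hgx, hgy, h] at h1
    linarith
  · refine ⟨_, _, hpos.le, hpos'.le, ?_, ?_⟩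
    · rw [Finset.sum_add_sum_compl, b.sum_coord_apply_eq_one]
    · rw [barycentricPart, barycentricPart, smul_inv_smul₀ hpos.ne', smul_inv_smul₀ hpos'.ne',
        Finset.sum_add_sum_compl, b.linear_combination_coord_eq_self]

/-- As all coordinates of z are positive, a part determines its index set as its support. The common
index i₀ rules out exchange of the ends. -/
lemma segment_barycentricPart_injective {b : AffineBasis ι ℝ (𝔼 n)} {z : 𝔼 n}
    (hz : ∀ i, 0 < b.coord i z) {i₀ : ι} {S T : Finset ι} (hS : i₀ ∈ S)
    (hT : i₀ ∈ T) (hTc : Tᶜ.Nonempty)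
    (h : segment ℝ (barycentricPart b z S) (barycentricPart b z Sᶜ) =
      segment ℝ (barycentricPart b z T) (barycentricPart b z Tᶜ)) : S = T := by
  have hsupp : ∀ {A B : Finset ι}, A.Nonempty → B.Nonempty →
      barycentricPart b z A = barycentricPart b z B → A ⊆ B := by
    intro A B hA hB hAB i hi
    by_contra hiB
    have hposA : 0 < ∑ i ∈ A, b.coord i z := Finset.sum_pos (fun i _ => hz i) hA
    have hposB : 0 < ∑ i ∈ B, b.coord i z := Finset.sum_pos (fun i _ => hz i) hB
    have h1 := coord_barycentricPart_of_mem hposA.ne' hi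
    rw [hAB, coord_barycentricPart_of_notMem hposB.ne' hiB] at h1
    exact (mul_pos (inv_pos.2 hposA) (hz i)).ne h1
  rcases segment_eq_segment h with ⟨h1, -⟩ | ⟨h1, -⟩
  · exact (hsupp ⟨i₀, hS⟩ ⟨i₀, hT⟩ h1).antisymm (hsupp ⟨i₀, hT⟩ ⟨i₀, hS⟩ h1.symm)
  · exact absurd hT (Finset.mem_compl.1 (hsupp ⟨i₀, hS⟩ hTc h1 hS))

lemma le_numDiam_of_mem_interior_simplex (b : AffineBasis (Fin (n + 1)) ℝ (𝔼 n)) {z : 𝔼 n}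
    (hz : z ∈ interior (convexHull ℝ (Set.range b))) :
    ((2 ^ n - 1 : ℕ) : ℝ≥0∞) ≤ numDiam (convexHull ℝ (Set.range b)) z := by
  rw [b.interior_convexHull] at hz
  have hz' : ∀ i, 0 < b.coord i z := hz
  -- Each unordered splitting is represented by the block containing 0, that is, by a subset of the
  -- other n indices; the full subset is excluded, which leaves 2^n - 1.
  set A : Finset (Fin n) → Finset (Fin (n + 1)) := fun S => insert 0 (S.map (Fin.succEmb n)) with hA
  have hmemA : ∀ S i, Fin.succ i ∈ A S ↔ i ∈ S := by
    intro S i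
    simp [hA, Fin.succ_ne_zero]
  have h0A : ∀ S, 0 ∈ A S := fun S => Finset.mem_insert_self _ _
  have hAc : ∀ S ∈ (Finset.univ : Finset (Finset (Fin n))).erase Finset.univ, (A S)ᶜ.Nonempty := by
    intro S hS
    obtain ⟨i, hi⟩ : ∃ i, i ∉ S := by
      by_contra hno
      push Not at hno
      exact (Finset.mem_erase.1 hS).1 (Finset.eq_univ_iff_forall.2 hno)
    exact ⟨i.succ, Finset.mem_compl.2 fun h => hi ((hmemA S i).1 h)⟩
  set F : Finset (Fin n) → Set (𝔼 n) := fun S =>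
    segment ℝ (barycentricPart b z (A S)) (barycentricPart b z (A S)ᶜ) with hF
  have hinj : Set.InjOn F ((Finset.univ : Finset (Finset (Fin n))).erase Finset.univ) := by
    intro S hS T hT h
    have := segment_barycentricPart_injective hz' (h0A S) (h0A T) (hAc T hT) h
    ext i
    rw [← hmemA, ← hmemA, this]
  have hle : Set.encard (F '' ((Finset.univ : Finset (Finset (Fin n))).erase Finset.univ)) ≤
      Set.encard {S | IsAffineDiameter (convexHull ℝ (Set.range b)) S ∧ z ∈ S} := by
    refine Set.encard_le_encard ?_
    rintro _ ⟨S, hS, rfl⟩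
    exact isAffineDiameter_barycentricPart hz' ⟨0, h0A S⟩ (hAc S hS)
  rw [hinj.encard_image, Set.encard_coe_eq_coe_finsetCard, Finset.card_erase_of_mem
    (Finset.mem_univ _), Finset.card_univ, Fintype.card_finset, Fintype.card_fin] at hle
  rw [numDiam]
  exact_mod_cast hle

lemma IsFullSimplex.le_meanDiam {P : Set (𝔼 n)} (hP : IsFullPolytope P) (hS : IsFullSimplex P) :
    ((2 ^ n - 1 : ℕ) : ℝ≥0∞) ≤ meanDiam P := by
  obtain ⟨p, hp, rfl⟩ := hS
  have htop : affineSpan ℝ (Set.range p) = ⊤ := by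
    rw [hp.affineSpan_eq_top_iff_card_eq_finrank_add_one]
    simp
  set b : AffineBasis (Fin (n + 1)) ℝ (𝔼 n) := ⟨p, hp, htop⟩ with hb
  rw [meanDiam, ENNReal.le_div_iff_mul_le (Or.inl hP.volume_pos.ne') (Or.inl hP.volume_ne_top)]
  have hvol : volume (convexHull ℝ (Set.range p)) ≤
      volume (interior (convexHull ℝ (Set.range p))) := by
    have h2 : volume (convexHull ℝ (Set.range p)) ≤
        volume (interior (convexHull ℝ (Set.range p))) +
          volume (frontier (convexHull ℝ (Set.range p))) := by
      refine le_trans (measure_mono ?_) (measure_union_le _ _)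
      rw [← closure_eq_interior_union_frontier]
      exact subset_closure
    rwa [hP.convex.addHaar_frontier volume, add_zero] at h2
  calc ((2 ^ n - 1 : ℕ) : ℝ≥0∞) * volume (convexHull ℝ (Set.range p))
      ≤ ((2 ^ n - 1 : ℕ) : ℝ≥0∞) * volume (interior (convexHull ℝ (Set.range p))) := by gcongr
    _ = ∫⁻ _ in interior (convexHull ℝ (Set.range p)), ((2 ^ n - 1 : ℕ) : ℝ≥0∞) := by
        rw [setLIntegral_const]
    _ ≤ ∫⁻ z in interior (convexHull ℝ (Set.range p)), numDiam (convexHull ℝ (Set.range p)) z :=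
        setLIntegral_mono' isOpen_interior.measurableSet fun z hz =>
          le_numDiam_of_mem_interior_simplex b hz
    _ ≤ _ := lintegral_mono_set interior_subset

lemma IsFullPolytope.meanDiam_eq_iff (hn : n ≠ 0) {P : Set (𝔼 n)} (hP : IsFullPolytope P)
    (hG : GeneralRelPos P) : (meanDiam P).toReal = 2 ^ n - 1 ↔ IsFullSimplex P := by
  refine ⟨hP.isFullSimplex_of_meanDiam_eq hn hG, fun hS => (hP.meanDiam_le hn hG).antisymm ?_⟩
  have h1 := ENNReal.toReal_mono (hP.meanDiam_formula hG).1 (hS.le_meanDiam hP)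
  rw [ENNReal.toReal_natCast, Nat.cast_sub Nat.one_le_two_pow] at h1
  simpa using h1

end

/-! ### Sharpness: generic perturbations of the cross-polytope. -/

section

variable {ι : Type*}

/-- No direction other than `0` is orthogonal to `n` differences `p (c j) - p (s j)` with the
`c j` distinct from each other and from all `s j`. -/
def GenericPoints (p : ι → 𝔼 n) : Prop :=
  ∀ c s : Fin n → ι, Function.Injective c → (∀ i j, c j ≠ s i) → ∀ u : 𝔼 n,
    (∀ j, inner ℝ u (p (c j)) = inner ℝ u (p (s j))) → u = 0

lemma exists_genericPoints [Finite ι] (e : ι → 𝔼 n) {δ : ℝ} (hδ : 0 < δ) :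
    ∃ p : ι → 𝔼 n, (∀ i k, |p i k - e i k| ≤ δ) ∧ GenericPoints p := by
  classical
  have := Fintype.ofFinite ι
  set M : (Fin n → ι) × (Fin n → ι) → Matrix (Fin n) (Fin n) (MvPolynomial (ι × Fin n) ℝ) :=
    fun cs => Matrix.of fun j k => MvPolynomial.X (cs.1 j, k) - MvPolynomial.X (cs.2 j, k) with hM
  set T : Finset ((Fin n → ι) × (Fin n → ι)) := Finset.univ.filter fun cs =>
    Function.Injective cs.1 ∧ ∀ i j, cs.1 j ≠ cs.2 i with hT
  have heval : ∀ cs (x : ι × Fin n → ℝ), MvPolynomial.eval x (M cs).det =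
      (Matrix.of fun j k => x (cs.1 j, k) - x (cs.2 j, k)).det := by
    intro cs x
    rw [RingHom.map_det]
    congr 1
    ext j k
    simp [hM]
  have hne : ∀ cs ∈ T, (M cs).det ≠ 0 := by
    intro cs hcs h0
    obtain ⟨hinj, hdis⟩ := (Finset.mem_filter.1 hcs).2
    -- The points c k are placed at the basis vectors and all others at 0; the matrix becomes the
    -- identity because no s j is among the c k. So the determinant polynomial is nonzero, and the
    -- product of all of them cannot vanish on a box.
    have h1 := heval cs fun ik => if ik.1 = cs.1 ik.2 then 1 else 0
    rw [h0, map_zero] at h1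
    have h2 : (Matrix.of fun j k => (if cs.1 j = cs.1 k then (1 : ℝ) else 0) -
        (if cs.2 j = cs.1 k then 1 else 0)) = 1 := by
      ext j k
      rw [Matrix.of_apply, if_neg (hdis j k).symm, Matrix.one_apply, sub_zero]
      simp only [hinj.eq_iff]
    simp only [h2, Matrix.det_one] at h1
    exact zero_ne_one h1
  have hprod : ∏ cs ∈ T, (M cs).det ≠ 0 := Finset.prod_ne_zero_iff.2 hne
  obtain ⟨x, hx, hx0⟩ : ∃ x ∈ Set.pi Set.univ
      fun ik : ι × Fin n => Set.Icc (e ik.1 ik.2 - δ) (e ik.1 ik.2 + δ),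
      MvPolynomial.eval x (∏ cs ∈ T, (M cs).det) ≠ 0 := by
    by_contra hno
    push Not at hno
    refine hprod (MvPolynomial.funext_set
      (fun ik : ι × Fin n => Set.Icc (e ik.1 ik.2 - δ) (e ik.1 ik.2 + δ))
      (fun ik => Set.Icc_infinite (by linarith)) fun x hx => ?_)
    rw [hno x hx, map_zero]
  rw [map_prod, Finset.prod_ne_zero_iff] at hx0
  refine ⟨fun i => WithLp.toLp 2 fun k => x (i, k), fun i k => ?_, fun c s hc hcs u hu => ?_⟩
  · have := hx (i, k) (Set.mem_univ _)
    rw [abs_le]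
    exact ⟨by change _ ≤ x (i, k) - _; linarith [this.1],
      by change x (i, k) - _ ≤ _; linarith [this.2]⟩
  · have hdet := hx0 (c, s) (Finset.mem_filter.2 ⟨Finset.mem_univ _, hc, hcs⟩)
    rw [heval] at hdet
    have h0 : (fun k => u k) = 0 := by
      refine Matrix.eq_zero_of_mulVec_eq_zero hdet ?_
      ext j
      have := hu j
      rw [PiLp.inner_apply, PiLp.inner_apply] at this
      simp only [Matrix.mulVec, dotProduct, Matrix.of_apply, sub_mul, Finset.sum_sub_distrib,
        Pi.zero_apply]
      rw [sub_eq_zero]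
      simpa [mul_comm] using this
    ext k
    exact congrFun h0 k

lemma setDim_convexHull_image_add_one_le (p : ι → 𝔼 n) {A : Finset ι} (hA : A.Nonempty) :
    setDim (convexHull ℝ (p '' A)) + 1 ≤ A.card := by
  classical
  have h1 : vectorSpan ℝ (convexHull ℝ (p '' A)) = vectorSpan ℝ (p '' A) := by
    rw [← direction_affineSpan, ← direction_affineSpan, affineSpan_convexHull]
  have h2 := finrank_vectorSpan_image_finset_le ℝ p A (n := A.card - 1)
    (by have := hA.card_pos; omega)
  rw [setDim, h1]
  rw [Finset.coe_image] at h2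
  have := hA.card_pos
  omega

/-- If the two faces contained at least n + 2 of the points together, then discarding one base point
from each would leave n differences orthogonal to u, against genericity. With at most n + 1 points
the dimensions of the faces add up to at most n - 1. -/
lemma GenericPoints.generalRelPos [Finite ι] {p : ι → 𝔼 n} (hp : GenericPoints p)
    (hP : IsFullPolytope (convexHull ℝ (Set.range p))) :
    GeneralRelPos (convexHull ℝ (Set.range p)) := by
  classical
  have := Fintype.ofFinite ι
  intro u hu hdim
  set P := convexHull ℝ (Set.range p) with hPdef
  have hu0 : u ≠ 0 := ne_zero_of_norm_eq_one hu
  set A : (𝔼 n) → Finset ι := fun w => Finset.univ.filter fun i => p i ∈ suppSet P w with hA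
  have hmemA : ∀ w i, i ∈ A w ↔ p i ∈ suppSet P w := fun w i => by simp [hA]
  have hsupp : ∀ w, suppSet P w = convexHull ℝ (p '' A w) := by
    intro w
    rw [hPdef, suppSet_convexHull (Set.finite_range p)]
    congr 1
    ext x
    constructor
    · rintro ⟨⟨i, rfl⟩, hi⟩
      exact ⟨i, (hmemA w i).2 hi, rfl⟩
    · rintro ⟨i, hi, rfl⟩
      exact ⟨⟨i, rfl⟩, (hmemA w i).1 hi⟩
  have hAne : ∀ w, (A w).Nonempty := by
    intro w
    have h1 := hP.suppSet_nonempty w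
    rw [hsupp, convexHull_nonempty_iff, Set.image_nonempty] at h1
    exact h1
  have hF := setDim_convexHull_image_add_one_le p (hAne u)
  have hG := setDim_convexHull_image_add_one_le p (hAne (-u))
  rw [← hsupp] at hF hG
  have hsum : setDim (suppSet P u + suppSet P (-u)) ≤
      setDim (suppSet P u) + setDim (suppSet P (-u)) := by
    rw [setDim, vectorSpan_add_eq_sup (hP.suppSet_nonempty u) (hP.suppSet_nonempty (-u))]
    exact Submodule.finrank_add_le_finrank_add_finrank _ _
  suffices hcard : (A u).card + (A (-u)).card ≤ n + 1 by omega
  by_contra hlt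
  push Not at hlt
  have hdisj : Disjoint (A u) (A (-u)) := by
    rw [Finset.disjoint_left]
    intro i h1 h2
    exact lt_irrefl _ (hP.inner_lt hu0 ((hmemA _ _).1 h1) ((hmemA _ _).1 h2))
  obtain ⟨a, ha⟩ := hAne u
  obtain ⟨b, hb⟩ := hAne (-u)
  set R := (A u).erase a ∪ (A (-u)).erase b with hR
  have hRcard : n ≤ R.card := by
    rw [hR, Finset.card_union_of_disjoint (hdisj.mono (Finset.erase_subset _ _)
      (Finset.erase_subset _ _)), Finset.card_erase_of_mem ha, Finset.card_erase_of_mem hb]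
    omega
  set c : Fin n → ι := fun j => (R.equivFin.symm (Fin.castLE hRcard j) : ι) with hc
  have hcR : ∀ j, c j ∈ R := fun j => (R.equivFin.symm (Fin.castLE hRcard j)).2
  have hcinj : Function.Injective c := Subtype.val_injective.comp
    (R.equivFin.symm.injective.comp (Fin.castLE_injective hRcard))
  have hca : ∀ j, c j ≠ a ∧ c j ≠ b := by
    intro j
    rcases Finset.mem_union.1 (hcR j) with h | h
    · exact ⟨Finset.ne_of_mem_erase h, fun hjb => Finset.disjoint_left.1 hdisj
        (Finset.mem_of_mem_erase h) (hjb ▸ hb)⟩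
    · exact ⟨fun hja => Finset.disjoint_left.1 hdisj ha
        (hja ▸ Finset.mem_of_mem_erase h), Finset.ne_of_mem_erase h⟩
  refine hu0 (hp c (fun j => if c j ∈ A u then a else b) hcinj (fun i j => ?_) u fun j => ?_)
  · split_ifs
    · exact (hca j).1
    · exact (hca j).2
  · split_ifs with h
    · exact inner_eq_of_mem_suppSet ((hmemA _ _).1 h) ((hmemA _ _).1 ha)
    · have h' : c j ∈ A (-u) := by
        rcases Finset.mem_union.1 (hcR j) with h1 | h1
        · exact absurd (Finset.mem_of_mem_erase h1) h
        · exact Finset.mem_of_mem_erase h1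
      have := inner_eq_of_mem_suppSet ((hmemA _ _).1 h') ((hmemA _ _).1 hb)
      rw [inner_neg_left, inner_neg_left] at this
      linarith

/-- The vertices `± eᵢ` of the cross-polytope. -/
def crossVertex (i : Fin n × Bool) : 𝔼 n :=
  EuclideanSpace.single i.1 (if i.2 then 1 else -1)

/-- The cross-polytope. -/
def crossPolytope (n : ℕ) : Set (𝔼 n) := convexHull ℝ (Set.range (crossVertex (n := n)))

lemma convex_crossPolytope : Convex ℝ (crossPolytope n) := convex_convexHull ℝ _

lemma isCompact_crossPolytope : IsCompact (crossPolytope n) :=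
  (Set.finite_range _).isCompact_convexHull ℝ

lemma crossVertex_mem (i : Fin n × Bool) : crossVertex i ∈ crossPolytope n :=
  subset_convexHull ℝ _ ⟨i, rfl⟩

lemma single_mem_crossPolytope (i : Fin n) {t : ℝ} (ht : |t| ≤ 1) :
    EuclideanSpace.single i t ∈ crossPolytope n := by
  obtain ⟨h1, h2⟩ := abs_le.1 ht
  have := convex_crossPolytope (crossVertex_mem (i, true)) (crossVertex_mem (i, false))
    (a := (1 + t) / 2) (b := (1 - t) / 2) (by linarith) (by linarith) (by ring)
  convert this using 1
  ext k
  by_cases hk : k = i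
  · subst hk
    simp [crossVertex]
    ring
  · simp [crossVertex, hk]

lemma mem_crossPolytope_of_abs_le (hn : n ≠ 0) {x : 𝔼 n} (hx : ∀ k, |x k| ≤ 1 / n) :
    x ∈ crossPolytope n := by
  have hn' : (0 : ℝ) < n := by positivity
  have h1 := convex_crossPolytope.sum_mem (t := Finset.univ) (w := fun _ : Fin n => (1 / n : ℝ))
    (z := fun i => EuclideanSpace.single i (n * x i)) (fun _ _ => by positivity)
    (by simp [hn]) fun i _ => single_mem_crossPolytope i (by
      have := hx i
      rw [le_div_iff₀ hn'] at this
      rw [abs_mul, abs_of_pos hn']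
      linarith)
  convert h1 using 1
  ext k
  simp [Pi.single_apply, hn]

lemma neg_mem_crossPolytope {x : 𝔼 n} (hx : x ∈ crossPolytope n) : -x ∈ crossPolytope n := by
  have h1 : crossPolytope n ⊆ -crossPolytope n := by
    refine convexHull_min ?_ convex_crossPolytope.neg
    rintro _ ⟨⟨i, b⟩, rfl⟩
    have : -(crossVertex (i, b) : 𝔼 n) = crossVertex (i, !b) := by
      ext k
      by_cases hk : k = i
      · subst hk; cases b <;> simp [crossVertex]
      · cases b <;> simp [crossVertex, hk]
    rw [Set.mem_neg, this]
    exact crossVertex_mem _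
  exact h1 hx

lemma interior_crossPolytope_nonempty (hn : n ≠ 0) : (interior (crossPolytope n)).Nonempty := by
  have hn' : (0 : ℝ) < 1 / n := by positivity
  refine ⟨0, interior_maximal (fun x hx => mem_crossPolytope_of_abs_le hn fun k => ?_)
    Metric.isOpen_ball (Metric.mem_ball_self hn')⟩
  rw [mem_ball_zero_iff] at hx
  exact (PiLp.norm_apply_le x k).trans hx.le

lemma isFullPolytope_of_interior_nonempty [Finite ι] {p : ι → 𝔼 n}
    (h : (interior (convexHull ℝ (Set.range p))).Nonempty) :
    IsFullPolytope (convexHull ℝ (Set.range p)) := by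
  refine ⟨⟨_, Set.finite_range p, ?_, rfl⟩, ?_⟩
  · exact (convexHull_nonempty_iff (𝕜 := ℝ)).1 (h.mono interior_subset)
  · rw [setDim, ← direction_affineSpan, affineSpan_convexHull,
      affineSpan_eq_top_of_nonempty_interior h, AffineSubspace.direction_top, finrank_top,
      finrank_euclideanSpace_fin]

/-- A body close to a convex hull contains a slightly smaller copy of it. -/
lemma smul_convexHull_subset {e p : ι → 𝔼 n} [Finite ι] {ε : ℝ} (h0 : 0 ≤ ε)
    (h1 : ε < 1)
    (h : ∀ i, ∃ y ∈ convexHull ℝ (Set.range e), e i = p i + ε • y) :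
    (1 - ε) • convexHull ℝ (Set.range e) ⊆ convexHull ℝ (Set.range p) := by
  set C := convexHull ℝ (Set.range e) with hC
  set P := convexHull ℝ (Set.range p) with hP
  have hsub : C ⊆ P + ε • C := by
    refine convexHull_min ?_ ((convex_convexHull ℝ _).add ((convex_convexHull ℝ _).smul ε))
    rintro _ ⟨i, rfl⟩
    obtain ⟨y, hy, e⟩ := h i
    exact ⟨p i, subset_convexHull ℝ _ ⟨i, rfl⟩, _, Set.smul_mem_smul_set hy, e.symm⟩
  rintro _ ⟨x, hx, rfl⟩
  by_contra hxP
  obtain ⟨f, r, hf, hfx⟩ := geometric_hahn_banach_closed_point (convex_convexHull ℝ _)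
    ((Set.finite_range p).isCompact_convexHull ℝ).isClosed hxP
  -- At a maximizer m of f on C, written q + εy, f(y) ≤ f(m) gives (1-ε)f(m) ≤ f(q), contrary to the
  -- separation.
  obtain ⟨m, hm, hmax⟩ := ((Set.finite_range e).isCompact_convexHull ℝ).exists_isMaxOn ⟨x, hx⟩
    f.continuous.continuousOn
  obtain ⟨q, hq, _, ⟨y, hy, rfl⟩, hqy⟩ := hsub hm
  have h2 := hf q hq
  have h3 : f x ≤ f m := hmax hx
  have h4 : f y ≤ f m := hmax hy
  have h5 : f m = f q + ε * f y := by rw [← hqy]; simp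
  simp only [map_smul, smul_eq_mul] at hfx
  nlinarith

/-- By symmetry and convexity every (1-t)P - tP stays inside D, so the integral is at most V(D). -/
lemma IsFullPolytope.meanDiam_le_of_subset {P D : Set (𝔼 n)} (hP : IsFullPolytope P)
    (hG : GeneralRelPos P) (hD : IsCompact D) (hconv : Convex ℝ D) (hneg : ∀ x ∈ D, -x ∈ D)
    (hPD : P ⊆ D) :
    (meanDiam P).toReal ≤ (n + 1) * (volume.real D / volume.real P) - 1 := by
  rw [(hP.meanDiam_formula hG).2, div_mul_eq_mul_div, mul_div_assoc]
  have h1 : ‖∫ t in (0 : ℝ)..1, volume.real ((1 - t) • P - t • P)‖ ≤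
      volume.real D * |1 - 0| := by
    refine intervalIntegral.norm_integral_le_of_norm_le_const fun t ht => ?_
    rw [Set.uIoc_of_le zero_le_one] at ht
    rw [Real.norm_of_nonneg measureReal_nonneg]
    refine measureReal_mono ?_ hD.measure_lt_top.ne
    rintro _ ⟨_, ⟨x, hx, rfl⟩, _, ⟨y, hy, rfl⟩, rfl⟩
    have := hconv (hPD hx) (hneg y (hPD hy)) (sub_nonneg.2 ht.2) ht.1.le (by ring)
    simpa [sub_eq_add_neg] using this
  have h2 := (Real.le_norm_self _).trans h1
  rw [sub_zero, abs_one, mul_one] at h2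
  have := hP.volumeReal_pos
  gcongr

lemma exists_meanDiam_lt (hn : n ≠ 0) {c : ℝ} (hc : n < c) :
    ∃ P : Set (𝔼 n), IsFullPolytope P ∧ GeneralRelPos P ∧ (meanDiam P).toReal < c := by
  obtain ⟨ε, ⟨hε0, hε1⟩, hε⟩ : ∃ ε ∈ Set.Ioo (0 : ℝ) 1,
      (n + 1) * ((1 + ε) ^ n / (1 - ε) ^ n) - 1 < c := by
    have hcont : ContinuousAt (fun ε : ℝ => (n + 1) * ((1 + ε) ^ n / (1 - ε) ^ n) - 1) 0 := by
      refine ContinuousAt.sub (ContinuousAt.mul continuousAt_const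
        (ContinuousAt.div (by fun_prop) (by fun_prop) (by simp))) continuousAt_const
    have h1 : ∀ᶠ ε in nhdsWithin (0 : ℝ) (Set.Ioi 0),
        (n + 1) * ((1 + ε) ^ n / (1 - ε) ^ n) - 1 < c :=
      (hcont.eventually (gt_mem_nhds (by simpa using hc))).filter_mono nhdsWithin_le_nhds
    have h0 : ∀ᶠ ε in nhdsWithin (0 : ℝ) (Set.Ioi 0), ε ∈ Set.Ioo (0 : ℝ) 1 :=
      Ioo_mem_nhdsGT zero_lt_one
    obtain ⟨ε, h2, h3⟩ := (h0.and h1).exists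
    exact ⟨ε, h2, h3⟩
  have hn' : (0 : ℝ) < n := by positivity
  -- The cross-polytope contains the cube of half-side 1/n, so perturbing coordinates by at most ε/n
  -- moves each vertex within ε times the cross-polytope.
  obtain ⟨p, hp, hgen⟩ := exists_genericPoints (crossVertex (n := n)) (δ := ε / n) (by positivity)
  have hdiff : ∀ i, ∃ y ∈ crossPolytope n, p i = crossVertex i + ε • y := by
    intro i
    refine ⟨ε⁻¹ • (p i - crossVertex i), mem_crossPolytope_of_abs_le hn fun k => ?_, ?_⟩
    · have := hp i k
      rw [PiLp.smul_apply, PiLp.sub_apply, smul_eq_mul, abs_mul, abs_of_pos (inv_pos.2 hε0)]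
      calc ε⁻¹ * |p i k - crossVertex i k| ≤ ε⁻¹ * (ε / n) := by gcongr
        _ = 1 / n := by field_simp
    · rw [smul_inv_smul₀ hε0.ne']; abel
  set P := convexHull ℝ (Set.range p) with hPdef
  have hsub : (1 - ε) • crossPolytope n ⊆ P := by
    refine smul_convexHull_subset hε0.le hε1 fun i => ?_
    obtain ⟨y, hy, h⟩ := hdiff i
    exact ⟨-y, neg_mem_crossPolytope hy, by rw [h]; module⟩
  have hsup : P ⊆ (1 + ε) • crossPolytope n := by
    refine convexHull_min ?_ (convex_crossPolytope.smul _)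
    rintro _ ⟨i, rfl⟩
    obtain ⟨y, hy, h⟩ := hdiff i
    rw [h, convex_crossPolytope.add_smul zero_le_one hε0.le, one_smul]
    exact Set.add_mem_add (crossVertex_mem i) (Set.smul_mem_smul_set hy)
  have h1ε : 0 < 1 - ε := sub_pos.2 hε1
  have hint : (interior P).Nonempty := by
    obtain ⟨x, hx⟩ := interior_crossPolytope_nonempty hn
    refine ⟨(1 - ε) • x, interior_maximal ?_ (isOpen_interior.smul₀ h1ε.ne')
      (Set.smul_mem_smul_set hx)⟩
    exact (Set.smul_set_mono interior_subset).trans hsub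
  have hP : IsFullPolytope P := isFullPolytope_of_interior_nonempty hint
  have hG : GeneralRelPos P := hgen.generalRelPos hP
  refine ⟨P, hP, hG, lt_of_le_of_lt (hP.meanDiam_le_of_subset hG
    (isCompact_crossPolytope.smul (1 + ε)) (convex_crossPolytope.smul _) ?_ hsup)
    (lt_of_le_of_lt ?_ hε)⟩
  · rintro _ ⟨x, hx, rfl⟩
    exact ⟨-x, neg_mem_crossPolytope hx, by simp⟩
  · have hvol : ∀ r : ℝ, 0 ≤ r → volume.real (r • crossPolytope n) =
        r ^ n * volume.real (crossPolytope n) := by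
      intro r hr
      rw [Measure.real, Measure.addHaar_smul, finrank_euclideanSpace_fin,
        abs_of_nonneg (by positivity), ENNReal.toReal_mul, ENNReal.toReal_ofReal (by positivity)]
      rfl
    have h1 := measureReal_mono (μ := volume) hsub hP.volume_ne_top
    rw [hvol _ h1ε.le] at h1
    rw [hvol _ (by linarith)]
    have hC : 0 < volume.real (crossPolytope n) :=
      ENNReal.toReal_pos ((isOpen_interior.measure_pos volume
        (interior_crossPolytope_nonempty hn)).trans_le (measure_mono interior_subset)).ne'
        isCompact_crossPolytope.measure_lt_top.ne
    have h2 : (1 + ε) ^ n * volume.real (crossPolytope n) / volume.real P ≤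
        (1 + ε) ^ n / (1 - ε) ^ n := by
      rw [div_le_div_iff₀ hP.volumeReal_pos (by positivity)]
      calc (1 + ε) ^ n * volume.real (crossPolytope n) * (1 - ε) ^ n =
          (1 + ε) ^ n * ((1 - ε) ^ n * volume.real (crossPolytope n)) := by ring
        _ ≤ _ := by gcongr
    gcongr

end

end AffineDiam

end


theorem theorem1 (n : ℕ) (hn : 1 ≤ n) :
    (∀ P : Set (EuclideanSpace ℝ (Fin n)),
      AffineDiam.IsFullPolytope P → AffineDiam.GeneralRelPos P →
        AEMeasurable (AffineDiam.numDiam P) (volume.restrict P) ∧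
        AffineDiam.meanDiam P ≠ ∞ ∧
        (AffineDiam.meanDiam P).toReal =
          ((n : ℝ) + 1) / volume.real P *
            (∫ t in (0 : ℝ)..1, volume.real ((1 - t) • P - t • P)) - 1 ∧
        (n : ℝ) ≤ (AffineDiam.meanDiam P).toReal ∧
        (2 ≤ n → (n : ℝ) < (AffineDiam.meanDiam P).toReal) ∧
        (AffineDiam.meanDiam P).toReal ≤ 2 ^ n - 1 ∧
        ((AffineDiam.meanDiam P).toReal = 2 ^ n - 1 ↔ AffineDiam.IsFullSimplex P)) ∧
    (∀ c : ℝ, (n : ℝ) < c →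
      ∃ P : Set (EuclideanSpace ℝ (Fin n)),
        AffineDiam.IsFullPolytope P ∧ AffineDiam.GeneralRelPos P ∧
          (AffineDiam.meanDiam P).toReal < c) := by
  have hn0 : n ≠ 0 := by omega
  refine ⟨fun P hP hG => ⟨(hP.aemeasurable_numDiam hG).restrict, (hP.meanDiam_formula hG).1,
    (hP.meanDiam_formula hG).2, hP.le_meanDiam hG, hP.lt_meanDiam hG, hP.meanDiam_le hn0 hG,
    hP.meanDiam_eq_iff hn0 hG⟩, fun c hc => AffineDiam.exists_meanDiam_lt hn0 hc⟩
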